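/- Let $\mathbb{T}=\mathbb{R}/\mathbb{Z}$ with Lebesgue measure $|\cdot|$ (also written $dx$). An environment is a sequence $(T_n,W_n)_{n\in\mathbb{Z}}$ of maps $T_n:\mathbb{T}\to\mathbb{T}$ and arcs $W_n\subset\mathbb{T}$ (backward gates). The walk on $\mathbb{T}\times\mathbb{Z}$ is $F(x,z)=(T_zx,\,z-1)$ if $x\in W_z$ and $F(x,z)=(T_zx,\,z+1)$ if $x\notin W_z$. Let $\tau_n(x,k)$ be the smallest $t\ge 0$ such that $F^t(x,k)\in\mathbb{T}\times\{n\}$, and put $\tau_n(x)=\tau_n(x,0)$, $r_n(x)=\tau_{n+1}(x,n)$, $G_n(x)=\pi_{\mathbb{T}}F^{r_n(x)}(x,n)$, $G_{1,i}=G_i\circ\dots\circ G_1$, and $$\sigma_n^2=\int_{\mathbb{T}}\Big[\sum_{i=1}^n\Big(r_i(G_{1,i}x)-\int_{\mathbb{T}}r_i(G_{1,i}y)\,dy\Big)\Big]^2dx .$$ Model A with constants $\gamma,K,K_1,c,\delta_0$: for every $n\in\mathbb{Z}$, $T_n$ is $C^{1}$ with $\gamma\le|T_n'|\le K$ and $\mathrm{Lip}(T_n')\le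 K_1$; $c\delta_0\le|W_n|\le\delta_0$; and $T_n(W_n)\cap W_{n-1}=\emptyset$, $T_{n-1}T_n(W_n)\cap W_n=\emptyset$. Model B with reference pair $(\bar T,\bar W)$ and constant $\delta_0$: here $\bar T:\mathbb{T}\to\mathbb{T}$ is $C^{1+\mathrm{Lip}}$ with $\inf|\bar T'|>3$ and $\bar W$ is a non-degenerate closed arc with $\bar T^p\bar W\cap\bar W=\emptyset$ for $p=1,2$; for every $n\in\mathbb{Z}$, $|T_n-\bar T|_{C^{1+\mathrm{Lip}}}\le\delta_0$ and the Hausdorff distance between $W_n$ and $\bar W$ is smaller than $\delta_0$. Lemma. (A) For all constants $3<\gamma\le K$, $K_1>0$, $c>0$ there is $\bar\delta_0>0$ such that the following holds for every $0<\delta_0\le\bar\delta_0$. Let $E=\{(\mathcal{T}_1,\mathcal{W}_1),\dots,(\mathcal{T}_m,\mathcal{W}_m)\}$ be a finite collection such that every sequence $(T_n,W_n)_{n\in\mathbb{Z}}$ with values in $E$ satisfies the conditions of Model A with constants $\gamma,K,K_1,c,\delta_0$, and let the pairs $(T_n,W_n)$, $n\in\mathbb{Z}$, be chosen from $E$ independently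 with a common law $\nu$. Then there is a constant $C>0$ such that for almost every realization, for all sufficiently large $n$, $$\sigma_n^2\ge Cn\qquad\text{and}\qquad \mathrm{Var}(\tau_n)\ge Cn,$$ where $\mathrm{Var}(\tau_n)$ is the variance of $\tau_n(x)$ for $x$ uniformly distributed on $\mathbb{T}$. (B) For every $(\bar T,\bar W)$ as above there is $\bar\delta_0>0$ such that the same conclusion holds for every $0<\delta_0\le\bar\delta_0$ and every finite collection $E$ such that every sequence with values in $E$ satisfies the conditions of Model B with reference pair $(\bar T,\bar W)$ and constant $\delta_0$. -/

import Mathlib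

open MeasureTheory ProbabilityTheory Filter

/-- A pair (map of the circle `ℝ/ℤ`, backward gate `W = W₋₁`).
The forward gate is the complement of `gate`. -/
structure MapGate where
  map : UnitAddCircle → UnitAddCircle
  gate : Set UnitAddCircle

namespace DynWalk

/-- An arc of the circle: the image of an interval of `ℝ` of any kind
(open, closed or half-open). -/
def IsArc (W : Set UnitAddCircle) : Prop :=
  ∃ I : Set ℝ, I.OrdConnected ∧ W = (fun t : ℝ => (t : UnitAddCircle)) '' I

/-- A closed arc with non-empty interior (the image of `[a, b]`, `a < b`). -/
def IsSegment (W : Set UnitAddCircle) : Prop :=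
  ∃ a b : ℝ, a < b ∧ W = (fun t : ℝ => (t : UnitAddCircle)) '' Set.Icc a b

/-- `T` is a `C^{1+Lip}` map of the circle with `γ ≤ |T'| ≤ K` and `Lip(T') ≤ K₁`.
The derivative of `T` at `t mod 1` is the derivative at `t` of a lift `f : ℝ → ℝ` of `T`. -/
def ExpandingBounds (γ K K₁ : ℝ) (T : UnitAddCircle → UnitAddCircle) : Prop :=
  ∃ f : ℝ → ℝ, ContDiff ℝ 1 f ∧ (∀ t : ℝ, T (t : UnitAddCircle) = (f t : UnitAddCircle)) ∧
    (∀ t, γ ≤ |deriv f t| ∧ |deriv f t| ≤ K) ∧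
    ∀ s t, |deriv f s - deriv f t| ≤ K₁ * |s - t|

/-- `|T - T'|_{C^{1+Lip}} ≤ δ`: `T = T' + h` with `h` a real-valued `C^{1+Lip}` function on the
circle (a `1`-periodic function on `ℝ`) such that `sup |h|`, `sup |h'|` and `Lip(h')` are at most
`δ`. -/
def C1LipClose (δ : ℝ) (T T' : UnitAddCircle → UnitAddCircle) : Prop :=
  ∃ h : ℝ → ℝ, ContDiff ℝ 1 h ∧ Function.Periodic h 1 ∧
    (∀ t : ℝ, T (t : UnitAddCircle) = T' (t : UnitAddCircle) + (h t : UnitAddCircle)) ∧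
    (∀ t, |h t| ≤ δ) ∧ (∀ t, |deriv h t| ≤ δ) ∧
    ∀ s t, |deriv h s - deriv h t| ≤ δ * |s - t|

/-- The conditions of Model A for an environment `e = (T_n, W_n)_{n ∈ ℤ}`. -/
structure ModelA (γ K K₁ c δ₀ : ℝ) (e : ℤ → MapGate) : Prop where
  bounds : ∀ n, ExpandingBounds γ K K₁ (e n).map
  arc : ∀ n, IsArc (e n).gate
  gate_lower : ∀ n, c * δ₀ ≤ volume.real (e n).gate
  gate_upper : ∀ n, volume.real (e n).gate ≤ δ₀
  disjoint_one : ∀ n, (e n).map '' (e n).gate ∩ (e (n - 1)).gate = ∅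
  disjoint_two : ∀ n, (e (n - 1)).map '' ((e n).map '' (e n).gate) ∩ (e n).gate = ∅

/-- The conditions on the reference map and reference gate of Model B. -/
structure ModelBReference (T : UnitAddCircle → UnitAddCircle) (W : Set UnitAddCircle) :
    Prop where
  bounds : ∃ γ K K₁ : ℝ, 3 < γ ∧ ExpandingBounds γ K K₁ T
  segment : IsSegment W
  disjoint_one : T '' W ∩ W = ∅
  disjoint_two : T '' (T '' W) ∩ W = ∅

/-- The conditions of Model B for an environment `e = (T_n, W_n)_{n ∈ ℤ}`, relative to the
reference pair `(T, W)`. -/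
structure ModelB (T : UnitAddCircle → UnitAddCircle) (W : Set UnitAddCircle) (δ₀ : ℝ)
    (e : ℤ → MapGate) : Prop where
  close : ∀ n, C1LipClose δ₀ (e n).map T
  arc : ∀ n, IsArc (e n).gate
  gate_close : ∀ n, Metric.hausdorffEDist (e n).gate W < ENNReal.ofReal δ₀

open Classical in
/-- One step `F` of the walk: a particle with internal state `x` at site `z` gets the internal
state `T_z x`, and moves to `z - 1` if `x ∈ W_z` and to `z + 1` otherwise. -/
noncomputable def step (e : ℤ → MapGate) (p : UnitAddCircle × ℤ) : UnitAddCircle × ℤ :=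
  ((e p.2).map p.1, if p.1 ∈ (e p.2).gate then p.2 - 1 else p.2 + 1)

/-- `τ_n(x, k)`: the smallest time `t` at which the walk started from `(x, k)` is at site `n`. -/
noncomputable def hitTime (e : ℤ → MapGate) (n : ℤ) (x : UnitAddCircle) (k : ℤ) : ℕ :=
  sInf {t : ℕ | ((step e)^[t] (x, k)).2 = n}

/-- `r_n(x) = τ_{n+1}(x, n)`: the time needed to get from site `n` to site `n + 1`. -/
noncomputable def passTime (e : ℤ → MapGate) (n : ℤ) (x : UnitAddCircle) : ℕ :=
  hitTime e (n + 1) x n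

/-- The induced map `G_n`: the internal state at the first visit to site `n + 1`, as a function
of the internal state at site `n`. -/
noncomputable def inducedMap (e : ℤ → MapGate) (n : ℤ) (x : UnitAddCircle) : UnitAddCircle :=
  ((step e)^[passTime e n x] (x, n)).1

/-- `G_{1,i} = G_i ∘ ⋯ ∘ G_1` (the identity for `i = 0`). -/
noncomputable def inducedComp (e : ℤ → MapGate) : ℕ → UnitAddCircle → UnitAddCircle
  | 0 => id
  | i + 1 => inducedMap e ((i : ℤ) + 1) ∘ inducedComp e i

/-- `σ_n² = ∫ [∑_{i=1}^n (r_i(G_{1,i} x) - ∫ r_i(G_{1,i} y) dy)]² dx`. -/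
noncomputable def sigmaSq (e : ℤ → MapGate) (n : ℕ) : ℝ :=
  ∫ x : UnitAddCircle, (∑ i ∈ Finset.Icc 1 n,
    ((passTime e i (inducedComp e i x) : ℝ) -
      ∫ y : UnitAddCircle, (passTime e i (inducedComp e i y) : ℝ))) ^ 2

/-- The variance of the hitting time `τ_n(x) = τ_n(x, 0)` for `x` uniformly distributed on the
circle. -/
noncomputable def hitVar (e : ℤ → MapGate) (n : ℕ) : ℝ :=
  variance (fun x : UnitAddCircle => (hitTime e n x 0 : ℝ)) volume

/-- The environment obtained by choosing at each site `n` the pair of index `ω n` in a finite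
collection. -/
def envOf {m : ℕ} (E : Fin m → MapGate) (ω : ℤ → Fin m) : ℤ → MapGate := fun n => E (ω n)

/-- Linear growth of variance for the iid selection with marginal law `ν` from the collection
`E`: for some constant `C > 0`, almost surely both `σ_n²` and the variance of the hitting time
`τ_n` are at least `C n` for all large `n`. -/
def LinearVarianceGrowth {m : ℕ} (E : Fin m → MapGate) (ν : Measure (Fin m))
    [IsProbabilityMeasure ν] : Prop :=
  ∃ C : ℝ, 0 < C ∧ ∀ᵐ ω ∂(Measure.infinitePi fun _ : ℤ => ν), ∀ᶠ n : ℕ in atTop,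
    C * n ≤ sigmaSq (envOf E ω) n ∧ C * n ≤ hitVar (envOf E ω) n

end DynWalk

/-! The disjointness conditions say that a step backward is followed by two steps forward. Hence
`passTime` is 3 on the gate and 1 off it, and both quantities to be bounded are four times a mean
square deviation of the number of visits to gates along a non-autonomous composition of the induced
maps. The bound is proved for every realization, with constants that depend only on the finite
family; independence plays no role.

Let `dens j` be the density of the state at time `j`, and `past j` the transported centred count of
earlier visits. Their quotient `cm j` is the conditional mean of that count given the present state,
and the increments `incr j` are reverse martingale differences: the transfer operator kills `dens j
* incr j`. So the mean square deviation is the sum of the energies of the increments plus a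
nonnegative remainder (`Chain.energy_eq`), and it suffices that each block of `L` steps contributes
at least a fixed `δ`.

For this, suppose that no visit occurs during a block. The increments then telescope to a difference
of two values of `cm` minus the sum of the expected visits. If `|cm| ≤ U` and the expected visits
are bounded below, a long block makes this sum at most -1, so by Cauchy–Schwarz the squares add up
to at least `1 / L`. Having no visit has probability bounded below: the expansion exceeds 3, so
every point has three different preimages among any three consecutive branches, while the gate of
the map and the gate being counted contain at most one each (`System.op_avoid_ge`,
`Chain.integral_avoid`).

The bounds on `cm` and `dens` come from uniform loss of memory. Cutting along a gate at most doubles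
the variation, up to a multiple of the integral, and each branch contracts it by nearly `1 / γ`, so
expansion above 3 gives a Lasota–Yorke inequality with factor 3/4 (`System.op_hasVar`). An interval
cut by a gate keeps a piece of a third of its length, which still grows by `γ / 3 > 1`, so
positivity spreads to the whole circle (`System.exists_mixing`). Together these contract a cone of
densities, and `past j` is a geometrically damped sum (`Chain.past_diff`).

Everything is done on `ℝ` with 1-periodic functions. The lift of an expanding map is a bijection of
the line, so its inverse branches are translates of a single function. -/

namespace DynWalk

/-! ### Periodic functions of bounded variation -/

/-- The increments of `f` are dominated by those of `m`. -/
def Dominates (m f : ℝ → ℝ) : Prop := ∀ s t, s ≤ t → |f t - f s| ≤ m t - m s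

/-- `f` is `1`-periodic and has variation at most `V` over a period. -/
def HasVar (f : ℝ → ℝ) (V : ℝ) : Prop :=
  Function.Periodic f 1 ∧ ∃ m : ℝ → ℝ, (∀ t, m (t + 1) = m t + V) ∧ Dominates m f

/-- Bounded measurable functions of period one. -/
structure Obs (f : ℝ → ℝ) : Prop where
  per : Function.Periodic f 1
  meas : Measurable f
  bdd : ∃ C, ∀ t, |f t| ≤ C

theorem Dominates.mono {m f : ℝ → ℝ} (h : Dominates m f) : Monotone m := fun s t hst => by
  have := h s t hst
  have := abs_nonneg (f t - f s)
  linarith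

/-- Jordan decomposition: both `f + m` and `m` are monotone. -/
theorem Dominates.measurable {m f : ℝ → ℝ} (h : Dominates m f) : Measurable f := by
  have h1 : Monotone (fun t => f t + m t) := fun s t hst => by
    have := h s t hst
    have := neg_abs_le (f t - f s)
    simp only
    linarith
  have : f = fun t => (f t + m t) - m t := by funext t; ring
  rw [this]
  exact h1.measurable.sub h.mono.measurable

theorem exists_mem_period (s t : ℝ) : ∃ k : ℤ, s ≤ t + k ∧ t + k < s + 1 := by
  refine ⟨-⌊t - s⌋, ?_, ?_⟩
  · have := Int.floor_le (t - s); push_cast; linarith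
  · have := Int.lt_floor_add_one (t - s); push_cast; linarith

theorem periodic_int {α : Type*} {f : ℝ → α} (hf : Function.Periodic f 1) (t : ℝ) (k : ℤ) :
    f (t + k) = f t := by
  have := hf.int_mul k t
  simpa using this

namespace HasVar

variable {f g : ℝ → ℝ} {V V' : ℝ}

theorem abs_sub_le (h : HasVar f V) (s t : ℝ) : |f t - f s| ≤ V := by
  obtain ⟨hp, m, hm, hd⟩ := h
  obtain ⟨k, hk1, hk2⟩ := exists_mem_period s t
  rw [← periodic_int hp t k]
  have h1 := hd s _ hk1
  have h2 := hd.mono hk2.le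
  have := hm s
  linarith

theorem nonneg (h : HasVar f V) : 0 ≤ V := by simpa using h.abs_sub_le 0 0

theorem measurable (h : HasVar f V) : Measurable f := by
  obtain ⟨_, m, _, hd⟩ := h
  exact hd.measurable

theorem obs (h : HasVar f V) : Obs f := ⟨h.1, h.measurable, |f 0| + V, fun t => by
  have h1 := h.abs_sub_le 0 t
  have := abs_sub_abs_le_abs_sub (f t) (f 0)
  linarith⟩

theorem const (c : ℝ) : HasVar (fun _ => c) 0 :=
  ⟨fun _ => rfl, fun _ => 0, by simp, fun s t _ => by simp⟩

theorem add (hf : HasVar f V) (hg : HasVar g V') : HasVar (fun t => f t + g t) (V + V') := by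
  obtain ⟨hp, m, hm, hd⟩ := hf
  obtain ⟨hp', m', hm', hd'⟩ := hg
  refine ⟨fun t => by simp only [hp t, hp' t], fun t => m t + m' t,
    fun t => by simp only [hm, hm']; ring, fun s t hst => ?_⟩
  have h1 := hd s t hst
  have h2 := hd' s t hst
  have h3 := abs_add_le (f t - f s) (g t - g s)
  have h4 : f t + g t - (f s + g s) = (f t - f s) + (g t - g s) := by ring
  rw [h4]
  linarith

theorem smul (hf : HasVar f V) {c : ℝ} (hc : 0 ≤ c) : HasVar (fun t => c * f t) (c * V) := by
  obtain ⟨hp, m, hm, hd⟩ := hf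
  refine ⟨fun t => by simp only [hp t], fun t => c * m t,
    fun t => by simp only [hm]; ring, fun s t hst => ?_⟩
  have h1 := mul_le_mul_of_nonneg_left (hd s t hst) hc
  rw [← mul_sub, abs_mul, abs_of_nonneg hc]
  linarith

theorem add_const (hf : HasVar f V) (c : ℝ) : HasVar (fun t => f t + c) V := by
  simpa using hf.add (HasVar.const c)

theorem weaken (hf : HasVar f V) (h : V ≤ V') : HasVar f V' := by
  obtain ⟨hp, m, hm, hd⟩ := hf
  refine ⟨hp, fun t => m t + (V' - V) * t, fun t => by simp only [hm]; ring, fun s t hst => ?_⟩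
  have h1 := hd s t hst
  nlinarith

end HasVar

namespace Obs

variable {f g : ℝ → ℝ}

theorem const (c : ℝ) : Obs (fun _ => c) := ⟨fun _ => rfl, measurable_const, |c|, fun _ => le_rfl⟩

theorem add (hf : Obs f) (hg : Obs g) : Obs (fun t => f t + g t) := by
  obtain ⟨C, hC⟩ := hf.bdd
  obtain ⟨D, hD⟩ := hg.bdd
  exact ⟨fun t => by simp only [hf.per t, hg.per t], hf.meas.add hg.meas, C + D,
    fun t => (abs_add_le _ _).trans (add_le_add (hC t) (hD t))⟩

theorem mul (hf : Obs f) (hg : Obs g) : Obs (fun t => f t * g t) := by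
  obtain ⟨C, hC⟩ := hf.bdd
  obtain ⟨D, hD⟩ := hg.bdd
  refine ⟨fun t => by simp only [hf.per t, hg.per t], hf.meas.mul hg.meas, C * D, fun t => ?_⟩
  rw [abs_mul]
  exact mul_le_mul (hC t) (hD t) (abs_nonneg _) ((abs_nonneg _).trans (hC t))

theorem smul (hf : Obs f) (c : ℝ) : Obs (fun t => c * f t) := (const c).mul hf

theorem sub (hf : Obs f) (hg : Obs g) : Obs (fun t => f t - g t) := by
  have := hf.add (hg.smul (-1))
  simpa [sub_eq_add_neg] using this

theorem indicator (hf : Obs f) {A : Set ℝ} (hA : MeasurableSet A)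
    (hper : ∀ t, t + 1 ∈ A ↔ t ∈ A) : Obs (A.indicator f) := by
  obtain ⟨C, hC⟩ := hf.bdd
  refine ⟨fun t => ?_, hf.meas.indicator hA, C, fun t => ?_⟩
  · by_cases h : t ∈ A
    · rw [Set.indicator_of_mem h, Set.indicator_of_mem ((hper t).2 h), hf.per]
    · rw [Set.indicator_of_notMem h, Set.indicator_of_notMem (mt (hper t).1 h)]
  · by_cases h : t ∈ A
    · rw [Set.indicator_of_mem h]; exact hC t
    · rw [Set.indicator_of_notMem h, abs_zero]; exact (abs_nonneg _).trans (hC t)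

theorem intervalIntegrable (hf : Obs f) (a b : ℝ) : IntervalIntegrable f volume a b := by
  obtain ⟨C, hC⟩ := hf.bdd
  rw [intervalIntegrable_iff]
  exact Measure.integrableOn_of_bounded (M := C) (by simp) hf.meas.aestronglyMeasurable
    (Eventually.of_forall fun t => hC t)

theorem integral_period (hf : Obs f) (a : ℝ) : ∫ t in a..a + 1, f t = ∫ t in (0 : ℝ)..1, f t := by
  simpa using hf.per.intervalIntegral_add_eq a 0

theorem integral_add (hf : Obs f) (hg : Obs g) (a b : ℝ) :
    ∫ t in a..b, (f t + g t) = (∫ t in a..b, f t) + ∫ t in a..b, g t :=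
  intervalIntegral.integral_add (hf.intervalIntegrable a b) (hg.intervalIntegrable a b)

theorem integral_sub (hf : Obs f) (hg : Obs g) (a b : ℝ) :
    ∫ t in a..b, (f t - g t) = (∫ t in a..b, f t) - ∫ t in a..b, g t :=
  intervalIntegral.integral_sub (hf.intervalIntegrable a b) (hg.intervalIntegrable a b)

theorem integral_mono (hf : Obs f) (hg : Obs g) (h : ∀ t, f t ≤ g t) {a b : ℝ} (hab : a ≤ b) :
    ∫ t in a..b, f t ≤ ∫ t in a..b, g t :=
  intervalIntegral.integral_mono hab (hf.intervalIntegrable a b) (hg.intervalIntegrable a b)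
    fun t => h t

end Obs

theorem HasVar.le_integral {f : ℝ → ℝ} {V : ℝ} (h : HasVar f V) (t : ℝ) :
    f t ≤ (∫ s in (0 : ℝ)..1, f s) + V := by
  have h1 := (Obs.const (f t - V)).integral_mono h.obs
    (fun s => by have := (abs_le.1 (h.abs_sub_le s t)).2; linarith) zero_le_one
  simp at h1
  linarith

/-- Some point of an interval has value at most the average. -/
theorem exists_mul_le_integral {f : ℝ → ℝ} (hf : Obs f) {a b : ℝ} (hab : a < b) :
    ∃ r ∈ Set.Ioo a b, f r * (b - a) ≤ ∫ t in a..b, f t := by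
  by_contra! hcon
  have h0 : 0 < b - a := by linarith
  set I := ∫ t in a..b, f t with hI
  have h1 : ∫ t in a..b, (f t - I / (b - a)) = 0 := by
    rw [hf.integral_sub (Obs.const _)]
    simp only [intervalIntegral.integral_const, smul_eq_mul]
    field_simp
    rw [hI]; ring
  have h2 : 0 < ∫ t in a..b, (f t - I / (b - a)) := by
    refine intervalIntegral.intervalIntegral_pos_of_pos_on
      ((hf.sub (Obs.const _)).intervalIntegrable a b) (fun x hx => ?_) hab
    have := hcon x hx
    rw [sub_pos, div_lt_iff₀ h0]
    exact this
  linarith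

/-- Domination at small scales implies domination. -/
theorem Dominates.of_local {m f : ℝ → ℝ} {η : ℝ} (hη : 0 < η)
    (h : ∀ s t, s ≤ t → t ≤ s + η → |f t - f s| ≤ m t - m s) : Dominates m f := by
  have key : ∀ n : ℕ, ∀ s t, s ≤ t → t ≤ s + n * η → |f t - f s| ≤ m t - m s := by
    intro n
    induction n with
    | zero =>
      intro s t h1 h2
      have : t = s := by simp at h2; linarith
      simp [this]
    | succ n ih =>
      intro s t h1 h2
      by_cases h3 : t ≤ s + η
      · exact h s t h1 h3
      · have h4 := h s (s + η) (by linarith) le_rfl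
        have h5 := ih (s + η) t (by linarith) (by push_cast at h2; linarith)
        have h6 := abs_sub_le (f t) (f (s + η)) (f s)
        linarith
  intro s t hst
  obtain ⟨n, hn⟩ := exists_nat_ge ((t - s) / η)
  refine key n s t hst ?_
  rw [div_le_iff₀ hη] at hn
  linarith

/-- Variation of a periodic function can be measured on one closed period. -/
theorem HasVar.of_period {f m : ℝ → ℝ} (hf : Function.Periodic f 1) (p : ℝ)
    (h : ∀ s t, p ≤ s → s ≤ t → t ≤ p + 1 → |f t - f s| ≤ m t - m s) :
    HasVar f (m (p + 1) - m p) := by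
  set V := m (p + 1) - m p with hV
  have hV0 : 0 ≤ V := (abs_nonneg _).trans (h p (p + 1) le_rfl (by linarith) le_rfl)
  -- The dominating function repeats the increments of `m` on every period; the floor counts the
  -- periods between `p` and `t`.
  refine ⟨hf, fun t => m (t - ⌊t - p⌋) + ⌊t - p⌋ * V, fun t => ?_, fun s t hst => ?_⟩
  · have : t + 1 - p = (t - p) + 1 := by ring
    simp only [this, Int.floor_add_one]
    push_cast
    have : t + 1 - ((⌊t - p⌋ : ℝ) + 1) = t - ⌊t - p⌋ := by ring
    rw [this]; ring
  · set k := ⌊s - p⌋ with hk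
    set l := ⌊t - p⌋ with hl
    have hs1 := Int.floor_le (s - p)
    have hs2 := Int.lt_floor_add_one (s - p)
    have ht1 := Int.floor_le (t - p)
    have ht2 := Int.lt_floor_add_one (t - p)
    rw [← hk] at hs1 hs2
    rw [← hl] at ht1 ht2
    have hfs : f s = f (s - k) := by
      have := periodic_int hf (s - k) k
      rw [← this]; congr 1; ring
    have hft : f t = f (t - l) := by
      have := periodic_int hf (t - l) l
      rw [← this]; congr 1; ring
    have hkl : k ≤ l := Int.floor_le_floor (by linarith)
    change |f t - f s| ≤ (m (t - l) + l * V) - (m (s - k) + k * V)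
    rcases hkl.eq_or_lt with hkl | hkl
    · rw [hfs, hft]
      rw [← hkl] at ht1 ht2 ⊢
      have := h (s - k) (t - k) (by linarith) (by linarith) (by linarith)
      linarith
    · have h1 := h p (t - l) le_rfl (by linarith) (by linarith)
      have h2 := h (s - k) (p + 1) (by linarith) (by linarith) le_rfl
      have h3 : f (p + 1) = f p := hf p
      have h4 : (k : ℝ) + 1 ≤ l := by exact_mod_cast hkl
      have h5 := _root_.abs_sub_le (f (t - l)) (f p) (f (s - k))
      rw [h3] at h2
      rw [hfs, hft]
      have h6 : ((l : ℝ) - k - 1) * V ≥ 0 := mul_nonneg (by linarith) hV0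
      nlinarith

/-! ### Cutting along a gate -/

/-- `A` is, up to its end points, the set of all integer translates of the interval from `a` to
`b`. -/
structure IsGate (A : Set ℝ) (a b : ℝ) : Prop where
  lt : a < b
  lt_add : b < a + 1
  per : ∀ t, t + 1 ∈ A ↔ t ∈ A
  meas : MeasurableSet A
  sub : ∀ t, a < t → t < b → t ∈ A
  out : ∀ t, b < t → t < a + 1 → t ∉ A

namespace IsGate

variable {A : Set ℝ} {a b : ℝ}

theorem compl (h : IsGate A a b) : IsGate Aᶜ b (a + 1) where
  lt := h.lt_add
  lt_add := by linarith [h.lt]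
  per t := not_congr (h.per t)
  meas := h.meas.compl
  sub t h1 h2 := h.out t h1 h2
  out t h1 h2 := by
    have : t - 1 ∈ A := h.sub _ (by linarith) (by linarith)
    rw [← h.per] at this
    simpa using this

theorem add_int (h : IsGate A a b) (t : ℝ) (k : ℤ) : t + k ∈ A ↔ t ∈ A := by
  have : Function.Periodic (fun t => t ∈ A) 1 := fun t => propext (h.per t)
  exact iff_of_eq (periodic_int this t k)

theorem translate (h : IsGate A a b) (k : ℤ) : IsGate A (a + k) (b + k) where
  lt := by linarith [h.lt]
  lt_add := by linarith [h.lt_add]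
  per := h.per
  meas := h.meas
  sub t h1 h2 := by
    have := h.sub (t + (-k : ℤ)) (by push_cast; linarith) (by push_cast; linarith)
    rwa [h.add_int] at this
  out t h1 h2 := by
    have := h.out (t + (-k : ℤ)) (by push_cast; linarith) (by push_cast; linarith)
    rwa [h.add_int] at this

/-- The heights of the two jumps at the ends are compared with the value at an interior point `r`:
they are at most `f r` plus the increment of `m` between `r` and the end. The point is left free so
that it can be chosen where `f` is small. -/
theorem hasVar_indicator_aux (h : IsGate A a b) {f m : ℝ → ℝ} (hf : ∀ t, 0 ≤ f t)
    (hper : Function.Periodic f 1) (hm : Dominates m f) {r : ℝ} (har : a < r) (hrb : r < b) :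
    HasVar (A.indicator f) (2 * (m b - m a) + 2 * f r) := by
  classical
  -- The midpoint of the gap preceding the gate: the period starting at `p` begins and ends off the
  -- gate and contains one copy of it.
  set p := (a + b - 1) / 2 with hp
  have hlt := h.lt
  have hlt' := h.lt_add
  have hout : ∀ t, p ≤ t → t ≤ p + 1 → t ∈ A → a ≤ t ∧ t ≤ b := by
    intro t h1 h2 h3
    constructor
    · by_contra! hc
      have := h.out (t + 1) (by linarith) (by linarith)
      rw [h.per] at this
      exact this h3
    · by_contra! hc
      exact h.out t hc (by linarith) h3
  -- Constant before and after the gate, with jumps `f r + m r - m a` on entry and `f r + m b - m r`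
  -- on exit. Comparing with `r` decides the side of the gate, whichever end points belong to `A`.
  set m₀ : ℝ → ℝ := fun t => if t ∈ A then (m t - m a) + (f r + m r - m a) else
    if t < r then 0 else 2 * (m b - m a) + 2 * f r with hm₀
  have hper' : Function.Periodic (A.indicator f) 1 := fun t => by
    by_cases ht : t ∈ A
    · rw [Set.indicator_of_mem ht, Set.indicator_of_mem ((h.per t).2 ht), hper]
    · rw [Set.indicator_of_notMem ht, Set.indicator_of_notMem (mt (h.per t).1 ht)]
  have hp1 : p ∉ A := fun hc => by
    have := (hout p le_rfl (by linarith) hc).1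
    linarith
  have hp2 : p + 1 ∉ A := fun hc => hp1 ((h.per p).1 hc)
  have hval : m₀ (p + 1) - m₀ p = 2 * (m b - m a) + 2 * f r := by
    simp only [hm₀, if_neg hp1, if_neg hp2]
    rw [if_neg (by linarith), if_pos (by linarith)]
    ring
  rw [← hval]
  refine HasVar.of_period hper' p fun s t hs hst ht => ?_
  have hbd : ∀ x, a ≤ x → x ≤ b → f x ≤ f r + m r - m a + (m x - m a) ∧
      f x ≤ f r + m b - m r + (m b - m x) := by
    intro x hx1 hx2
    have e1 := hm.mono hx1
    have e2 := hm.mono hx2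
    have e3 := hm.mono har.le
    have e4 := hm.mono hrb.le
    rcases le_total x r with hxr | hxr
    · have := abs_le.1 (hm x r hxr)
      constructor <;> linarith [this.1, hm.mono hxr]
    · have := abs_le.1 (hm r x hxr)
      constructor <;> linarith [this.2, hm.mono hxr]
  have hab := hm.mono hlt.le
  by_cases hsA : s ∈ A <;> by_cases htA : t ∈ A
  · simp only [hm₀, if_pos hsA, if_pos htA, Set.indicator_of_mem hsA, Set.indicator_of_mem htA]
    have := hm s t hst
    linarith
  · have h1 := hout s hs (by linarith) hsA
    have hrt : r ≤ t := by
      by_contra! hc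
      exact htA (h.sub t (by
        rcases h1.1.lt_or_eq with h2 | h2
        · linarith
        · rcases hst.lt_or_eq with h3 | h3
          · linarith
          · rw [h3] at hsA; exact absurd hsA htA) (by linarith))
    simp only [hm₀, if_pos hsA, if_neg htA, Set.indicator_of_mem hsA,
      Set.indicator_of_notMem htA, if_neg hrt.not_gt]
    rw [zero_sub, abs_neg, abs_of_nonneg (hf s)]
    linarith [(hbd s h1.1 h1.2).2]
  · have h1 := hout t (by linarith) ht htA
    have hrs : s < r := by
      by_contra! hc
      exact hsA (h.sub s (by linarith) (by
        rcases h1.2.lt_or_eq with h2 | h2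
        · linarith
        · rcases hst.lt_or_eq with h3 | h3
          · linarith
          · rw [h3] at hsA; exact absurd htA hsA))
    simp only [hm₀, if_neg hsA, if_pos htA, Set.indicator_of_mem htA,
      Set.indicator_of_notMem hsA, if_pos hrs]
    rw [sub_zero, abs_of_nonneg (hf t)]
    linarith [(hbd t h1.1 h1.2).1]
  · simp only [hm₀, if_neg hsA, if_neg htA, Set.indicator_of_notMem hsA,
      Set.indicator_of_notMem htA]
    simp only [sub_self, abs_zero]
    have := hf r
    split_ifs <;> linarith

/-- Cutting a nonnegative function along a gate costs a factor two in variation. -/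
theorem hasVar_indicator (h : IsGate A a b) {f : ℝ → ℝ} {V : ℝ} (hf : ∀ t, 0 ≤ f t)
    (hV : HasVar f V) {ℓ : ℝ} (hℓ : 0 < ℓ) (h1 : ℓ ≤ b - a) (h2 : ℓ ≤ a + 1 - b) :
    ∃ V₁ V₂, HasVar (A.indicator f) V₁ ∧ HasVar (Aᶜ.indicator f) V₂ ∧
      V₁ + V₂ ≤ 2 * V + 4 / ℓ * ∫ t in (0 : ℝ)..1, f t := by
  obtain ⟨hper, m, hm, hd⟩ := id hV
  -- Below-average points of the gate and of the gap serve as the points `r`; both have length at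
  -- least `ℓ`, hence the factor `1 / ℓ`.
  have hint : ∀ x y, a ≤ x → x < y → y ≤ a + 1 → ℓ ≤ y - x →
      ∃ r, x < r ∧ r < y ∧ f r ≤ 1 / ℓ * ∫ t in (0 : ℝ)..1, f t := by
    intro x y hx hxy hy hl
    obtain ⟨r, hr, hle⟩ := exists_mul_le_integral hV.obs hxy
    refine ⟨r, hr.1, hr.2, ?_⟩
    have h3 : ∫ t in x..y, f t ≤ ∫ t in a..a + 1, f t :=
      intervalIntegral.integral_mono_interval hx hxy.le hy
        (Eventually.of_forall fun t => hf t) (hV.obs.intervalIntegrable _ _)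
    rw [hV.obs.integral_period] at h3
    rw [one_div, inv_mul_eq_div, le_div_iff₀ hℓ]
    have := mul_le_mul_of_nonneg_left hl (hf r)
    linarith
  obtain ⟨r, hr1, hr2, hr3⟩ := hint a b le_rfl h.lt h.lt_add.le h1
  obtain ⟨r', hr1', hr2', hr3'⟩ := hint b (a + 1) h.lt.le h.lt_add le_rfl h2
  refine ⟨_, _, h.hasVar_indicator_aux hf hper hd hr1 hr2,
    h.compl.hasVar_indicator_aux hf hper hd hr1' hr2', ?_⟩
  have := hm a
  have e : 4 / ℓ * (∫ t in (0 : ℝ)..1, f t) = 4 * (1 / ℓ * ∫ t in (0 : ℝ)..1, f t) := by ring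
  rw [e, this]
  linarith

/-- An interval of length at most one contains an interval of a third of its length which is inside
or outside a given gate. -/
theorem exists_third (h : IsGate A a b) {s t : ℝ} (hst : s < t) (hst' : t ≤ s + 1) :
    ∃ s' t', s ≤ s' ∧ t' ≤ t ∧ t - s ≤ 3 * (t' - s') ∧
      ((∀ x, s' < x → x < t' → x ∈ A) ∨ ∀ x, s' < x → x < t' → x ∉ A) := by
  -- After this translation the left end of the gate lies in `[s - 1, s)`, so the interval meets at
  -- most three consecutive pieces, alternately gate and gap. One of them takes up a third of it.
  obtain ⟨k, hk1, hk2⟩ := exists_mem_period (s - 1) a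
  replace h := h.translate k
  set a' := a + k
  set b' := b + k
  have hlt := h.lt
  have hlt' := h.lt_add
  have hsub' : ∀ x, a' + 1 < x → x < b' + 1 → x ∈ A := fun x h1 h2 => by
    have := h.translate 1
    exact this.sub x (by push_cast; linarith) (by push_cast; linarith)
  have hout' : ∀ x, b' + 1 < x → x < a' + 2 → x ∉ A := fun x h1 h2 => by
    have := h.translate 1
    exact this.out x (by push_cast; linarith) (by push_cast; linarith)
  by_contra! hcon
  rcases lt_or_ge s b' with hsb | hsb
  · rcases le_or_gt t b' with htb | htb
    · exact absurd (hcon s t le_rfl le_rfl (by linarith)).1 (by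
        push Not; exact fun x h1 h2 => h.sub x (by linarith) (by linarith))
    rcases le_or_gt t (a' + 1) with hta | hta
    · by_cases hc : t - s ≤ 3 * (b' - s)
      · exact absurd (hcon s b' le_rfl htb.le hc).1 (by
          push Not; exact fun x h1 h2 => h.sub x (by linarith) (by linarith))
      · exact absurd (hcon b' t hsb.le le_rfl (by linarith)).2 (by
          push Not; exact fun x h1 h2 => h.out x (by linarith) (by linarith))
    · by_cases hc : t - s ≤ 3 * (b' - s)
      · exact absurd (hcon s b' le_rfl htb.le hc).1 (by
          push Not; exact fun x h1 h2 => h.sub x (by linarith) (by linarith))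
      by_cases hc' : t - s ≤ 3 * (t - (a' + 1))
      · exact absurd (hcon (a' + 1) t (by linarith) le_rfl hc').1 (by
          push Not; exact fun x h1 h2 => hsub' x (by linarith) (by linarith))
      · exact absurd (hcon b' (a' + 1) (by linarith) (by linarith) (by linarith)).2 (by
          push Not; exact fun x h1 h2 => h.out x (by linarith) (by linarith))
  · rcases le_or_gt t (a' + 1) with htb | htb
    · exact absurd (hcon s t le_rfl le_rfl (by linarith)).2 (by
        push Not; exact fun x h1 h2 => h.out x (by linarith) (by linarith))
    rcases le_or_gt t (b' + 1) with hta | hta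
    · by_cases hc : t - s ≤ 3 * (a' + 1 - s)
      · exact absurd (hcon s (a' + 1) le_rfl htb.le hc).2 (by
          push Not; exact fun x h1 h2 => h.out x (by linarith) (by linarith))
      · exact absurd (hcon (a' + 1) t (by linarith) le_rfl (by linarith)).1 (by
          push Not; exact fun x h1 h2 => hsub' x (by linarith) (by linarith))
    · by_cases hc : t - s ≤ 3 * (a' + 1 - s)
      · exact absurd (hcon s (a' + 1) le_rfl htb.le hc).2 (by
          push Not; exact fun x h1 h2 => h.out x (by linarith) (by linarith))
      by_cases hc' : t - s ≤ 3 * (t - (b' + 1))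
      · exact absurd (hcon (b' + 1) t (by linarith) le_rfl hc').2 (by
          push Not; exact fun x h1 h2 => hout' x (by linarith) (by linarith))
      · exact absurd (hcon (a' + 1) (b' + 1) (by linarith) (by linarith) (by linarith)).1 (by
          push Not; exact fun x h1 h2 => hsub' x (by linarith) (by linarith))

end IsGate

/-! ### Expanding coverings of the circle and their transfer operators -/

/-- A lift of an expanding map of the circle together with its inverse and the absolute value of
the derivative of the inverse. -/
structure Cover (γ K Λ : ℝ) where
  lift : ℝ → ℝ
  inv : ℝ → ℝ
  wt : ℝ → ℝ
  deg : ℕ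
  sgn : ℝ
  sgn_eq : sgn = 1 ∨ sgn = -1
  lift_inv : ∀ y, lift (inv y) = y
  inv_lift : ∀ x, inv (lift x) = x
  inv_deriv : ∀ y, HasDerivAt inv (sgn * wt y) y
  inv_add : ∀ y, inv (y + deg) = inv y + sgn
  wt_add : ∀ y, wt (y + deg) = wt y
  wt_ge : ∀ y, 1 / K ≤ wt y
  wt_le : ∀ y, wt y ≤ 1 / γ
  wt_lip : ∀ s t, |wt s - wt t| ≤ Λ * |s - t|
  lift_expand : ∀ s t, γ * |s - t| ≤ |lift s - lift t|
  inv_mono : ∀ s t, s < t → sgn * inv s < sgn * inv t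
  four_le : 4 ≤ deg

namespace Cover

variable {γ K Λ : ℝ} (c : Cover γ K Λ)

/-- The transfer operator. -/
noncomputable def transfer (f : ℝ → ℝ) (y : ℝ) : ℝ :=
  ∑ k ∈ Finset.range c.deg, f (c.inv (y + k)) * c.wt (y + k)

theorem wt_pos (hK : 0 < K) (y : ℝ) : 0 < c.wt y := lt_of_lt_of_le (by positivity) (c.wt_ge y)

theorem inv_cont : Continuous c.inv :=
  continuous_iff_continuousAt.2 fun y => (c.inv_deriv y).continuousAt

theorem wt_cont : Continuous c.wt := by
  have hΛ : 0 ≤ Λ := by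
    have := (abs_nonneg _).trans (c.wt_lip 1 0); simpa using this
  exact (LipschitzWith.of_dist_le_mul (K := ⟨Λ, hΛ⟩) fun s t => by
    rw [Real.dist_eq, Real.dist_eq]; exact c.wt_lip s t).continuous

theorem lift_add (x : ℝ) : c.lift (x + c.sgn) = c.lift x + c.deg := by
  conv_lhs => rw [← c.inv_lift x]
  rw [← c.inv_add, c.lift_inv]

theorem lift_add_one (x : ℝ) : ∃ k : ℤ, c.lift (x + 1) = c.lift x + k := by
  rcases c.sgn_eq with h | h
  · exact ⟨c.deg, by have := c.lift_add x; rw [h] at this; simpa using this⟩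
  · refine ⟨-c.deg, ?_⟩
    have := c.lift_add (x + 1)
    rw [h] at this
    push_cast
    rw [add_neg_cancel_right] at this
    linarith

theorem inv_injective : Function.Injective c.inv := fun s t h => by
  rw [← c.lift_inv s, h, c.lift_inv]

theorem lift_strict (s t : ℝ) (h : s < t) : c.sgn * c.lift s < c.sgn * c.lift t := by
  by_contra! hc
  have e : c.inv (c.lift s) = s := c.inv_lift s
  have e' : c.inv (c.lift t) = t := c.inv_lift t
  rcases c.sgn_eq with hs | hs
  · rw [hs, one_mul, one_mul] at hc
    rcases hc.lt_or_eq with h1 | h1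
    · have := c.inv_mono _ _ h1
      rw [hs, e, e'] at this; linarith
    · rw [h1, e] at e'; linarith
  · rw [hs] at hc
    have hc : c.lift s ≤ c.lift t := by linarith
    rcases hc.lt_or_eq with h1 | h1
    · have := c.inv_mono _ _ h1
      rw [hs, e, e'] at this; linarith
    · rw [h1, e'] at e; linarith

theorem lift_measurable : Measurable c.lift := by
  have h : Monotone fun x => c.sgn * c.lift x :=
    (show StrictMono fun x => c.sgn * c.lift x from fun s t h => c.lift_strict s t h).monotone
  rcases c.sgn_eq with hs | hs
  · simpa [hs] using h.measurable
  · have := h.measurable.neg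
    simp only [hs, neg_one_mul] at this
    simpa [Pi.neg_def] using this

theorem per_comp_inv {f : ℝ → ℝ} (hf : Function.Periodic f 1) (y : ℝ) :
    f (c.inv (y + c.deg)) = f (c.inv y) := by
  rw [c.inv_add]
  rcases c.sgn_eq with h | h
  · rw [h, hf]
  · rw [h]
    have := hf (c.inv y + -1)
    rw [← this]; congr 1; ring

theorem per_comp_lift {α : Type*} {f : ℝ → α} (hf : Function.Periodic f 1) (x : ℝ) :
    f (c.lift (x + 1)) = f (c.lift x) := by
  obtain ⟨k, hk⟩ := c.lift_add_one x
  rw [hk, periodic_int hf]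

theorem _root_.DynWalk.Obs.comp_lift {f : ℝ → ℝ} (hf : Obs f) : Obs (fun x => f (c.lift x)) := by
  obtain ⟨C, hC⟩ := hf.bdd
  exact ⟨c.per_comp_lift hf.per, hf.meas.comp c.lift_measurable, C, fun _ => hC _⟩

theorem transfer_add (f g : ℝ → ℝ) :
    c.transfer (fun t => f t + g t) = fun t => c.transfer f t + c.transfer g t := by
  funext y
  simp only [transfer, ← Finset.sum_add_distrib, add_mul]

theorem transfer_smul (f : ℝ → ℝ) (r : ℝ) :
    c.transfer (fun t => r * f t) = fun t => r * c.transfer f t := by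
  funext y
  simp only [transfer, Finset.mul_sum, mul_assoc]

theorem transfer_nonneg (hK : 0 < K) {f : ℝ → ℝ} (hf : ∀ t, 0 ≤ f t) (y : ℝ) :
    0 ≤ c.transfer f y :=
  Finset.sum_nonneg fun _ _ => mul_nonneg (hf _) (c.wt_pos hK _).le

/-- Sums of translates of a function with deck period `d` change by one telescoping term. -/
theorem _root_.DynWalk.sum_translates (F : ℝ → ℝ) (d : ℕ) (y : ℝ) :
    ∑ k ∈ Finset.range d, F (y + 1 + k) =
      (∑ k ∈ Finset.range d, F (y + k)) + (F (y + d) - F y) := by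
  have h1 := Finset.sum_range_succ (fun k : ℕ => F (y + k)) d
  have h2 := Finset.sum_range_succ' (fun k : ℕ => F (y + k)) d
  have h3 : ∀ k : ℕ, F (y + (k + 1 : ℕ)) = F (y + 1 + k) := fun k => by
    congr 1; push_cast; ring
  simp only [h3, Nat.cast_zero, add_zero] at h2
  linarith

theorem transfer_periodic {f : ℝ → ℝ} (hf : Function.Periodic f 1) :
    Function.Periodic (c.transfer f) 1 := fun y => by
  have := sum_translates (fun y => f (c.inv y) * c.wt y) c.deg y
  simp only [c.per_comp_inv hf, c.wt_add, sub_self, add_zero] at this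
  exact this

theorem transfer_obs {f : ℝ → ℝ} (hK : 0 < K) (hf : Obs f) : Obs (c.transfer f) := by
  obtain ⟨C, hC⟩ := hf.bdd
  refine ⟨c.transfer_periodic hf.per, ?_, c.deg * (C * (1 / γ)), fun y => ?_⟩
  · refine Finset.measurable_sum _ fun k _ => ?_
    exact (hf.meas.comp (c.inv_cont.measurable.comp (measurable_id.add_const _))).mul
      (c.wt_cont.measurable.comp (measurable_id.add_const _))
  · refine (Finset.abs_sum_le_sum_abs _ _).trans ?_
    refine (Finset.sum_le_card_nsmul _ _ (C * (1 / γ)) fun k _ => ?_).trans (by simp)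
    rw [abs_mul, abs_of_pos (c.wt_pos hK _)]
    exact mul_le_mul (hC _) (c.wt_le _) (c.wt_pos hK _).le ((abs_nonneg _).trans (hC 0))

/-- Change of variables: `inv` carries an interval of length `deg` bijectively onto an interval of
length one, with Jacobian `wt`. -/
theorem integral_deck (hK : 0 < K) {f : ℝ → ℝ} (hf : Obs f) (t : ℝ) :
    ∫ y in t..t + c.deg, f (c.inv y) * c.wt y = ∫ x in (0 : ℝ)..1, f x := by
  have hd : (0 : ℝ) ≤ c.deg := Nat.cast_nonneg _
  have key := integral_image_eq_integral_abs_deriv_smul (s := Set.Icc t (t + c.deg))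
    measurableSet_Icc (fun x _ => (c.inv_deriv x).hasDerivWithinAt) c.inv_injective.injOn f
  have h1 : ∀ y, |c.sgn * c.wt y| • f (c.inv y) = f (c.inv y) * c.wt y := fun y => by
    rw [smul_eq_mul, mul_comm, abs_mul, abs_of_pos (c.wt_pos hK y)]
    rcases c.sgn_eq with h | h <;> simp [h]
  simp only [h1] at key
  rw [intervalIntegral.integral_of_le (by linarith), ← integral_Icc_eq_integral_Ioc, ← key]
  have hle : ∀ x, x ∈ c.inv '' Set.Icc t (t + c.deg) ↔
      t ≤ c.lift x ∧ c.lift x ≤ t + c.deg := fun x =>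
    ⟨fun ⟨y, hy, hx⟩ => by rw [← hx, c.lift_inv]; exact hy,
      fun h => ⟨c.lift x, h, c.inv_lift x⟩⟩
  have hmono : ∀ a b, c.sgn * c.inv a ≤ c.sgn * c.inv b ↔ a ≤ b := fun a b =>
    (show StrictMono fun y => c.sgn * c.inv y from fun s t h => c.inv_mono s t h).le_iff_le
  have e1 : ∀ x, t ≤ c.lift x ↔ c.sgn * c.inv t ≤ c.sgn * x := fun x => by
    rw [← hmono, c.inv_lift]
  have e2 : ∀ x, c.lift x ≤ t + c.deg ↔ c.sgn * x ≤ c.sgn * (c.inv t + c.sgn) := fun x => by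
    rw [← hmono, c.inv_lift, c.inv_add]
  rcases c.sgn_eq with h | h
  · have : c.inv '' Set.Icc t (t + c.deg) = Set.Icc (c.inv t) (c.inv t + 1) := by
      ext x
      rw [hle, e1, e2, h, Set.mem_Icc]
      simp
    rw [this, integral_Icc_eq_integral_Ioc, ← intervalIntegral.integral_of_le (by linarith),
      hf.integral_period]
  · have : c.inv '' Set.Icc t (t + c.deg) = Set.Icc (c.inv t - 1) (c.inv t - 1 + 1) := by
      ext x
      rw [hle, e1, e2, h, Set.mem_Icc]
      constructor <;> rintro ⟨h1, h2⟩ <;> constructor <;> linarith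
    rw [this, integral_Icc_eq_integral_Ioc, ← intervalIntegral.integral_of_le (by linarith),
      hf.integral_period]

theorem deck_integrable (hK : 0 < K) {f : ℝ → ℝ} (hf : Obs f) (a b : ℝ) :
    IntervalIntegrable (fun y => f (c.inv y) * c.wt y) volume a b := by
  obtain ⟨C, hC⟩ := hf.bdd
  rw [intervalIntegrable_iff]
  refine Measure.integrableOn_of_bounded (M := C * (1 / γ)) (by simp)
    ((hf.meas.comp c.inv_cont.measurable).mul c.wt_cont.measurable).aestronglyMeasurable
    (Eventually.of_forall fun t => ?_)
  rw [norm_mul, Real.norm_eq_abs, Real.norm_eq_abs, abs_of_pos (c.wt_pos hK _)]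
  exact mul_le_mul (hC _) (c.wt_le _) (c.wt_pos hK _).le ((abs_nonneg _).trans (hC 0))

/-- The branches are evaluated at `y, y + 1, ...`, so the sum of their integrals over one period is
a single integral over `deg` periods, to which `integral_deck` applies. -/
theorem duality (hK : 0 < K) {f ψ : ℝ → ℝ} (hf : Obs f) (hψ : Obs ψ) :
    ∫ y in (0 : ℝ)..1, c.transfer f y * ψ y = ∫ x in (0 : ℝ)..1, f x * ψ (c.lift x) := by
  have hF : Obs (fun x => f x * ψ (c.lift x)) := hf.mul (Obs.comp_lift c hψ)
  rw [← c.integral_deck hK hF 0]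
  have h1 : ∀ y, c.transfer f y * ψ y = ∑ k ∈ Finset.range c.deg,
      (fun z => f (c.inv z) * ψ (c.lift (c.inv z)) * c.wt z) (y + k) := fun y => by
    rw [transfer, Finset.sum_mul]
    refine Finset.sum_congr rfl fun k _ => ?_
    simp only [c.lift_inv]
    have : ψ (y + k) = ψ y := by
      have := periodic_int hψ.per y k
      simpa using this
    rw [this]; ring
  simp only [h1]
  rw [intervalIntegral.integral_finsetSum]
  · simp only [intervalIntegral.integral_comp_add_right
      (fun z => f (c.inv z) * ψ (c.lift (c.inv z)) * c.wt z)]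
    have := intervalIntegral.sum_integral_adjacent_intervals (μ := volume)
      (f := fun z => f (c.inv z) * ψ (c.lift (c.inv z)) * c.wt z)
      (a := fun k : ℕ => (k : ℝ)) (n := c.deg) (fun k _ => c.deck_integrable hK hF _ _)
    simp only [Nat.cast_zero] at this
    rw [zero_add, ← this]
    refine Finset.sum_congr rfl fun k _ => ?_
    congr 1
    · ring
    · push_cast; ring
  · intro k _
    have := (c.deck_integrable hK hF k (k + 1)).comp_add_right (k : ℝ)
    simpa using this

theorem integral_transfer (hK : 0 < K) {f : ℝ → ℝ} (hf : Obs f) :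
    ∫ y in (0 : ℝ)..1, c.transfer f y = ∫ x in (0 : ℝ)..1, f x := by
  simpa using c.duality hK hf (Obs.const 1)

/-- Lasota–Yorke inequality. -/
theorem transfer_hasVar (hK : 0 < K) (hγ : 0 < γ) (hΛ : 0 ≤ Λ) {η θ : ℝ} (hη : 0 < η)
    (hθ : 1 / γ + Λ * η ≤ θ) {f : ℝ → ℝ} {V : ℝ} (hf : ∀ t, 0 ≤ f t) (hV : HasVar f V) :
    HasVar (c.transfer f) (θ * V + Λ * K * ∫ t in (0 : ℝ)..1, f t) := by
  have hV0 := hV.nonneg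
  have hobs := hV.obs
  obtain ⟨hper, m, hm, hd⟩ := id hV
  -- a dominating function for the composition with the inverse
  obtain ⟨M, hM, hMd⟩ : ∃ M : ℝ → ℝ, Dominates M (fun y => f (c.inv y)) ∧
      ∀ y, M (y + c.deg) = M y + V := by
    rcases c.sgn_eq with h | h
    · refine ⟨fun y => m (c.inv y), fun s t hst => hd _ _ ?_, fun y => ?_⟩
      · rcases hst.lt_or_eq with h1 | h1
        · have := c.inv_mono s t h1
          rw [h] at this; linarith
        · rw [h1]
      · simp only [c.inv_add, h, hm]
    · refine ⟨fun y => -m (c.inv y), fun s t hst => ?_, fun y => ?_⟩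
      · have := hd (c.inv t) (c.inv s) (by
          rcases hst.lt_or_eq with h1 | h1
          · have := c.inv_mono s t h1
            rw [h] at this; linarith
          · rw [h1])
        rw [abs_sub_comm] at this
        linarith
      · have := hm (c.inv y + -1)
        rw [neg_add_cancel_right] at this
        simp only [c.inv_add, h, this]; ring
  have hint := c.deck_integrable hK hobs
  set J : ℝ → ℝ := fun t => ∫ y in (0 : ℝ)..t, f (c.inv y) * c.wt y with hJ
  have hJsub : ∀ s t, J t - J s = ∫ y in s..t, f (c.inv y) * c.wt y := fun s t => by
    rw [hJ]
    exact intervalIntegral.integral_interval_sub_left (hint _ _) (hint _ _)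
  set N : ℝ → ℝ := fun t => θ * M t + Λ * K * J t with hN
  have hθ0 : 0 ≤ θ := le_trans (by positivity) hθ
  have hdom : Dominates N (fun y => f (c.inv y) * c.wt y) := by
    refine Dominates.of_local hη fun s t hst hst' => ?_
    have h1 := hM s t hst
    simp only at h1
    have h2 := c.wt_lip t s
    rw [abs_of_nonneg (by linarith : 0 ≤ t - s)] at h2
    have h3 : |f (c.inv t) * c.wt t - f (c.inv s) * c.wt s| ≤
        1 / γ * (M t - M s) + f (c.inv s) * (Λ * (t - s)) := by
      have e : f (c.inv t) * c.wt t - f (c.inv s) * c.wt s =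
        c.wt t * (f (c.inv t) - f (c.inv s)) + f (c.inv s) * (c.wt t - c.wt s) := by ring
      rw [e]
      refine (abs_add_le _ _).trans (add_le_add ?_ ?_)
      · rw [abs_mul, abs_of_pos (c.wt_pos hK t)]
        exact mul_le_mul (c.wt_le t) h1 (abs_nonneg _) (by positivity)
      · rw [abs_mul, abs_of_nonneg (hf _)]
        exact mul_le_mul_of_nonneg_left h2 (hf _)
    have hMM : 0 ≤ M t - M s := (abs_nonneg _).trans h1
    -- On a short interval `f ∘ inv` stays above its left value minus its variation, and the weight
    -- is at least `1 / K`. This replaces a pointwise value by mass, at the cost of `η` times the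
    -- variation.
    have h4 : (f (c.inv s) - (M t - M s)) * (t - s) ≤ K * (J t - J s) := by
      have h5 : ∫ y in s..t, (f (c.inv s) - (M t - M s)) ≤
          ∫ y in s..t, K * (f (c.inv y) * c.wt y) := by
        refine intervalIntegral.integral_mono_on hst (by simp) ((hint s t).const_mul K)
          fun y hy => ?_
        have h6 := hM s y hy.1
        have h7 := hM.mono hy.2
        have h8 := (abs_le.1 h6).1
        have h9 := c.wt_ge y
        have h10 : 1 ≤ K * c.wt y := by
          rw [div_le_iff₀ hK] at h9; linarith
        have h11 : f (c.inv y) * 1 ≤ f (c.inv y) * (K * c.wt y) :=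
          mul_le_mul_of_nonneg_left h10 (hf _)
        linarith
      rw [intervalIntegral.integral_const, intervalIntegral.integral_const_mul, ← hJsub,
        smul_eq_mul] at h5
      linarith
    have h12 : (M t - M s) * (t - s) ≤ (M t - M s) * η :=
      mul_le_mul_of_nonneg_left (by linarith) hMM
    have h13 : Λ * ((f (c.inv s) - (M t - M s)) * (t - s)) ≤ Λ * (K * (J t - J s)) :=
      mul_le_mul_of_nonneg_left h4 hΛ
    have h14 : Λ * ((M t - M s) * (t - s)) ≤ Λ * ((M t - M s) * η) :=
      mul_le_mul_of_nonneg_left h12 hΛ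
    have h15 : (1 / γ + Λ * η) * (M t - M s) ≤ θ * (M t - M s) :=
      mul_le_mul_of_nonneg_right hθ hMM
    simp only [hN]
    nlinarith
  -- The sum over the branches telescopes over a period to `N (y + deg) - N y`, which is the claimed
  -- bound.
  refine ⟨c.transfer_periodic hper, fun y => ∑ k ∈ Finset.range c.deg, N (y + k), fun y => ?_,
    fun s t hst => ?_⟩
  · simp only [sum_translates N c.deg y]
    congr 1
    have := hJsub y (y + c.deg)
    rw [c.integral_deck hK hobs] at this
    simp only [hN, hMd]
    rw [← this]; ring
  · simp only [transfer, ← Finset.sum_sub_distrib]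
    refine (Finset.abs_sum_le_sum_abs _ _).trans (Finset.sum_le_sum fun k _ => ?_)
    exact hdom _ _ (by linarith)

/-- A lower bound on an interval is transferred to a longer interval. -/
theorem transfer_ge_on (hK : 0 < K) {f : ℝ → ℝ} (hf : ∀ t, 0 ≤ f t) {s t b : ℝ}
    (hst : s ≤ t) (h : ∀ x, s < x → x < t → b ≤ f x) :
    ∃ s' t', γ * (t - s) ≤ t' - s' ∧ ∀ y, s' < y → y < t' → b / K ≤ c.transfer f y := by
  have hexp := c.lift_expand t s
  rw [abs_of_nonneg (by linarith : 0 ≤ t - s)] at hexp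
  have hmono : ∀ a b, c.sgn * c.inv a < c.sgn * c.inv b ↔ a < b := fun a b =>
    (show StrictMono fun y => c.sgn * c.inv y from fun s t h => c.inv_mono s t h).lt_iff_lt
  have hmono' : ∀ a b, c.sgn * c.lift a ≤ c.sgn * c.lift b ↔ a ≤ b := fun a b =>
    (show StrictMono fun y => c.sgn * c.lift y from fun s t h => c.lift_strict s t h).le_iff_le
  have hst' := (hmono' s t).2 hst
  have key : ∀ y, s < c.inv y → c.inv y < t → b / K ≤ c.transfer f y := by
    intro y h1 h2
    have h3 : f (c.inv (y + (0 : ℕ))) * c.wt (y + (0 : ℕ)) ≤ c.transfer f y :=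
      Finset.single_le_sum (f := fun k : ℕ => f (c.inv (y + k)) * c.wt (y + k))
        (fun k _ => mul_nonneg (hf _) (c.wt_pos hK _).le)
        (Finset.mem_range.2 (by have := c.four_le; lia))
    simp only [Nat.cast_zero, add_zero] at h3
    refine le_trans ?_ h3
    rw [div_eq_mul_one_div]
    exact mul_le_mul (h _ h1 h2) (c.wt_ge y) (by positivity) (hf _)
  rcases c.sgn_eq with hs | hs
  · rw [hs] at hst'
    rw [abs_of_nonneg (by linarith)] at hexp
    refine ⟨c.lift s, c.lift t, hexp, fun y h1 h2 => key y ?_ ?_⟩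
    · rw [← hmono, c.inv_lift, hs] at h1; linarith
    · rw [← hmono, c.inv_lift, hs] at h2; linarith
  · rw [hs] at hst'
    rw [abs_of_nonpos (by linarith)] at hexp
    refine ⟨c.lift t, c.lift s, by linarith, fun y h1 h2 => key y ?_ ?_⟩
    · rw [← hmono, c.inv_lift, hs] at h2; linarith
    · rw [← hmono, c.inv_lift, hs] at h1; linarith

/-- Every point has a preimage outside two sets on which the map is injective. -/
theorem exists_preimage_notMem (hγ : 3 < γ) {A B : Set ℝ}
    (hA : ∀ s ∈ A, ∀ t ∈ A, (∃ k : ℤ, c.lift s - c.lift t = k) → ∃ k : ℤ, s - t = k)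
    (hB : ∀ s ∈ B, ∀ t ∈ B, (∃ k : ℤ, c.lift s - c.lift t = k) → ∃ k : ℤ, s - t = k) (y : ℝ) :
    ∃ k ∈ Finset.range c.deg, c.inv (y + k) ∉ A ∧ c.inv (y + k) ∉ B := by
  -- Three consecutive preimages are distinct modulo 1: their images differ by at most 2, whereas a
  -- nonzero integer difference of preimages would be expanded by more than 3. Each set then
  -- contains at most one of them, and the pigeonhole principle leaves one outside both.
  have hne : ∀ i j : ℕ, i < j → j < 3 → ¬ ∃ k : ℤ, c.inv (y + i) - c.inv (y + j) = k := by
    rintro i j hij hj ⟨k, hk⟩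
    have h1 := c.lift_expand (c.inv (y + i)) (c.inv (y + j))
    rw [c.lift_inv, c.lift_inv, hk] at h1
    have h2 : |y + i - (y + j)| ≤ 2 := by
      have : (i : ℝ) < j := by exact_mod_cast hij
      have h3 : (j : ℝ) ≤ 2 := by exact_mod_cast (by lia : j ≤ 2)
      have h4 : (0 : ℝ) ≤ i := Nat.cast_nonneg i
      rw [abs_le]; constructor <;> linarith
    have h3 : |(k : ℝ)| < 1 := by
      by_contra! hc
      nlinarith
    have h4 : k = 0 := by
      have : |k| < 1 := by exact_mod_cast h3
      exact Int.abs_lt_one_iff.1 this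
    rw [h4, Int.cast_zero, sub_eq_zero] at hk
    have := c.inv_injective hk
    have : (i : ℝ) = j := by linarith
    have : i = j := by exact_mod_cast this
    lia
  have hlift : ∀ i j : ℕ, ∃ k : ℤ, c.lift (c.inv (y + i)) - c.lift (c.inv (y + j)) = k :=
    fun i j => ⟨(i : ℤ) - j, by rw [c.lift_inv, c.lift_inv]; push_cast; ring⟩
  by_contra! hcon
  have hmem : ∀ k : ℕ, k < 3 → c.inv (y + k) ∈ A ∨ c.inv (y + k) ∈ B := fun k hk => by
    have := hcon k (Finset.mem_range.2 (by have := c.four_le; lia))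
    tauto
  have hAA : ∀ i j : ℕ, i < j → j < 3 → c.inv (y + i) ∈ A → c.inv (y + j) ∉ A :=
    fun i j hij hj h1 h2 => hne i j hij hj (hA _ h1 _ h2 (hlift i j))
  have hBB : ∀ i j : ℕ, i < j → j < 3 → c.inv (y + i) ∈ B → c.inv (y + j) ∉ B :=
    fun i j hij hj h1 h2 => hne i j hij hj (hB _ h1 _ h2 (hlift i j))
  have h0 := hmem 0 (by lia)
  have h1 := hmem 1 (by lia)
  have h2 := hmem 2 (by lia)
  have a01 := hAA 0 1 (by lia) (by lia)
  have a02 := hAA 0 2 (by lia) (by lia)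
  have a12 := hAA 1 2 (by lia) (by lia)
  have b01 := hBB 0 1 (by lia) (by lia)
  have b02 := hBB 0 2 (by lia) (by lia)
  have b12 := hBB 1 2 (by lia) (by lia)
  tauto

end Cover

/-! ### The transfer operators of the induced maps -/

/-- A family of expanding maps and gates, described by lifts. -/
structure System (ι : Type*) (γ K Λ ℓ : ℝ) where
  cov : ι → Cover γ K Λ
  gate : ι → Set ℝ
  left : ι → ℝ
  right : ι → ℝ
  isGate : ∀ i, IsGate (gate i) (left i) (right i)
  len_le : ∀ i, ℓ ≤ right i - left i
  gap_le : ∀ i, ℓ ≤ left i + 1 - right i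
  inj : ∀ i j, ∀ s ∈ gate j, ∀ t ∈ gate j,
    (∃ k : ℤ, (cov i).lift s - (cov i).lift t = k) → ∃ k : ℤ, s - t = k
  three_lt : 3 < γ
  one_le : 1 ≤ K
  nonneg : 0 ≤ Λ
  len_pos : 0 < ℓ

namespace System

variable {ι : Type*} {γ K Λ ℓ : ℝ} (S : System ι γ K Λ ℓ)

theorem K_pos (S : System ι γ K Λ ℓ) : 0 < K := lt_of_lt_of_le one_pos S.one_le

open Classical in
/-- The induced map for the current index `e.1` and the index `e.2` of the site to the left. -/
noncomputable def ind (e : ι × ι) (t : ℝ) : ℝ :=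
  if t ∈ S.gate e.1 then (S.cov e.1).lift ((S.cov e.2).lift ((S.cov e.1).lift t))
  else (S.cov e.1).lift t

/-- The transfer operator of the induced map. -/
noncomputable def op (e : ι × ι) (f : ℝ → ℝ) (y : ℝ) : ℝ :=
  (S.cov e.1).transfer ((S.gate e.1)ᶜ.indicator f) y +
    (S.cov e.1).transfer ((S.cov e.2).transfer ((S.cov e.1).transfer
      ((S.gate e.1).indicator f))) y

variable (e : ι × ι)

theorem op_add (f g : ℝ → ℝ) :
    S.op e (fun t => f t + g t) = fun t => S.op e f t + S.op e g t := by
  have h : ∀ A : Set ℝ, A.indicator (fun t => f t + g t) =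
      fun t => A.indicator f t + A.indicator g t := fun A => Set.indicator_add A f g
  funext y
  simp only [op, h, Cover.transfer_add]
  ring

theorem op_smul (f : ℝ → ℝ) (r : ℝ) : S.op e (fun t => r * f t) = fun t => r * S.op e f t := by
  have h : ∀ A : Set ℝ, A.indicator (fun t => r * f t) = fun t => r * A.indicator f t :=
    fun A => by
      funext t
      by_cases ht : t ∈ A <;> simp [ht]
  funext y
  simp only [op, h, Cover.transfer_smul]
  ring

theorem op_sub (f g : ℝ → ℝ) :
    S.op e (fun t => f t - g t) = fun t => S.op e f t - S.op e g t := by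
  have h1 : (fun t => f t - g t) = fun t => f t + (-1) * g t := by funext t; ring
  rw [h1, S.op_add, S.op_smul]
  funext t; ring

theorem op_nonneg {f : ℝ → ℝ} (hf : ∀ t, 0 ≤ f t) (y : ℝ) : 0 ≤ S.op e f y :=
  add_nonneg (Cover.transfer_nonneg _ S.K_pos (fun t => Set.indicator_nonneg (fun t _ => hf t) t) y)
    (Cover.transfer_nonneg _ S.K_pos (Cover.transfer_nonneg _ S.K_pos
      (Cover.transfer_nonneg _ S.K_pos fun t => Set.indicator_nonneg (fun t _ => hf t) t)) y)

theorem obs_gate {f : ℝ → ℝ} (hf : Obs f) (i : ι) : Obs ((S.gate i).indicator f) :=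
  hf.indicator (S.isGate i).meas (S.isGate i).per

theorem obs_gate_compl {f : ℝ → ℝ} (hf : Obs f) (i : ι) : Obs ((S.gate i)ᶜ.indicator f) :=
  hf.indicator (S.isGate i).compl.meas (S.isGate i).compl.per

theorem op_obs {f : ℝ → ℝ} (hf : Obs f) : Obs (S.op e f) :=
  ((S.cov e.1).transfer_obs S.K_pos (S.obs_gate_compl hf _)).add
    ((S.cov e.1).transfer_obs S.K_pos ((S.cov e.2).transfer_obs S.K_pos
      ((S.cov e.1).transfer_obs S.K_pos (S.obs_gate hf _))))

theorem obs_ind {ψ : ℝ → ℝ} (hψ : Obs ψ) : Obs (fun t => ψ (S.ind e t)) := by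
  have h1 := Obs.comp_lift (S.cov e.1) hψ
  have h2 := Obs.comp_lift (S.cov e.1) (Obs.comp_lift (S.cov e.2) h1)
  have h := (S.obs_gate h2 e.1).add (S.obs_gate_compl h1 e.1)
  convert h using 1
  funext t
  by_cases ht : t ∈ S.gate e.1 <;> simp [ind, ht]

/-- This identifies `op` as the operator that pushes densities forward under `ind`. -/
theorem op_duality {f ψ : ℝ → ℝ} (hf : Obs f) (hψ : Obs ψ) :
    ∫ y in (0 : ℝ)..1, S.op e f y * ψ y = ∫ x in (0 : ℝ)..1, f x * ψ (S.ind e x) := by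
  have hK := S.K_pos
  have h1 := Obs.comp_lift (S.cov e.1) hψ
  have h2 := Obs.comp_lift (S.cov e.2) h1
  have h3 := Obs.comp_lift (S.cov e.1) h2
  have g0 := S.obs_gate hf e.1
  have g1 := (S.cov e.1).transfer_obs hK g0
  have g2 := (S.cov e.2).transfer_obs hK g1
  have g3 := (S.cov e.1).transfer_obs hK g2
  have g0' := S.obs_gate_compl hf e.1
  have g1' := (S.cov e.1).transfer_obs hK g0'
  simp only [op, add_mul]
  rw [(g1'.mul hψ).integral_add (g3.mul hψ), (S.cov e.1).duality hK g0' hψ,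
    (S.cov e.1).duality hK g2 hψ, (S.cov e.2).duality hK g1 h1, (S.cov e.1).duality hK g0 h2,
    ← (g0'.mul h1).integral_add (g0.mul h3)]
  congr 1
  funext t
  by_cases ht : t ∈ S.gate e.1 <;> simp [ind, ht]

theorem integral_op {f : ℝ → ℝ} (hf : Obs f) :
    ∫ y in (0 : ℝ)..1, S.op e f y = ∫ x in (0 : ℝ)..1, f x := by
  simpa using S.op_duality e hf (Obs.const 1)

/-- Lasota–Yorke inequality for the induced map. -/
theorem op_hasVar {f : ℝ → ℝ} {V : ℝ} (hf : ∀ t, 0 ≤ f t) (hV : HasVar f V) :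
    HasVar (S.op e f) (3 / 4 * V + (3 / (2 * ℓ) + 4 * (Λ * K)) * ∫ t in (0 : ℝ)..1, f t) := by
  have hK := S.K_pos
  have hγ := S.three_lt
  have hγ0 : 0 < γ := by linarith
  have hΛ := S.nonneg
  -- The margin between 1/3 and 3/8 absorbs the distortion; after doubling by the cut the factor is
  -- 3/4.
  obtain ⟨η, hη, hθ⟩ : ∃ η > 0, 1 / γ + Λ * η ≤ 3 / 8 := by
    refine ⟨1 / (24 * (Λ + 1)), by positivity, ?_⟩
    have h1 : 1 / γ ≤ 1 / 3 := one_div_le_one_div_of_le (by norm_num) hγ.le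
    have h2 : Λ * (1 / (24 * (Λ + 1))) ≤ 1 / 24 := by
      rw [mul_one_div, div_le_div_iff₀ (by positivity) (by norm_num)]
      linarith
    linarith
  obtain ⟨V₁, V₂, h1, h2, h12⟩ := (S.isGate e.1).hasVar_indicator hf hV S.len_pos
    (S.len_le e.1) (S.gap_le e.1)
  have hobs := hV.obs
  set I := ∫ t in (0 : ℝ)..1, f t with hI
  have p1 : ∀ t, 0 ≤ (S.gate e.1).indicator f t :=
    fun t => Set.indicator_nonneg (fun t _ => hf t) t
  have p2 : ∀ t, 0 ≤ (S.gate e.1)ᶜ.indicator f t :=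
    fun t => Set.indicator_nonneg (fun t _ => hf t) t
  have i1 : ∫ t in (0 : ℝ)..1, (S.gate e.1).indicator f t ≤ I :=
    h1.obs.integral_mono hobs (fun t => Set.indicator_le_self' (fun t _ => hf t) t) zero_le_one
  have i2 : ∫ t in (0 : ℝ)..1, (S.gate e.1)ᶜ.indicator f t ≤ I :=
    h2.obs.integral_mono hobs (fun t => Set.indicator_le_self' (fun t _ => hf t) t) zero_le_one
  have a1 := (S.cov e.1).transfer_hasVar hK hγ0 hΛ hη hθ p1 h1
  have q1 := (S.cov e.1).transfer_nonneg hK p1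
  have a2 := (S.cov e.2).transfer_hasVar hK hγ0 hΛ hη hθ q1 a1
  have q2 := (S.cov e.2).transfer_nonneg hK q1
  have a3 := (S.cov e.1).transfer_hasVar hK hγ0 hΛ hη hθ q2 a2
  have b1 := (S.cov e.1).transfer_hasVar hK hγ0 hΛ hη hθ p2 h2
  rw [(S.cov e.2).integral_transfer hK a1.obs, (S.cov e.1).integral_transfer hK h1.obs] at a3
  -- The branch off the gate costs one `Λ * K`. The three maps composed on the gate cost at most
  -- three more, and their extra contraction is discarded.
  refine (b1.add a3).weaken ?_
  have hV1 := h1.nonneg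
  have hΛK : 0 ≤ Λ * K := mul_nonneg hΛ hK.le
  set I₁ := ∫ t in (0 : ℝ)..1, (S.gate e.1).indicator f t
  set I₂ := ∫ t in (0 : ℝ)..1, (S.gate e.1)ᶜ.indicator f t
  have m1 := mul_le_mul_of_nonneg_left i1 hΛK
  have m2 := mul_le_mul_of_nonneg_left i2 hΛK
  have I10 : 0 ≤ I₁ := intervalIntegral.integral_nonneg zero_le_one fun t _ => p1 t
  have m3 := mul_nonneg hΛK I10
  have e1 : 3 / (2 * ℓ) * I = 3 / 8 * (4 / ℓ * I) := by
    have := S.len_pos.ne'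
    field_simp; ring
  have : (3 / (2 * ℓ) + 4 * (Λ * K)) * I = 3 / (2 * ℓ) * I + 4 * (Λ * K * I) := by ring
  rw [this, e1]
  nlinarith

/-- A lower bound on an interval is transferred to a longer interval. -/
theorem op_ge_on {f : ℝ → ℝ} (hf : ∀ t, 0 ≤ f t) {s t b : ℝ} (hst : s < t)
    (hst' : t ≤ s + 1) (hb : 0 ≤ b) (h : ∀ x, s < x → x < t → b ≤ f x) :
    ∃ s' t', γ / 3 * (t - s) ≤ t' - s' ∧ ∀ y, s' < y → y < t' → b / K ^ 3 ≤ S.op e f y := by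
  have hK := S.K_pos
  have hγ := S.three_lt
  obtain ⟨u, v, hu, hv, huv, hor⟩ := (S.isGate e.1).exists_third hst hst'
  have p1 : ∀ t, 0 ≤ (S.gate e.1).indicator f t :=
    fun t => Set.indicator_nonneg (fun t _ => hf t) t
  have p2 : ∀ t, 0 ≤ (S.gate e.1)ᶜ.indicator f t :=
    fun t => Set.indicator_nonneg (fun t _ => hf t) t
  have q1 := (S.cov e.1).transfer_nonneg hK p1
  have q2 := (S.cov e.2).transfer_nonneg hK q1
  have q3 := (S.cov e.1).transfer_nonneg hK q2
  have q1' := (S.cov e.1).transfer_nonneg hK p2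
  -- On the gate the interval is expanded three times, off it once; the growth by a single `γ` and
  -- the loss `K ^ 3` cover both cases.
  rcases hor with hin | hout
  · obtain ⟨u1, v1, hl1, h1⟩ := (S.cov e.1).transfer_ge_on hK p1 (s := u) (t := v) (b := b)
      (by linarith) fun x hx hx' => by
        rw [Set.indicator_of_mem (hin x hx hx')]; exact h x (by linarith) (by linarith)
    have w1 : v - u ≤ v1 - u1 := by nlinarith
    obtain ⟨u2, v2, hl2, h2⟩ := (S.cov e.2).transfer_ge_on hK q1 (by linarith) h1
    have w2 : v - u ≤ v2 - u2 := by nlinarith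
    obtain ⟨u3, v3, hl3, h3⟩ := (S.cov e.1).transfer_ge_on hK q2 (by linarith) h2
    refine ⟨u3, v3, by nlinarith, fun y hy hy' => ?_⟩
    have := h3 y hy hy'
    have e1 : b / K ^ 3 = b / K / K / K := by
      field_simp
    rw [e1, op]
    linarith [q1' y]
  · obtain ⟨u1, v1, hl1, h1⟩ := (S.cov e.1).transfer_ge_on hK p2 (s := u) (t := v) (b := b)
      (by linarith) fun x hx hx' => by
        rw [Set.indicator_of_mem (hout x hx hx')]; exact h x (by linarith) (by linarith)
    refine ⟨u1, v1, by nlinarith, fun y hy hy' => ?_⟩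
    have h2 := h1 y hy hy'
    have h3 : b / K ^ 3 ≤ b / K := by
      refine div_le_div_of_nonneg_left hb hK ?_
      have := S.one_le
      calc K = K ^ 1 := (pow_one K).symm
        _ ≤ K ^ 3 := pow_le_pow_right₀ this (by norm_num)
    rw [op]
    linarith [q3 y]

theorem op_periodic {f : ℝ → ℝ} (hf : Function.Periodic f 1) :
    Function.Periodic (S.op e f) 1 := by
  have hind : ∀ {A : Set ℝ} {a b : ℝ}, IsGate A a b → Function.Periodic (A.indicator f) 1 :=
    fun {A a b} h t => by
      by_cases ht : t ∈ A
      · rw [Set.indicator_of_mem ht, Set.indicator_of_mem ((h.per t).2 ht), hf]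
      · rw [Set.indicator_of_notMem ht, Set.indicator_of_notMem (mt (h.per t).1 ht)]
  have h1 := (S.cov e.1).transfer_periodic (hind (S.isGate e.1).compl)
  have h2 := (S.cov e.1).transfer_periodic ((S.cov e.2).transfer_periodic
    ((S.cov e.1).transfer_periodic (hind (S.isGate e.1))))
  exact fun t => by simp only [op, h1 t, h2 t]

/-- A lower bound on an interval of length at least one becomes global after one step. -/
theorem op_ge {f : ℝ → ℝ} (hf : ∀ t, 0 ≤ f t) (hper : Function.Periodic f 1) {s t b : ℝ}
    (hst : s + 1 ≤ t) (hb : 0 ≤ b) (h : ∀ x, s < x → x < t → b ≤ f x) (y : ℝ) :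
    b / K ^ 3 ≤ S.op e f y := by
  -- The image has length at least `γ / 3 > 1`, so its interior contains a representative of every
  -- point of the circle.
  obtain ⟨s', t', hl, h'⟩ := S.op_ge_on e hf (s := s) (t := s + 1) (by linarith) le_rfl hb
    fun x h1 h2 => h x h1 (by linarith)
  have hγ := S.three_lt
  obtain ⟨k, hk1, hk2⟩ := exists_mem_period ((s' + t' - 1) / 2) y
  rw [← periodic_int (S.op_periodic e hper) y k]
  exact h' _ (by linarith) (by linarith)

/-- Mass outside the gate of the map and a second gate is transported to the whole circle. -/
theorem op_avoid_ge {f : ℝ → ℝ} {b : ℝ} (hb : 0 ≤ b) (hf : ∀ t, b ≤ f t) (r : ι) (y : ℝ) :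
    b / K ≤ S.op e (fun t => f t * (1 - (S.gate r).indicator 1 t)) y := by
  have hK := S.K_pos
  obtain ⟨k, hk, h1, h2⟩ := (S.cov e.1).exists_preimage_notMem S.three_lt (S.inj e.1 e.1)
    (S.inj e.1 r) y
  set g : ℝ → ℝ := fun t => f t * (1 - (S.gate r).indicator 1 t) with hg
  have hg0 : ∀ t, 0 ≤ g t := fun t => by
    refine mul_nonneg (hb.trans (hf t)) ?_
    by_cases ht : t ∈ S.gate r <;> simp [ht]
  have p1 : ∀ t, 0 ≤ (S.gate e.1).indicator g t :=
    fun t => Set.indicator_nonneg (fun t _ => hg0 t) t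
  have p2 : ∀ t, 0 ≤ (S.gate e.1)ᶜ.indicator g t :=
    fun t => Set.indicator_nonneg (fun t _ => hg0 t) t
  have q3 := (S.cov e.1).transfer_nonneg hK ((S.cov e.2).transfer_nonneg hK
    ((S.cov e.1).transfer_nonneg hK p1)) y
  have h3 := Finset.single_le_sum
    (f := fun k : ℕ => (S.gate e.1)ᶜ.indicator g ((S.cov e.1).inv (y + k)) * (S.cov e.1).wt (y + k))
    (fun k _ => mul_nonneg (p2 _) ((S.cov e.1).wt_pos hK _).le) hk
  have h4 : b / K ≤ (S.gate e.1)ᶜ.indicator g ((S.cov e.1).inv (y + k)) *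
      (S.cov e.1).wt (y + k) := by
    rw [Set.indicator_of_mem (Set.mem_compl h1), hg]
    simp only [Set.indicator_of_notMem h2, sub_zero, mul_one]
    rw [div_eq_mul_one_div]
    exact mul_le_mul (hf _) ((S.cov e.1).wt_ge _) (by positivity) (hb.trans (hf _))
  have h5 : (S.gate e.1)ᶜ.indicator g ((S.cov e.1).inv (y + k)) *
      (S.cov e.1).wt (y + k) ≤ (S.cov e.1).transfer ((S.gate e.1)ᶜ.indicator g) y := h3
  rw [op]
  linarith

end System

/-! ### Contraction on a cone of functions of bounded variation -/

/-- Nonnegative functions whose variation is controlled by their integral. -/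
structure Cone (a : ℝ) (f : ℝ → ℝ) : Prop where
  nonneg : ∀ t, 0 ≤ f t
  var : HasVar f (a * ∫ t in (0 : ℝ)..1, f t)

namespace Cone

variable {a : ℝ} {f g : ℝ → ℝ}

theorem obs (h : Cone a f) : Obs f := h.var.obs

theorem integral_nonneg (h : Cone a f) : 0 ≤ ∫ t in (0 : ℝ)..1, f t :=
  intervalIntegral.integral_nonneg zero_le_one fun t _ => h.nonneg t

theorem le (h : Cone a f) (t : ℝ) : f t ≤ (1 + a) * ∫ t in (0 : ℝ)..1, f t := by
  have := h.var.le_integral t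
  linarith

theorem add (hf : Cone a f) (hg : Cone a g) : Cone a (fun t => f t + g t) := by
  refine ⟨fun t => add_nonneg (hf.nonneg t) (hg.nonneg t), ?_⟩
  rw [hf.obs.integral_add hg.obs, mul_add]
  exact hf.var.add hg.var

theorem add_const (hf : Cone a f) (ha : 0 ≤ a) {c : ℝ} (hc : 0 ≤ c) :
    Cone a (fun t => f t + c) := by
  refine hf.add (g := fun _ => c) ⟨fun _ => hc, (HasVar.const c).weaken ?_⟩
  simp only [intervalIntegral.integral_const, sub_zero, one_smul]
  positivity

theorem one (ha : 0 ≤ a) : Cone a (fun _ => 1) :=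
  ⟨fun _ => zero_le_one, (HasVar.const 1).weaken (by simpa using ha)⟩

/-- A function of the cone is at least half its mean on some interval of definite length. -/
theorem exists_interval (h : Cone a f) (ha : 0 < a) :
    ∃ s, ∀ x, s < x → x < s + 1 / (2 * a) → (∫ t in (0 : ℝ)..1, f t) / 2 ≤ f x := by
  obtain ⟨hper, m, hm, hd⟩ := h.var
  set I := ∫ t in (0 : ℝ)..1, f t with hI
  have hI0 : 0 ≤ I := h.integral_nonneg
  have hVn : 0 ≤ a * I := mul_nonneg ha.le hI0
  set δ := 1 / (2 * a) with hδ
  have hδ0 : 0 < δ := by positivity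
  -- Removing the slope makes the dominating function periodic. The average increment of `m` over a
  -- length `δ` is therefore `a * I * δ = I / 2`, and some `s` has `f s` minus this increment at
  -- least `I - I / 2`.
  set m₀ : ℝ → ℝ := fun t => m t - a * I * t with hm₀
  have hv : HasVar m₀ (2 * (a * I)) := by
    refine ⟨fun t => by simp only [hm₀, hm]; ring, fun t => m t + a * I * t,
      fun t => by simp only [hm]; ring, fun s t hst => ?_⟩
    have h1 := hd.mono hst
    have h2 := mul_le_mul_of_nonneg_left hst hVn
    simp only [hm₀]
    rw [abs_le]
    constructor <;> linarith
  have hobs := hv.obs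
  have hobs' : Obs (fun t => m₀ (t + δ)) := by
    obtain ⟨C, hC⟩ := hobs.bdd
    refine ⟨fun t => ?_, hobs.meas.comp (measurable_id.add_const _), C, fun t => hC _⟩
    have := hobs.per (t + δ)
    simp only [← this]; congr 1; ring
  have hint : ∫ t in (0 : ℝ)..1, m₀ (t + δ) = ∫ t in (0 : ℝ)..1, m₀ t := by
    rw [intervalIntegral.integral_comp_add_right, zero_add, add_comm (1 : ℝ), hobs.integral_period]
  obtain ⟨s, -, hs⟩ := exists_mul_le_integral (((hobs'.sub hobs).add
    (Obs.const (a * I * δ))).sub h.obs) zero_lt_one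
  rw [((hobs'.sub hobs).add (Obs.const _)).integral_sub h.obs, (hobs'.sub hobs).integral_add
    (Obs.const _), hobs'.integral_sub hobs, hint] at hs
  simp only [hm₀, sub_self, zero_add, intervalIntegral.integral_const, sub_zero, one_smul,
    mul_one] at hs
  have hδ' : a * I * δ = I / 2 := by rw [hδ]; field_simp
  refine ⟨s, fun x h1 h2 => ?_⟩
  have h3 := (abs_le.1 (hd s x h1.le)).1
  have h4 := hd.mono h2.le
  have h5 : a * I * (s + δ) = a * I * s + a * I * δ := by ring
  rw [h5, hδ'] at hs
  linarith

end Cone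

/-! ### Iterated transfer operators and uniform mixing -/

namespace System

variable {ι : Type*} {γ K Λ ℓ : ℝ} (S : System ι γ K Λ ℓ) (e : ℕ → ι × ι)

/-- The transfer operator from time `j` to time `j + n`. -/
noncomputable def iter (j : ℕ) : ℕ → (ℝ → ℝ) → ℝ → ℝ
  | 0, f => f
  | n + 1, f => S.op (e (j + n)) (iter j n f)

theorem iter_sub (j n : ℕ) (f g : ℝ → ℝ) :
    S.iter e j n (fun t => f t - g t) = fun t => S.iter e j n f t - S.iter e j n g t := by
  induction n with
  | zero => rfl
  | succ n ih => simp only [iter, ih, op_sub]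

theorem iter_nonneg (j n : ℕ) {f : ℝ → ℝ} (hf : ∀ t, 0 ≤ f t) : ∀ t, 0 ≤ S.iter e j n f t := by
  induction n with
  | zero => exact hf
  | succ n ih => exact S.op_nonneg _ ih

theorem iter_obs (j n : ℕ) {f : ℝ → ℝ} (hf : Obs f) : Obs (S.iter e j n f) := by
  induction n with
  | zero => exact hf
  | succ n ih => exact S.op_obs _ ih

theorem integral_iter (j n : ℕ) {f : ℝ → ℝ} (hf : Obs f) :
    ∫ t in (0 : ℝ)..1, S.iter e j n f t = ∫ t in (0 : ℝ)..1, f t := by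
  induction n with
  | zero => rfl
  | succ n ih => rw [iter, S.integral_op _ (S.iter_obs e j n hf), ih]

/-- The aperture of the invariant cone. -/
noncomputable def aperture (_ : System ι γ K Λ ℓ) : ℝ := 16 * (3 / (2 * ℓ) + 4 * (Λ * K))

theorem aperture_pos : 0 < S.aperture := by
  have := S.len_pos
  have := S.nonneg
  have := S.K_pos
  rw [aperture]
  positivity

theorem cone_op (e : ι × ι) {f : ℝ → ℝ} (hf : Cone S.aperture f) :
    Cone S.aperture (S.op e f) := by
  refine ⟨S.op_nonneg e hf.nonneg, (S.op_hasVar e hf.nonneg hf.var).weaken ?_⟩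
  rw [S.integral_op e hf.obs]
  have h1 := hf.integral_nonneg
  have h2 := mul_nonneg S.aperture_pos.le h1
  have : 3 / (2 * ℓ) + 4 * (Λ * K) = S.aperture / 16 := by rw [aperture]; ring
  rw [this]
  linarith

/-- The additive term of the Lasota–Yorke inequality is a sixteenth of the aperture per unit mass,
and 1/4 is the fixed point of `x ↦ 3 / 4 * x + 1 / 16`. -/
theorem iter_hasVar (j n : ℕ) {f : ℝ → ℝ} (hf : Cone S.aperture f) :
    HasVar (S.iter e j n f) (((3 / 4) ^ n + 1 / 4) *
      (S.aperture * ∫ t in (0 : ℝ)..1, f t)) := by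
  have h2 := mul_nonneg S.aperture_pos.le hf.integral_nonneg
  induction n with
  | zero => exact hf.var.weaken (by rw [pow_zero]; linarith)
  | succ n ih =>
    refine (S.op_hasVar _ (S.iter_nonneg e j n hf.nonneg) ih).weaken ?_
    rw [S.integral_iter e j n hf.obs]
    have : 3 / (2 * ℓ) + 4 * (Λ * K) = S.aperture / 16 := by rw [aperture]; ring
    rw [this, pow_succ]
    nlinarith

/-- Each step lengthens the interval by `γ / 3`. The length is capped at 1 because `op_ge_on` cuts
only intervals of length at most one. -/
theorem iter_ge_on (j n : ℕ) {f : ℝ → ℝ} (hf : ∀ t, 0 ≤ f t) {s t b l : ℝ} (hl : 0 < l)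
    (hl1 : l ≤ 1) (hst : s + l ≤ t) (hb : 0 ≤ b) (h : ∀ x, s < x → x < t → b ≤ f x) :
    ∃ s' t', s' + min 1 ((γ / 3) ^ n * l) ≤ t' ∧
      ∀ y, s' < y → y < t' → b / (K ^ 3) ^ n ≤ S.iter e j n f y := by
  have hγ := S.three_lt
  have hK := S.K_pos
  induction n with
  | zero => exact ⟨s, t, by simpa [hl1] using hst, by simpa [iter] using h⟩
  | succ n ih =>
    obtain ⟨s', t', h1, h2⟩ := ih
    set lam := min 1 ((γ / 3) ^ n * l) with hlam
    have hlam0 : 0 < lam := lt_min one_pos (by positivity)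
    have hlam1 : lam ≤ 1 := min_le_left _ _
    obtain ⟨u, v, h3, h4⟩ := S.op_ge_on (e (j + n)) (S.iter_nonneg e j n hf)
      (s := s') (t := s' + lam) (b := b / (K ^ 3) ^ n) (by linarith) (by linarith) (by positivity)
      fun x hx hx' => h2 x hx (by linarith)
    refine ⟨u, v, ?_, fun y hy hy' => ?_⟩
    · have h5 : min 1 ((γ / 3) ^ (n + 1) * l) ≤ γ / 3 * lam := by
        rcases min_choice 1 ((γ / 3) ^ n * l) with h6 | h6
        · rw [hlam, h6]
          exact (min_le_left _ _).trans (by linarith)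
        · rw [hlam, h6]
          exact (min_le_right _ _).trans (by rw [pow_succ]; linarith)
      linarith
    · have := h4 y hy hy'
      rwa [div_div, ← pow_succ] at this

theorem iter_ge (j n : ℕ) {f : ℝ → ℝ} (hf : ∀ t, 0 ≤ f t) (hper : Function.Periodic f 1)
    {s b l : ℝ} (hl : 0 < l) (hl1 : l ≤ 1) (hn : 1 ≤ (γ / 3) ^ n * l) (hb : 0 ≤ b)
    (h : ∀ x, s < x → x < s + l → b ≤ f x) (y : ℝ) :
    b / (K ^ 3) ^ (n + 1) ≤ S.iter e j (n + 1) f y := by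
  have hK := S.K_pos
  obtain ⟨s', t', h1, h2⟩ := S.iter_ge_on e j n hf hl hl1 le_rfl hb h
  rw [min_eq_left hn] at h1
  have hper' : ∀ n, Function.Periodic (S.iter e j n f) 1 := fun n => by
    induction n with
    | zero => exact hper
    | succ n ih => exact S.op_periodic _ ih
  have := S.op_ge (e (j + n)) (S.iter_nonneg e j n hf) (hper' n) h1 (by positivity) h2 y
  rwa [div_div, ← pow_succ] at this

/-- Uniform lower bound and cone contraction after a fixed number of steps. -/
theorem exists_mixing : ∃ N : ℕ, 0 < N ∧ ∃ ε : ℝ, 0 < ε ∧ ε ≤ 1 / 2 ∧ ∀ (e : ℕ → ι × ι) (j : ℕ)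
    (f : ℝ → ℝ), Cone S.aperture f →
      (∀ t, ε * (∫ t in (0 : ℝ)..1, f t) ≤ S.iter e j N f t) ∧
      HasVar (S.iter e j N f) (S.aperture / 2 * ∫ t in (0 : ℝ)..1, f t) := by
  have hγ := S.three_lt
  have hK := S.K_pos
  have ha := S.aperture_pos
  set l := min 1 (1 / (2 * S.aperture)) with hl
  have hl0 : 0 < l := lt_min one_pos (by positivity)
  -- `n₁` steps grow an interval of length `l` to a full period; `n₂` steps bring the variation down
  -- to half the aperture, leaving room in the cone for subtracting a constant.
  obtain ⟨n₁, hn₁⟩ := pow_unbounded_of_one_lt (1 / l) (show 1 < γ / 3 by linarith)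
  obtain ⟨n₂, hn₂⟩ := exists_pow_lt_of_lt_one (show (0 : ℝ) < 1 / 4 by norm_num)
    (show (3 / 4 : ℝ) < 1 by norm_num)
  set n := max n₁ n₂ with hn
  refine ⟨n + 1, by lia, 1 / 2 / (K ^ 3) ^ (n + 1), by positivity, ?_, fun e j f hf => ⟨?_, ?_⟩⟩
  · refine div_le_self (by norm_num) (one_le_pow₀ (one_le_pow₀ S.one_le))
  · obtain ⟨s, hs⟩ := hf.exists_interval ha
    intro t
    have h1 : 1 ≤ (γ / 3) ^ n * l := by
      rw [div_lt_iff₀ hl0] at hn₁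
      refine hn₁.le.trans (mul_le_mul_of_nonneg_right ?_ hl0.le)
      exact pow_le_pow_right₀ (by linarith) (le_max_left _ _)
    have h2 := S.iter_ge e j n hf.nonneg hf.obs.per hl0 (min_le_left _ _) h1
      (div_nonneg hf.integral_nonneg zero_le_two)
      (fun x hx hx' => hs x hx (hx'.trans_le (by linarith [min_le_right 1 (1 / (2 * S.aperture))])))
      t
    refine le_trans (le_of_eq ?_) h2
    ring
  · refine (S.iter_hasVar e j (n + 1) hf).weaken ?_
    have h2 := mul_nonneg ha.le hf.integral_nonneg
    have h3 : (3 / 4 : ℝ) ^ (n + 1) ≤ 1 / 4 :=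
      (pow_le_pow_of_le_one (by norm_num) (by norm_num)
        (show n₂ ≤ n + 1 by have := le_max_right n₁ n₂; lia)).trans hn₂.le
    nlinarith

/-! ### Differences of densities -/

/-- Differences of two functions of the cone with the same integral `I`. -/
def Diff (a I : ℝ) (v : ℝ → ℝ) : Prop :=
  ∃ f g : ℝ → ℝ, Cone a f ∧ Cone a g ∧ (∫ t in (0 : ℝ)..1, f t) = I ∧
    (∫ t in (0 : ℝ)..1, g t) = I ∧ v = fun t => f t - g t

theorem Diff.obs {a I : ℝ} {v : ℝ → ℝ} (h : Diff a I v) : Obs v := by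
  obtain ⟨f, g, hf, hg, _, _, rfl⟩ := h
  exact hf.obs.sub hg.obs

theorem Diff.abs_le {a I : ℝ} {v : ℝ → ℝ} (h : Diff a I v) (t : ℝ) : |v t| ≤ (1 + a) * I := by
  obtain ⟨f, g, hf, hg, h1, h2, rfl⟩ := h
  have h3 := hf.le t
  have h4 := hg.le t
  have h5 := hf.nonneg t
  have h6 := hg.nonneg t
  rw [h1] at h3
  rw [h2] at h4
  simp only
  rw [_root_.abs_le]
  constructor <;> linarith

theorem Diff.add {a I I' : ℝ} {v v' : ℝ → ℝ} (h : Diff a I v) (h' : Diff a I' v') :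
    Diff a (I + I') (fun t => v t + v' t) := by
  obtain ⟨f, g, hf, hg, h1, h2, rfl⟩ := h
  obtain ⟨f', g', hf', hg', h1', h2', rfl⟩ := h'
  refine ⟨_, _, hf.add hf', hg.add hg', ?_, ?_, by funext t; ring⟩
  · rw [hf.obs.integral_add hf'.obs, h1, h1']
  · rw [hg.obs.integral_add hg'.obs, h2, h2']

/-- The same constant is added to both functions. The mass `I` thus acts as a norm for `v`, which
also bounds its supremum. -/
theorem Diff.weaken {a I I' : ℝ} {v : ℝ → ℝ} (ha : 0 ≤ a) (h : Diff a I v) (hI : I ≤ I') :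
    Diff a I' v := by
  obtain ⟨f, g, hf, hg, h1, h2, rfl⟩ := h
  have hI' : 0 ≤ I' - I := by linarith
  refine ⟨_, _, hf.add_const ha hI', hg.add_const ha hI', ?_, ?_, by funext t; ring⟩
  · rw [hf.obs.integral_add (Obs.const _), h1]; simp
  · rw [hg.obs.integral_add (Obs.const _), h2]; simp

theorem Diff.zero {a : ℝ} : Diff a 0 (fun _ => 0) :=
  ⟨fun _ => 0, fun _ => 0, ⟨fun _ => le_rfl, by simpa using HasVar.const 0⟩,
    ⟨fun _ => le_rfl, by simpa using HasVar.const 0⟩, by simp, by simp, by simp⟩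

theorem diff_op (e : ι × ι) {I : ℝ} {v : ℝ → ℝ} (h : Diff S.aperture I v) :
    Diff S.aperture I (S.op e v) := by
  obtain ⟨f, g, hf, hg, h1, h2, rfl⟩ := h
  exact ⟨_, _, S.cone_op e hf, S.cone_op e hg, by rw [S.integral_op e hf.obs, h1],
    by rw [S.integral_op e hg.obs, h2], S.op_sub e f g⟩

/-- After `N` steps both functions are at least `ε * I`. Subtracting this common constant leaves the
difference unchanged; the variation, at most half the aperture times `I`, still fits the cone with
mass `(1 - ε) * I` because `ε ≤ 1 / 2`. -/
theorem diff_iter {N : ℕ} {ε : ℝ} (hε' : ε ≤ 1 / 2)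
    (hmix : ∀ (e : ℕ → ι × ι) (j : ℕ) (f : ℝ → ℝ), Cone S.aperture f →
      (∀ t, ε * (∫ t in (0 : ℝ)..1, f t) ≤ S.iter e j N f t) ∧
      HasVar (S.iter e j N f) (S.aperture / 2 * ∫ t in (0 : ℝ)..1, f t))
    (j : ℕ) {I : ℝ} {v : ℝ → ℝ} (h : Diff S.aperture I v) :
    Diff S.aperture ((1 - ε) * I) (S.iter e j N v) := by
  obtain ⟨f, g, hf, hg, h1, h2, rfl⟩ := h
  have key : ∀ f : ℝ → ℝ, Cone S.aperture f → (∫ t in (0 : ℝ)..1, f t) = I →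
      Cone S.aperture (fun t => S.iter e j N f t + -(ε * I)) ∧
      (∫ t in (0 : ℝ)..1, (S.iter e j N f t + -(ε * I))) = (1 - ε) * I := by
    intro f hf hI
    obtain ⟨h3, h4⟩ := hmix e j f hf
    have h5 := hf.integral_nonneg
    rw [hI] at h3 h4 h5
    have h6 : (∫ t in (0 : ℝ)..1, (S.iter e j N f t + -(ε * I))) = (1 - ε) * I := by
      rw [h4.obs.integral_add (Obs.const _), S.integral_iter e j N hf.obs, hI]
      simp; ring
    refine ⟨⟨fun t => by linarith [h3 t], ?_⟩, h6⟩
    rw [h6]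
    refine (h4.add_const _).weaken ?_
    have := mul_nonneg S.aperture_pos.le h5
    nlinarith
  obtain ⟨k1, k2⟩ := key f hf h1
  obtain ⟨k3, k4⟩ := key g hg h2
  refine ⟨_, _, k1, k3, k2, k4, ?_⟩
  rw [iter_sub]
  funext t
  ring

end System

/-! ### Linear growth of the variance of the number of visits to gates -/

/-- A sequence of induced maps, a sequence of gates to be counted, and an initial density. -/
structure Chain {ι : Type*} {γ K Λ ℓ : ℝ} (S : System ι γ K Λ ℓ) (b : ℝ) where
  idx : ℕ → ι × ι
  obsIdx : ℕ → ι
  init : ℝ → ℝ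
  cone : Cone S.aperture init
  mass : ∫ t in (0 : ℝ)..1, init t = 1
  le_init : ∀ t, b ≤ init t

namespace Chain

variable {ι : Type*} {γ K Λ ℓ b : ℝ} {S : System ι γ K Λ ℓ} (X : Chain S b)

/-- The indicator of the gate counted at time `j`. -/
noncomputable def visit (j : ℕ) : ℝ → ℝ := (S.gate (X.obsIdx j)).indicator 1

/-- The induced map at time `j`. -/
noncomputable def ind (j : ℕ) : ℝ → ℝ := S.ind (X.idx j)

/-- The density of the state at time `j`. -/
noncomputable def dens : ℕ → ℝ → ℝ
  | 0 => X.init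
  | j + 1 => S.op (X.idx j) (dens j)

/-- The expected number of visits at time `j`. -/
noncomputable def mean (j : ℕ) : ℝ := ∫ t in (0 : ℝ)..1, X.visit j t * X.dens j t

/-- The centred visit at time `j`, weighted by the density. -/
noncomputable def src (j : ℕ) (t : ℝ) : ℝ := (X.visit j t - X.mean j) * X.dens j t

/-- The centred number of visits before time `j`, transported by the transfer operators. -/
noncomputable def past : ℕ → ℝ → ℝ
  | 0 => fun _ => 0
  | j + 1 => S.op (X.idx j) (fun t => past j t + X.src j t)

/-- The number of visits at times `j, ..., j + l - 1`. -/
noncomputable def count : ℕ → ℕ → ℝ → ℝ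
  | _, 0 => fun _ => 0
  | j, l + 1 => fun t => X.visit j t + count (j + 1) l (X.ind j t)

theorem visit_nonneg (j : ℕ) (t : ℝ) : 0 ≤ X.visit j t :=
  Set.indicator_nonneg (fun _ _ => zero_le_one) t

theorem visit_eq (j : ℕ) (t : ℝ) : X.visit j t = 0 ∨ X.visit j t = 1 := by
  by_cases h : t ∈ S.gate (X.obsIdx j) <;> simp [visit, h]

theorem visit_obs (j : ℕ) : Obs (X.visit j) := S.obs_gate (Obs.const 1) _

theorem dens_cone (j : ℕ) : Cone S.aperture (X.dens j) := by
  induction j with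
  | zero => exact X.cone
  | succ j ih => exact S.cone_op _ ih

theorem dens_mass (j : ℕ) : ∫ t in (0 : ℝ)..1, X.dens j t = 1 := by
  induction j with
  | zero => exact X.mass
  | succ j ih => rw [dens, S.integral_op _ (X.dens_cone j).obs, ih]

theorem dens_add (j i : ℕ) : X.dens (j + i) = S.iter X.idx j i (X.dens j) := by
  induction i with
  | zero => rfl
  | succ i ih => rw [← add_assoc, dens, ih, System.iter]

theorem visit_dens (j : ℕ) :
    (fun t => X.visit j t * X.dens j t) = (S.gate (X.obsIdx j)).indicator (X.dens j) := by
  funext t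
  by_cases h : t ∈ S.gate (X.obsIdx j) <;> simp [visit, h]

theorem mean_mem (j : ℕ) : 0 ≤ X.mean j ∧ X.mean j ≤ 1 := by
  have h := X.dens_cone j
  refine ⟨intervalIntegral.integral_nonneg zero_le_one fun t _ =>
    mul_nonneg (X.visit_nonneg j t) (h.nonneg t), ?_⟩
  rw [← X.dens_mass j]
  refine ((X.visit_obs j).mul h.obs).integral_mono h.obs (fun t => ?_) zero_le_one
  have := h.nonneg t
  rcases X.visit_eq j t with h1 | h1 <;> simp [h1, this]

theorem mean_ge {b' : ℝ} (hb' : 0 ≤ b') (j : ℕ) (h : ∀ t, b' ≤ X.dens j t) :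
    b' * ℓ ≤ X.mean j := by
  set i := X.obsIdx j with hi
  have hg := S.isGate i
  have ho := (X.visit_obs j).mul (X.dens_cone j).obs
  have h1 : ∫ t in S.left i..S.right i, b' ≤
      ∫ t in S.left i..S.right i, X.visit j t * X.dens j t := by
    refine intervalIntegral.integral_mono_on_of_le_Ioo hg.lt.le (by simp)
      (ho.intervalIntegrable _ _) fun t ht => ?_
    have : t ∈ S.gate (X.obsIdx j) := hg.sub t ht.1 ht.2
    simp only [visit, Set.indicator_of_mem this, Pi.one_apply, one_mul]
    exact h t
  have h2 : ∫ t in S.left i..S.right i, X.visit j t * X.dens j t ≤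
      ∫ t in S.left i..S.left i + 1, X.visit j t * X.dens j t :=
    intervalIntegral.integral_mono_interval le_rfl hg.lt.le hg.lt_add.le
      (Eventually.of_forall fun t => mul_nonneg (X.visit_nonneg j t) ((X.dens_cone j).nonneg t))
      (ho.intervalIntegrable _ _)
  rw [ho.integral_period] at h2
  rw [intervalIntegral.integral_const, smul_eq_mul] at h1
  have h3 := mul_le_mul_of_nonneg_left (S.len_le i) hb'
  rw [mean]
  linarith

/-- A bound for the size of the source terms. -/
noncomputable def srcBound (S : System ι γ K Λ ℓ) : ℝ :=
  1 + (2 * S.aperture + 4 / ℓ) / S.aperture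

theorem src_diff (j : ℕ) : System.Diff S.aperture (srcBound S) (X.src j) := by
  have ha := S.aperture_pos
  have hl := S.len_pos
  have hc := X.dens_cone j
  have hm := X.dens_mass j
  obtain ⟨hm0, hm1⟩ := X.mean_mem j
  set i := X.obsIdx j with hi
  -- The constant `M` is added to both parts of the source so that its mass pays for the variation
  -- created by cutting the density along the gate.
  set M := (2 * S.aperture + 4 / ℓ) / S.aperture with hM
  have haM : S.aperture * M = 2 * S.aperture + 4 / ℓ := by rw [hM]; field_simp
  have hM0 : 0 ≤ M := by positivity
  have h4 : 0 < 4 / ℓ := by positivity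
  obtain ⟨V₁, V₂, h1, h2, h3⟩ := (S.isGate i).hasVar_indicator hc.nonneg hc.var hl (S.len_le i)
    (S.gap_le i)
  rw [hm, mul_one, mul_one] at h3
  have h5 := h2.nonneg
  rw [← X.visit_dens j] at h1
  have i1 : ∫ t in (0 : ℝ)..1, (X.visit j t * X.dens j t + M) = X.mean j + M := by
    rw [h1.obs.integral_add (Obs.const M), mean]; simp
  have i2 : ∫ t in (0 : ℝ)..1, (X.mean j * X.dens j t + M) = X.mean j + M := by
    rw [(hc.obs.smul (X.mean j)).integral_add (Obs.const M), intervalIntegral.integral_const_mul,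
      hm]
    simp
  have h6 := mul_nonneg ha.le hm0
  have h7 : System.Diff S.aperture (X.mean j + M) (X.src j) := by
    refine ⟨fun t => X.visit j t * X.dens j t + M, fun t => X.mean j * X.dens j t + M,
      ⟨fun t => ?_, ?_⟩, ⟨fun t => ?_, ?_⟩, i1, i2, ?_⟩
    · exact add_nonneg (mul_nonneg (X.visit_nonneg j t) (hc.nonneg t)) hM0
    · rw [i1]
      exact (h1.add_const M).weaken (by rw [mul_add, haM]; linarith)
    · exact add_nonneg (mul_nonneg hm0 (hc.nonneg t)) hM0
    · rw [i2]
      refine ((hc.var.smul hm0).add_const M).weaken ?_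
      rw [hm, mul_one, mul_add, haM]
      nlinarith
    · funext t
      simp only [src]; ring
  exact h7.weaken ha.le (by rw [srcBound]; linarith)

/-- Over `i` steps the past differs from its transported initial value by `i` source terms, and no
operator increases the size of a `Diff`. -/
theorem past_add (j i : ℕ) : System.Diff S.aperture (i * srcBound S)
    (fun t => X.past (j + i) t - S.iter X.idx j i (X.past j) t) := by
  induction i with
  | zero => simpa [System.iter] using System.Diff.zero
  | succ i ih =>
    have h := S.diff_op (X.idx (j + i)) (ih.add (X.src_diff (j + i)))
    have e1 : (fun t => X.past (j + (i + 1)) t - S.iter X.idx j (i + 1) (X.past j) t) =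
        S.op (X.idx (j + i)) (fun t => X.past (j + i) t - S.iter X.idx j i (X.past j) t +
          X.src (j + i) t) := by
      rw [← add_assoc, past, System.iter, ← S.op_sub]
      congr 1
      funext t
      ring
    rw [e1]
    convert h using 1
    push_cast; ring

/-- In `N` steps the old past shrinks by `1 - ε` while the new sources have size at most `N *
srcBound S`; the bound is the fixed point of this recursion and does not depend on `j`. -/
theorem past_diff {N : ℕ} {ε : ℝ} (hN : 0 < N) (hε : 0 < ε) (hε' : ε ≤ 1 / 2)
    (hmix : ∀ (e : ℕ → ι × ι) (j : ℕ) (f : ℝ → ℝ), Cone S.aperture f →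
      (∀ t, ε * (∫ t in (0 : ℝ)..1, f t) ≤ S.iter e j N f t) ∧
      HasVar (S.iter e j N f) (S.aperture / 2 * ∫ t in (0 : ℝ)..1, f t)) (j : ℕ) :
    System.Diff S.aperture (N * srcBound S / ε) (X.past j) := by
  have ha := S.aperture_pos
  have hl := S.len_pos
  have hs : 0 ≤ srcBound S := by rw [srcBound]; positivity
  induction j using Nat.strong_induction_on with
  | _ j ih =>
    rcases lt_or_ge j N with hj | hj
    · have h := X.past_add 0 j
      have e0 : S.iter X.idx 0 j (X.past 0) = fun _ => 0 := by
        have h0 : X.past 0 = fun t => (fun _ : ℝ => (0 : ℝ)) t - (fun _ : ℝ => (0 : ℝ)) t := by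
          funext t; simp [past]
        rw [h0, S.iter_sub]
        funext t; ring
      simp only [zero_add, e0, sub_zero] at h
      refine h.weaken ha.le ?_
      rw [le_div_iff₀ hε]
      have h1 : (j : ℝ) ≤ N := by exact_mod_cast hj.le
      have h2 := mul_le_mul_of_nonneg_right h1 hs
      have h3 : 0 ≤ (j : ℝ) * srcBound S := by positivity
      nlinarith
    · obtain ⟨i, rfl⟩ := Nat.exists_eq_add_of_le' hj
      have h1 := X.past_add i N
      have h2 := S.diff_iter X.idx hε' hmix i (ih i (by lia))
      have h3 := h2.add h1
      have e1 : (fun t => S.iter X.idx i N (X.past i) t +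
          (X.past (i + N) t - S.iter X.idx i N (X.past i) t)) = X.past (i + N) := by
        funext t; ring
      rw [e1] at h3
      refine h3.weaken ha.le (le_of_eq ?_)
      field_simp; ring

/-- During the first `N` steps the initial lower bound loses at most `K ^ 3` per step; from then on
mixing supplies `ε`. -/
theorem dens_ge {N : ℕ} {ε : ℝ} (hb : 0 ≤ b)
    (hmix : ∀ (e : ℕ → ι × ι) (j : ℕ) (f : ℝ → ℝ), Cone S.aperture f →
      (∀ t, ε * (∫ t in (0 : ℝ)..1, f t) ≤ S.iter e j N f t) ∧
      HasVar (S.iter e j N f) (S.aperture / 2 * ∫ t in (0 : ℝ)..1, f t)) (j : ℕ) (t : ℝ) :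
    min ε (b / (K ^ 3) ^ N) ≤ X.dens j t := by
  have hK := S.K_pos
  rcases lt_or_ge j N with hj | hj
  · refine (min_le_right _ _).trans ?_
    have h1 : ∀ j t, b / (K ^ 3) ^ j ≤ X.dens j t := by
      intro j
      induction j with
      | zero => simpa [dens] using X.le_init
      | succ j ih =>
        intro t
        have := S.op_ge (X.idx j) (X.dens_cone j).nonneg (X.dens_cone j).obs.per
          (s := 0) (t := 1) (b := b / (K ^ 3) ^ j) (by norm_num) (by positivity)
          (fun x _ _ => ih x) t
        rw [div_div, ← pow_succ] at this
        exact this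
    refine le_trans ?_ (h1 j t)
    exact div_le_div_of_nonneg_left hb (by positivity)
      (pow_le_pow_right₀ (one_le_pow₀ S.one_le) hj.le)
  · refine (min_le_left _ _).trans ?_
    obtain ⟨i, rfl⟩ := Nat.exists_eq_add_of_le' hj
    have := (hmix X.idx i (X.dens i) (X.dens_cone i)).1 t
    rwa [X.dens_mass, mul_one, ← X.dens_add] at this

/-! #### The energy identity -/

/-- Conditional mean of the centred past given the present. -/
noncomputable def cm (j : ℕ) (t : ℝ) : ℝ := X.past j t / X.dens j t

/-- Reverse martingale differences. -/
noncomputable def incr (j : ℕ) (t : ℝ) : ℝ :=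
  X.visit j t - X.mean j + X.cm j t - X.cm (j + 1) (X.ind j t)

/-- Conditional mean of the centred number of visits given the state at time `j`. -/
noncomputable def rem (κ : ℝ) : ℕ → ℕ → ℝ → ℝ
  | j, 0 => fun t => X.cm j t - κ
  | j, l + 1 => fun t => X.incr j t + rem κ (j + 1) l (X.ind j t)

/-- Quadratic variation over `l` steps. -/
noncomputable def quad : ℕ → ℕ → ℝ → ℝ
  | _, 0 => fun _ => 0
  | j, l + 1 => fun t => X.incr j t ^ 2 + quad (j + 1) l (X.ind j t)

/-- The sum of the increments over `l` steps. -/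
noncomputable def drift : ℕ → ℕ → ℝ → ℝ
  | _, 0 => fun _ => 0
  | j, l + 1 => fun t => X.incr j t + drift (j + 1) l (X.ind j t)

/-- The indicator of having no visit during `l` steps. -/
noncomputable def avoid : ℕ → ℕ → ℝ → ℝ
  | _, 0 => fun _ => 1
  | j, l + 1 => fun t => (1 - X.visit j t) * avoid (j + 1) l (X.ind j t)

theorem rem_eq (κ : ℝ) (j l : ℕ) (t : ℝ) :
    X.rem κ j l t = X.count j l t - ∑ i ∈ Finset.range l, X.mean (j + i) + X.cm j t - κ := by
  induction l generalizing j t with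
  | zero => simp [rem, count]
  | succ l ih =>
    have h : ∑ i ∈ Finset.range (l + 1), X.mean (j + i) =
        X.mean j + ∑ i ∈ Finset.range l, X.mean (j + 1 + i) := by
      rw [Finset.sum_range_succ', add_zero, add_comm]
      congr 1
      exact Finset.sum_congr rfl fun i _ => by congr 1; ring
    simp only [rem, count, incr]
    rw [ih, h]
    ring

theorem avoid_eq (j l : ℕ) (t : ℝ) : X.avoid j l t = 0 ∨ X.avoid j l t = 1 := by
  induction l generalizing j t with
  | zero => exact Or.inr rfl
  | succ l ih =>
    rcases X.visit_eq j t with h | h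
    · simpa [avoid, h] using ih (j + 1) (X.ind j t)
    · left; simp [avoid, h]

theorem obs_ind (j : ℕ) {ψ : ℝ → ℝ} (hψ : Obs ψ) : Obs (fun t => ψ (X.ind j t)) := S.obs_ind _ hψ

theorem avoid_obs (j l : ℕ) : Obs (X.avoid j l) := by
  induction l generalizing j with
  | zero => exact Obs.const 1
  | succ l ih => exact ((Obs.const 1).sub (X.visit_obs j)).mul (X.obs_ind j (ih (j + 1)))

/-- The density is restricted to the complement of the counted gate and then pushed forward; by
`op_avoid_ge` the result is again bounded below everywhere, with a loss of only `K`, so the argument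
repeats. -/
theorem integral_avoid {f : ℝ → ℝ} {b' : ℝ} (hb' : 0 ≤ b') (hf : Obs f) (h : ∀ t, b' ≤ f t)
    (j l : ℕ) : b' / K ^ l ≤ ∫ t in (0 : ℝ)..1, f t * X.avoid j l t := by
  have hK := S.K_pos
  induction l generalizing f b' j with
  | zero =>
    have := (Obs.const b').integral_mono hf h (zero_le_one)
    simpa [avoid] using this
  | succ l ih =>
    have h1 : Obs (fun t => f t * (1 - X.visit j t)) :=
      hf.mul ((Obs.const 1).sub (X.visit_obs j))
    have h2 := ih (f := S.op (X.idx j) (fun t => f t * (1 - X.visit j t))) (b' := b' / K)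
      (by positivity) (S.op_obs _ h1) (S.op_avoid_ge (X.idx j) hb' h (X.obsIdx j)) (j + 1)
    rw [S.op_duality _ h1 (X.avoid_obs (j + 1) l), div_div, ← pow_succ'] at h2
    refine h2.trans (le_of_eq ?_)
    refine intervalIntegral.integral_congr fun t _ => ?_
    simp only [avoid, ind]
    ring

/-- Cauchy–Schwarz in linearized form: the sum of the squares `(incr + x) ^ 2` is nonnegative. -/
theorem quad_ge (x : ℝ) (j l : ℕ) (t : ℝ) :
    -(2 * x) * X.drift j l t - l * x ^ 2 ≤ X.quad j l t := by
  induction l generalizing j t with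
  | zero => simp [drift, quad]
  | succ l ih =>
    have h1 := ih (j + 1) (X.ind j t)
    have h2 := sq_nonneg (X.incr j t + x)
    simp only [drift, quad]
    push_cast
    nlinarith

theorem quad_nonneg (j l : ℕ) (t : ℝ) : 0 ≤ X.quad j l t := by
  have := X.quad_ge 0 j l t
  simpa using this

/-- Without visits the increments telescope to the initial `cm`, minus the final one, minus the sum
of the means. -/
theorem drift_le {U c : ℝ} (hU : ∀ j t, -U ≤ X.cm j t) (hc : ∀ j, c ≤ X.mean j) (j l : ℕ) (t : ℝ)
    (h : X.avoid j l t ≠ 0) : X.drift j l t ≤ X.cm j t + U - l * c := by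
  induction l generalizing j t with
  | zero => simp [drift]; linarith [hU j t]
  | succ l ih =>
    simp only [avoid] at h
    have h1 := right_ne_zero_of_mul h
    have h2 : X.visit j t = 0 := by
      rcases X.visit_eq j t with h2 | h2
      · exact h2
      · exact absurd (by rw [h2]; ring) h
    have h3 := ih (j + 1) (X.ind j t) h1
    have h4 := hc j
    simp only [drift, incr]
    rw [h2]
    push_cast
    linarith

theorem incr_obs (hcm : ∀ j, Obs (X.cm j)) (j : ℕ) : Obs (X.incr j) :=
  ((((X.visit_obs j).sub (Obs.const _)).add (hcm j))).sub (X.obs_ind j (hcm (j + 1)))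

theorem rem_obs (hcm : ∀ j, Obs (X.cm j)) (κ : ℝ) (j l : ℕ) : Obs (X.rem κ j l) := by
  induction l generalizing j with
  | zero => exact (hcm j).sub (Obs.const κ)
  | succ l ih => exact (X.incr_obs hcm j).add (X.obs_ind j (ih (j + 1)))

theorem quad_obs (hcm : ∀ j, Obs (X.cm j)) (j l : ℕ) : Obs (X.quad j l) := by
  induction l generalizing j with
  | zero => exact Obs.const 0
  | succ l ih =>
    have := ((X.incr_obs hcm j).mul (X.incr_obs hcm j)).add (X.obs_ind j (ih (j + 1)))
    simp only [← pow_two] at this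
    exact this

/-- Orthogonality of reverse martingale differences: `dens j * incr j` is pushed forward to `past (j
+ 1) - dens (j + 1) * cm (j + 1) = 0`, so the cross term with any function of the next state
vanishes. -/
theorem energy_step (hpos : ∀ j t, 0 < X.dens j t) (hcm : ∀ j, Obs (X.cm j))
    (j : ℕ) {R : ℝ → ℝ} (hR : Obs R) :
    ∫ t in (0 : ℝ)..1, X.dens j t * (X.incr j t + R (X.ind j t)) ^ 2 =
      (∫ t in (0 : ℝ)..1, X.dens j t * X.incr j t ^ 2) +
        ∫ t in (0 : ℝ)..1, X.dens (j + 1) t * R t ^ 2 := by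
  have hh := (X.dens_cone j).obs
  have hD := X.incr_obs hcm j
  have hRG := X.obs_ind j hR
  have hR2 : Obs (fun t => R t ^ 2) := by simpa only [← pow_two] using hR.mul hR
  have hD2 : Obs (fun t => X.dens j t * X.incr j t ^ 2) := by
    simpa only [← pow_two] using hh.mul (hD.mul hD)
  have h1 : ∫ t in (0 : ℝ)..1, X.dens (j + 1) t * R t ^ 2 =
      ∫ t in (0 : ℝ)..1, X.dens j t * R (X.ind j t) ^ 2 := S.op_duality (X.idx j) hh hR2
  have hp : Obs (fun t => X.past j t + X.src j t) := by
    have h2 := hh.mul (((X.visit_obs j).sub (Obs.const (X.mean j))).add (hcm j))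
    convert h2 using 1
    funext t
    have := (hpos j t).ne'
    simp only [src, cm]
    field_simp; ring
  have hu := (hcm (j + 1)).mul hR
  have h3 : ∫ t in (0 : ℝ)..1, (X.dens j t * X.incr j t) * R (X.ind j t) = 0 := by
    have e1 : ∀ t, (X.dens j t * X.incr j t) * R (X.ind j t) =
        (X.past j t + X.src j t) * R (X.ind j t) -
          X.dens j t * (X.cm (j + 1) (X.ind j t) * R (X.ind j t)) := by
      intro t
      have := (hpos j t).ne'
      simp only [src, incr, cm]
      field_simp; ring
    have e2 := S.op_duality (X.idx j) hp hR
    have e3 := S.op_duality (X.idx j) hh hu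
    simp only [e1]
    rw [(hp.mul hRG).integral_sub (hh.mul (X.obs_ind j hu))]
    change (∫ t in (0 : ℝ)..1, (X.past j t + X.src j t) * R (S.ind (X.idx j) t)) -
      ∫ t in (0 : ℝ)..1, X.dens j t * (X.cm (j + 1) (S.ind (X.idx j) t) *
        R (S.ind (X.idx j) t)) = 0
    rw [← e2, ← e3, sub_eq_zero]
    refine intervalIntegral.integral_congr fun t _ => ?_
    have := (hpos (j + 1) t).ne'
    change X.past (j + 1) t * R t = X.dens (j + 1) t * (X.cm (j + 1) t * R t)
    simp only [cm]
    field_simp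
  have e4 : ∀ t, X.dens j t * (X.incr j t + R (X.ind j t)) ^ 2 =
      (X.dens j t * X.incr j t ^ 2 + 2 * ((X.dens j t * X.incr j t) * R (X.ind j t))) +
        X.dens j t * R (X.ind j t) ^ 2 := fun t => by ring
  have o1 := ((hh.mul hD).mul hRG).smul 2
  have o2 : Obs (fun t => X.dens j t * R (X.ind j t) ^ 2) := hh.mul (X.obs_ind j hR2)
  simp only [e4]
  rw [(hD2.add o1).integral_add o2, hD2.integral_add o1, intervalIntegral.integral_const_mul,
    h3, h1]
  ring

theorem energy_eq (hpos : ∀ j t, 0 < X.dens j t) (hcm : ∀ j, Obs (X.cm j))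
    (κ : ℝ) (j i l : ℕ) :
    ∫ t in (0 : ℝ)..1, X.dens j t * X.rem κ j (i + l) t ^ 2 =
      (∫ t in (0 : ℝ)..1, X.dens j t * X.quad j i t) +
        ∫ t in (0 : ℝ)..1, X.dens (j + i) t * X.rem κ (j + i) l t ^ 2 := by
  induction i generalizing j with
  | zero => simp [quad]
  | succ i ih =>
    have hh := (X.dens_cone j).obs
    have hD := X.incr_obs hcm j
    have hq := X.quad_obs hcm (j + 1) i
    have hD2 : Obs (fun t => X.dens j t * X.incr j t ^ 2) := by
      simpa only [← pow_two] using hh.mul (hD.mul hD)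
    have e1 : i + 1 + l = (i + l) + 1 := by ring
    have e2 : j + (i + 1) = j + 1 + i := by ring
    have h1 := X.energy_step hpos hcm j (X.rem_obs hcm κ (j + 1) (i + l))
    rw [ih (j + 1)] at h1
    rw [e1, e2, rem, h1, ← add_assoc]
    congr 1
    have h2 : ∫ t in (0 : ℝ)..1, X.dens (j + 1) t * X.quad (j + 1) i t =
        ∫ t in (0 : ℝ)..1, X.dens j t * X.quad (j + 1) i (X.ind j t) :=
      S.op_duality (X.idx j) hh hq
    rw [h2, ← hD2.integral_add (hh.mul (X.obs_ind j hq))]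
    refine intervalIntegral.integral_congr fun t _ => ?_
    simp only [quad]; ring

end Chain

/-- Linear lower bound for the mean square deviation of the number of visits. -/
theorem System.count_growth {ι : Type*} {γ K Λ ℓ : ℝ} (S : System ι γ K Λ ℓ) {b : ℝ} (hb : 0 < b) :
    ∃ C : ℝ, 0 < C ∧ ∃ n₀ : ℕ, ∀ X : Chain S b, ∀ κ : ℝ, ∀ n : ℕ, n₀ ≤ n →
      C * n ≤ ∫ t in (0 : ℝ)..1, X.init t * (X.count 0 n t - κ) ^ 2 := by
  obtain ⟨N, hN, ε, hε, hε', hmix⟩ := S.exists_mixing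
  have ha := S.aperture_pos
  have hl := S.len_pos
  have hK := S.K_pos
  set b' := min ε (b / (K ^ 3) ^ N) with hb'
  have hb'0 : 0 < b' := lt_min hε (by positivity)
  set U := (1 + S.aperture) * (N * Chain.srcBound S / ε) / b' with hU
  -- A block so long that the expected visits, at least `b' * ℓ` each, exceed the possible variation
  -- `2 * U` of the conditional means by 1.
  obtain ⟨L, hL⟩ := exists_nat_gt ((2 * U + 1) / (b' * ℓ))
  have hs : 0 ≤ Chain.srcBound S := by rw [Chain.srcBound]; positivity
  have hU0 : 0 ≤ U := by positivity
  have hL0 : (0 : ℝ) < L := lt_of_le_of_lt (by positivity) hL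
  rw [div_lt_iff₀ (by positivity)] at hL
  have hL1 : 0 < L := by exact_mod_cast hL0
  set δ := 1 / L * (b' / K ^ L) with hδ
  have hδ0 : 0 < δ := by positivity
  refine ⟨δ / (2 * L), by positivity, L, fun X κ n hn => ?_⟩
  have hdens := X.dens_ge hb.le hmix
  have hpos : ∀ j t, 0 < X.dens j t := fun j t => hb'0.trans_le (hdens j t)
  have hpast := X.past_diff hN hε hε' hmix
  have hcmU : ∀ j t, |X.cm j t| ≤ U := fun j t => by
    rw [Chain.cm, abs_div, abs_of_pos (hpos j t), hU]
    have h1 := (hpast j).abs_le t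
    exact div_le_div₀ ((abs_nonneg _).trans h1) h1 hb'0 (hdens j t)
  have hcm : ∀ j, Obs (X.cm j) := fun j =>
    ⟨fun t => by simp only [Chain.cm, (hpast j).obs.per t, (X.dens_cone j).obs.per t],
      (hpast j).obs.meas.div (X.dens_cone j).obs.meas, U, hcmU j⟩
  have hmean : ∀ j, b' * ℓ ≤ X.mean j := fun j => X.mean_ge hb'0.le j (hdens j)
  have hblock : ∀ j, δ ≤ ∫ t in (0 : ℝ)..1, X.dens j t * X.quad j L t := fun j => by
    have h1 := X.integral_avoid hb'0.le (X.dens_cone j).obs (hdens j) j L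
    have h2 : ∫ t in (0 : ℝ)..1, 1 / L * (X.dens j t * X.avoid j L t) ≤
        ∫ t in (0 : ℝ)..1, X.dens j t * X.quad j L t := by
      refine (((X.dens_cone j).obs.mul (X.avoid_obs j L)).smul _).integral_mono
        ((X.dens_cone j).obs.mul (X.quad_obs hcm j L)) (fun t => ?_) zero_le_one
      rcases X.avoid_eq j L t with h3 | h3
      · rw [h3, mul_zero, mul_zero]
        exact mul_nonneg (hpos j t).le (X.quad_nonneg j L t)
      · rw [h3, mul_one, mul_comm]
        refine mul_le_mul_of_nonneg_left ?_ (hpos j t).le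
        have h4 := X.drift_le (fun j t => (abs_le.1 (hcmU j t)).1) hmean j L t (by rw [h3]; simp)
        have h5 := (abs_le.1 (hcmU j t)).2
        have h6 : X.drift j L t ≤ -1 := by linarith
        -- The optimal shift for a drift equal to -1 over `L` steps; it yields `2 / L - 1 / L`.
        have h7 := X.quad_ge (1 / L) j L t
        have h8 : (L : ℝ) * (1 / L) ^ 2 = 1 / L := by field_simp
        have h9 : 0 < 1 / (L : ℝ) := by positivity
        rw [h8] at h7
        nlinarith
    rw [intervalIntegral.integral_const_mul] at h2
    exact (mul_le_mul_of_nonneg_left h1 (by positivity)).trans h2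
  -- At time 0 the past vanishes, so with this shift `rem` is exactly `count - κ`. An arbitrary
  -- centring `κ` is thus allowed.
  set κ' := κ - ∑ i ∈ Finset.range n, X.mean (0 + i) with hκ'
  have key : ∀ k j l : ℕ, (k : ℝ) * δ ≤ ∫ t in (0 : ℝ)..1, X.dens j t * X.rem κ' j (k * L + l) t ^ 2 := by
    intro k
    induction k with
    | zero =>
      intro j l
      rw [Nat.cast_zero, zero_mul]
      exact intervalIntegral.integral_nonneg zero_le_one fun t _ =>
        mul_nonneg (hpos j t).le (sq_nonneg _)
    | succ k ih =>
      intro j l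
      have e1 : (k + 1) * L + l = L + (k * L + l) := by ring
      rw [e1, X.energy_eq hpos hcm]
      have h1 := ih (j + L) l
      have h2 := hblock j
      push_cast
      linarith
  have h1 := key (n / L) 0 (n % L)
  rw [Nat.div_add_mod'] at h1
  have h2 : ∀ t, X.rem κ' 0 n t = X.count 0 n t - κ := fun t => by
    rw [X.rem_eq, hκ', Chain.cm, Chain.past]
    ring
  simp only [h2] at h1
  refine le_trans ?_ h1
  -- The incomplete last block is shorter than a block and `n / L ≥ 1`, which costs the factor 2 in
  -- the constant.
  have h3 : (n : ℝ) ≤ (n / L : ℕ) * (2 * L) := by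
    have h4 : 1 ≤ n / L := (Nat.one_le_div_iff hL1).2 hn
    have h5 := Nat.div_add_mod n L
    have h6 := Nat.mod_lt n hL1
    have h7 : n ≤ n / L * (2 * L) := by nlinarith
    exact_mod_cast h7
  rw [div_mul_eq_mul_div, div_le_iff₀ (by positivity)]
  nlinarith

/-! ### Expanding maps and arcs of the circle -/

theorem coe_eq_coe_iff (s t : ℝ) :
    (s : UnitAddCircle) = (t : UnitAddCircle) ↔ ∃ k : ℤ, s - t = k := by
  rw [← sub_eq_zero, ← AddCircle.coe_sub, AddCircle.coe_eq_zero_iff]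
  constructor
  · rintro ⟨k, hk⟩
    exact ⟨k, by simpa using hk.symm⟩
  · rintro ⟨k, hk⟩
    exact ⟨k, by simpa using hk.symm⟩

theorem coe_add_int (s : ℝ) (k : ℤ) : ((s + k : ℝ) : UnitAddCircle) = (s : UnitAddCircle) :=
  (coe_eq_coe_iff _ _).2 ⟨k, by ring⟩

/-- A lift of a circle map changes by a constant integer over a period. -/
theorem exists_degree {f : ℝ → ℝ} {T : UnitAddCircle → UnitAddCircle} (hf : Continuous f)
    (hT : ∀ t : ℝ, T (t : UnitAddCircle) = (f t : UnitAddCircle)) :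
    ∃ d : ℤ, ∀ t, f (t + 1) = f t + d := by
  have h1 : ∀ t, ∃ k : ℤ, f (t + 1) - f t = k := fun t => by
    rw [← coe_eq_coe_iff, ← hT, ← hT]
    congr 1
    simp
  choose n hn using h1
  have hc : Continuous n := by
    rw [Int.isClosedEmbedding_coe_real.isEmbedding.continuous_iff]
    have : (fun k : ℤ => (k : ℝ)) ∘ n = fun t => f (t + 1) - f t := by
      funext t; simp [hn]
    change Continuous ((fun k : ℤ => (k : ℝ)) ∘ n)
    rw [this]
    fun_prop
  refine ⟨n 0, fun t => ?_⟩
  have := PreconnectedSpace.constant (inferInstance : PreconnectedSpace ℝ) hc (x := t) (y := 0)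
  rw [← this, ← hn]
  ring

theorem exists_sign {f : ℝ → ℝ} {γ : ℝ} (hγ : 0 < γ) (hf : Continuous f) (h : ∀ t, γ ≤ |f t|) :
    ∃ s : ℝ, (s = 1 ∨ s = -1) ∧ ∀ t, s * f t = |f t| := by
  have hne : ∀ t, f t ≠ 0 := fun t h0 => by have := h t; rw [h0, abs_zero] at this; linarith
  by_cases hp : ∃ t, 0 < f t
  · refine ⟨1, Or.inl rfl, fun t => ?_⟩
    rw [one_mul, abs_of_nonneg]
    by_contra! hc
    obtain ⟨u, hu⟩ := hp
    obtain ⟨z, hz⟩ := mem_range_of_exists_le_of_exists_ge hf ⟨t, hc.le⟩ ⟨u, hu.le⟩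
    exact hne z hz
  · push Not at hp
    refine ⟨-1, Or.inr rfl, fun t => ?_⟩
    rw [abs_of_nonpos (hp t)]
    ring

/-- A derivative of constant sign, bounded away from zero, makes the lift a bijection of the line.
Its degree exceeds 3 in absolute value, hence is at least 4; the Lipschitz constant of the weight
combines `1 / γ ^ 2` from inverting the derivative with `1 / γ` from the inverse map. -/
theorem exists_cover {γ K K₁ : ℝ} (hγ : 3 < γ) {T : UnitAddCircle → UnitAddCircle}
    (h : ExpandingBounds γ K K₁ T) :
    ∃ c : Cover γ K (K₁ / γ ^ 3), ∀ t : ℝ, T (t : UnitAddCircle) = (c.lift t : UnitAddCircle) := by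
  obtain ⟨f, hf, hT, hb, hlip⟩ := h
  have hγ0 : 0 < γ := by linarith
  have hdc : Continuous (deriv f) := hf.continuous_deriv le_rfl
  have hdiff : Differentiable ℝ f := hf.differentiable one_ne_zero
  have hK₁ : 0 ≤ K₁ := by
    have := (abs_nonneg _).trans (hlip 1 0); simpa using this
  obtain ⟨σ, hσ, hs⟩ := exists_sign hγ0 hdc fun t => (hb t).1
  have hσσ : σ * σ = 1 := by rcases hσ with h | h <;> simp [h]
  have hσa : |σ| = 1 := by rcases hσ with h | h <;> simp [h]
  have hinc : ∀ s t, s ≤ t → γ * (t - s) ≤ σ * f t - σ * f s := fun s t hst => by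
    refine mul_sub_le_image_sub_of_le_deriv (hdiff.const_mul σ) (fun x => ?_) hst
    rw [deriv_const_mul_field, hs]
    exact (hb x).1
  have hexp : ∀ s t, γ * |s - t| ≤ |f s - f t| := by
    have : ∀ s t, s ≤ t → γ * |s - t| ≤ |f s - f t| := fun s t hst => by
      have h1 := hinc s t hst
      have h2 : |f s - f t| = |σ * f t - σ * f s| := by
        rw [← mul_sub, abs_mul, hσa, one_mul, abs_sub_comm]
      rw [h2, abs_sub_comm, abs_of_nonneg (by linarith : 0 ≤ t - s)]
      exact h1.trans (le_abs_self _)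
    intro s t
    rcases le_total s t with h | h
    · exact this s t h
    · rw [abs_sub_comm s, abs_sub_comm (f s)]; exact this t s h
  have hinj : Function.Injective f := fun s t hst => by
    have := hexp s t
    rw [hst, sub_self, abs_zero] at this
    have h1 : |s - t| ≤ 0 := by
      by_contra! hc
      nlinarith
    exact sub_eq_zero.1 (abs_nonpos_iff.1 h1)
  have hsurj : Function.Surjective f := fun y => by
    have hc : Continuous fun t => σ * f t := by
      have := hdiff.continuous
      fun_prop
    set M := |σ * y - σ * f 0| / γ with hM
    have hM0 : 0 ≤ M := by positivity
    have hMγ : γ * M = |σ * y - σ * f 0| := by rw [hM]; field_simp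
    have h1 := hinc 0 M hM0
    have h2 := hinc (-M) 0 (by linarith)
    obtain ⟨z, hz⟩ := mem_range_of_exists_le_of_exists_ge (c := σ * y) hc
      ⟨-M, by have := neg_abs_le (σ * y - σ * f 0); linarith⟩
      ⟨M, by have := le_abs_self (σ * y - σ * f 0); linarith⟩
    refine ⟨z, ?_⟩
    have : σ * (σ * f z) = σ * (σ * y) := congrArg (σ * ·) hz
    rwa [← mul_assoc, ← mul_assoc, hσσ, one_mul, one_mul] at this
  obtain ⟨d, hd⟩ := exists_degree hdiff.continuous hT
  set g := Function.surjInv hsurj with hg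
  have hfg : ∀ y, f (g y) = y := Function.surjInv_eq hsurj
  have hgf : ∀ x, g (f x) = x := fun x => hinj (hfg _)
  have hglip : ∀ y z, |g y - g z| ≤ 1 / γ * |y - z| := fun y z => by
    have := hexp (g y) (g z)
    rw [hfg, hfg] at this
    rw [one_div, inv_mul_eq_div, le_div_iff₀ hγ0]
    linarith
  have hgc : Continuous g := (LipschitzWith.of_dist_le_mul (K := ⟨1 / γ, by positivity⟩)
    fun s t => by rw [Real.dist_eq, Real.dist_eq]; exact hglip s t).continuous
  have hpos : ∀ t, 0 < |deriv f t| := fun t => hγ0.trans_le (hb t).1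
  have hd1 : (4 : ℤ) ≤ |d| := by
    have h1 := hexp 1 0
    have h2 := hd 0
    rw [zero_add] at h2
    rw [h2, add_sub_cancel_left, sub_zero, abs_one, mul_one] at h1
    have h3 : (3 : ℝ) < ((|d| : ℤ) : ℝ) := by push_cast; linarith
    have h4 : (3 : ℤ) < |d| := by exact_mod_cast h3
    lia
  have hσd : σ * d = d.natAbs := by
    have h1 := hinc 0 1 zero_le_one
    have h2 := hd 0
    rw [zero_add] at h2
    rw [h2, mul_add] at h1
    have h3 : 0 ≤ σ * d := by linarith
    rw [Nat.cast_natAbs, Int.cast_abs, ← abs_of_nonneg h3, abs_mul, hσa, one_mul]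
  have hadd : ∀ y, g (y + d.natAbs) = g y + σ := fun y => by
    apply hinj
    rw [hfg, ← hσd]
    rcases hσ with h | h
    · rw [h, hd, hfg, one_mul]
    · have := hd (g y + -1)
      rw [neg_add_cancel_right, hfg] at this
      rw [h]; linarith
  have hper : ∀ t, deriv f (t + 1) = deriv f t := fun t => by
    rw [← deriv_comp_add_const f 1 t]
    have : (fun x => f (x + 1)) = fun x => f x + d := by funext x; exact hd x
    rw [this, deriv_add_const]
  have hperσ : ∀ t, deriv f (t + σ) = deriv f t := fun t => by
    rcases hσ with h | h
    · rw [h, hper]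
    · rw [h, ← hper]; congr 1; ring
  refine ⟨{ lift := f, inv := g, wt := fun y => 1 / |deriv f (g y)|, deg := d.natAbs, sgn := σ,
            sgn_eq := hσ, lift_inv := hfg, inv_lift := hgf, inv_deriv := fun y => ?_,
            inv_add := hadd, wt_add := fun y => by rw [hadd, hperσ],
            wt_ge := fun y => one_div_le_one_div_of_le (hpos _) (hb _).2,
            wt_le := fun y => one_div_le_one_div_of_le hγ0 (hb _).1,
            wt_lip := fun s t => ?_, lift_expand := hexp, inv_mono := fun s t hst => ?_,
            four_le := by rw [Int.abs_eq_natAbs] at hd1; exact_mod_cast hd1 }, hT⟩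
  · have h1 : HasDerivAt f (deriv f (g y)) (g y) := (hdiff _).hasDerivAt
    have h2 := h1.of_local_left_inverse hgc.continuousAt (abs_pos.1 (hpos _))
      (Eventually.of_forall hfg)
    have h3 : σ * (1 / |deriv f (g y)|) = (deriv f (g y))⁻¹ := by
      rw [← hs]
      rcases hσ with h | h
      · simp [h]
      · simp [h, inv_neg]
    rw [h3]
    exact h2
  · have p1 := hpos (g s)
    have p2 := hpos (g t)
    have e1 : 1 / |deriv f (g s)| - 1 / |deriv f (g t)| =
        (|deriv f (g t)| - |deriv f (g s)|) / (|deriv f (g s)| * |deriv f (g t)|) := by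
      field_simp
    have h1 : |(|deriv f (g t)| - |deriv f (g s)|)| ≤ K₁ * (1 / γ * |s - t|) := by
      refine (abs_abs_sub_abs_le_abs_sub _ _).trans ((hlip _ _).trans ?_)
      rw [abs_sub_comm]
      exact mul_le_mul_of_nonneg_left (hglip s t) hK₁
    rw [e1, abs_div, abs_of_pos (mul_pos p1 p2)]
    refine (div_le_div₀ ((abs_nonneg _).trans h1) h1 (mul_pos hγ0 hγ0)
      (mul_le_mul (hb _).1 (hb _).1 hγ0.le p1.le)).trans (le_of_eq ?_)
    field_simp
  · by_contra! hc
    have hsg : ∀ y, σ * f (g y) = σ * y := fun y => by rw [hfg]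
    rcases hσ with h | h
    · rw [h] at hc
      have := hinc (g t) (g s) (by linarith)
      rw [h, hfg, hfg] at this
      nlinarith
    · rw [h] at hc
      have := hinc (g s) (g t) (by linarith)
      rw [h, hfg, hfg] at this
      nlinarith

/-- The lift of an arc on which an expanding map is injective. -/
theorem exists_isGate {γ K Λ : ℝ} (c : Cover γ K Λ) (hγ : 3 < γ) {T : UnitAddCircle → UnitAddCircle}
    (hT : ∀ t : ℝ, T (t : UnitAddCircle) = (c.lift t : UnitAddCircle)) {W : Set UnitAddCircle}
    (hW : IsArc W) (hnt : W.Nontrivial) (hinj : Set.InjOn T W) :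
    ∃ a b : ℝ, IsGate ((fun t : ℝ => (t : UnitAddCircle)) ⁻¹' W) a b := by
  obtain ⟨I, hI, rfl⟩ := hW
  -- On a longer arc the point `u`, whose lifted image is one full turn beyond that of `s`, would
  -- lie in the arc at distance less than 1/3 from `s`, against injectivity.
  have hdiam : ∀ s ∈ I, ∀ t ∈ I, t - s ≤ 1 / 2 := by
    intro s hs t ht
    by_contra! hc
    set u := c.inv (c.lift s + c.sgn) with hu
    have hlu : c.lift u = c.lift s + c.sgn := c.lift_inv _
    have hσ : c.sgn * c.sgn = 1 := by rcases c.sgn_eq with h | h <;> simp [h]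
    have hσa : |c.sgn| = 1 := by rcases c.sgn_eq with h | h <;> simp [h]
    have h1 : s < u := by
      by_contra! h
      have h2 : c.sgn * c.lift u ≤ c.sgn * c.lift s := by
        rcases h.lt_or_eq with h3 | h3
        · exact (c.lift_strict _ _ h3).le
        · rw [h3]
      rw [hlu, mul_add, hσ] at h2
      linarith
    have h2 := c.lift_expand u s
    rw [hlu, add_sub_cancel_left, hσa, abs_of_pos (by linarith)] at h2
    have h3 : u - s < 1 / 3 := by nlinarith
    have huI : u ∈ I := hI.out hs ht ⟨h1.le, by linarith⟩
    have h4 : T (u : UnitAddCircle) = T (s : UnitAddCircle) := by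
      rw [hT, hT, coe_eq_coe_iff, hlu]
      rcases c.sgn_eq with h | h
      · exact ⟨1, by rw [h]; push_cast; ring⟩
      · exact ⟨-1, by rw [h]; push_cast; ring⟩
    have h5 := hinj ⟨u, huI, rfl⟩ ⟨s, hs, rfl⟩ h4
    obtain ⟨k, hk⟩ := (coe_eq_coe_iff _ _).1 h5
    have h6 : (0 : ℝ) < k := by linarith
    have h7 : (k : ℝ) < 1 := by linarith
    have h8 : (0 : ℤ) < k := by exact_mod_cast h6
    have h9 : k < (1 : ℤ) := by exact_mod_cast h7
    lia
  obtain ⟨s, hs, t, ht, hst⟩ : ∃ s ∈ I, ∃ t ∈ I, s < t := by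
    obtain ⟨x, ⟨s, hs, rfl⟩, y, ⟨t, ht, rfl⟩, hxy⟩ := hnt
    rcases lt_trichotomy s t with h | h | h
    · exact ⟨s, hs, t, ht, h⟩
    · rw [h] at hxy; exact absurd rfl hxy
    · exact ⟨t, ht, s, hs, h⟩
  have hne : I.Nonempty := ⟨s, hs⟩
  have hbb : BddBelow I := ⟨t - 1 / 2, fun x hx => by linarith [hdiam x hx t ht]⟩
  have hba : BddAbove I := ⟨s + 1 / 2, fun x hx => by linarith [hdiam s hs x hx]⟩
  have hlen : sSup I - sInf I ≤ 1 / 2 := by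
    have h1 : sSup I ≤ sInf I + 1 / 2 := csSup_le hne fun x hx => by
      have : x - 1 / 2 ≤ sInf I := le_csInf hne fun y hy => by linarith [hdiam y hy x hx]
      linarith
    linarith
  refine ⟨sInf I, sSup I, ?_, by linarith, fun t => ?_, ?_, fun t h1 h2 => ?_, fun t h1 h2 => ?_⟩
  · exact (csInf_le hbb hs).trans_lt (hst.trans_le (le_csSup hba ht))
  · have : ((t + 1 : ℝ) : UnitAddCircle) = (t : UnitAddCircle) := by simp
    simp only [Set.mem_preimage, this]
  · have : (fun t : ℝ => (t : UnitAddCircle)) ⁻¹' ((fun t : ℝ => (t : UnitAddCircle)) '' I) =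
        ⋃ k : ℤ, (fun t : ℝ => t + k) ⁻¹' I := by
      ext t
      simp only [Set.mem_preimage, Set.mem_image, Set.mem_iUnion]
      constructor
      · rintro ⟨s, hs, hst⟩
        obtain ⟨k, hk⟩ := (coe_eq_coe_iff _ _).1 hst
        exact ⟨k, by rw [← hk]; simpa using hs⟩
      · rintro ⟨k, hk⟩
        exact ⟨t + k, hk, coe_add_int t k⟩
    rw [this]
    exact MeasurableSet.iUnion fun k => (measurable_id.add_const _) hI.measurableSet
  · obtain ⟨x, hx, hxt⟩ := exists_lt_of_csInf_lt hne h1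
    obtain ⟨y, hy, hty⟩ := exists_lt_of_lt_csSup hne h2
    exact ⟨t, hI.out hx hy ⟨hxt.le, hty.le⟩, rfl⟩
  · rintro ⟨x, hx, hxt⟩
    obtain ⟨k, hk⟩ := (coe_eq_coe_iff _ _).1 hxt
    have h3 := csInf_le hbb hx
    have h4 := le_csSup hba hx
    rcases lt_trichotomy k 0 with h | h | h
    · have : (k : ℝ) ≤ -1 := by exact_mod_cast (by lia : k ≤ -1)
      linarith
    · rw [h, Int.cast_zero] at hk
      linarith
    · have : (1 : ℝ) ≤ k := by exact_mod_cast (by lia : 1 ≤ k)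
      linarith

/-- Hypotheses on a collection of maps and gates under which the variance grows linearly. -/
structure GoodFamily {m : ℕ} (E : Fin m → MapGate) (γ K K₁ : ℝ) : Prop where
  three_lt : 3 < γ
  bounds : ∀ i, ExpandingBounds γ K K₁ (E i).map
  arc : ∀ i, IsArc (E i).gate
  nontrivial : ∀ i, (E i).gate.Nontrivial
  injOn : ∀ i j, Set.InjOn (E i).map (E j).gate
  disjoint_one : ∀ i j, ∀ x ∈ (E i).gate, (E i).map x ∉ (E j).gate
  disjoint_two : ∀ i j, ∀ x ∈ (E i).gate, (E j).map ((E i).map x) ∉ (E i).gate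

theorem GoodFamily.exists_system {m : ℕ} [Nonempty (Fin m)] {E : Fin m → MapGate} {γ K K₁ : ℝ}
    (h : GoodFamily E γ K K₁) :
    ∃ (Λ ℓ : ℝ) (S : System (Fin m) γ K Λ ℓ),
      (∀ i, ∀ t : ℝ, (E i).map (t : UnitAddCircle) = ((S.cov i).lift t : UnitAddCircle)) ∧
      ∀ i, S.gate i = (fun t : ℝ => (t : UnitAddCircle)) ⁻¹' (E i).gate := by
  have hγ := h.three_lt
  choose c hc using fun i => exists_cover hγ (h.bounds i)
  choose a b hab using fun i => exists_isGate (c i) hγ (hc i) (h.arc i) (h.nontrivial i)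
    (h.injOn i i)
  obtain ⟨i₀⟩ := ‹Nonempty (Fin m)›
  -- Finiteness of the family gives one `ℓ` that works for all gates and gaps.
  obtain ⟨i₁, hi₁⟩ := Finite.exists_min fun i => min (b i - a i) (a i + 1 - b i)
  obtain ⟨f, -, -, hf, hlip⟩ := h.bounds i₀
  have hK₁ : 0 ≤ K₁ := by
    have := (abs_nonneg _).trans (hlip 1 0); simpa using this
  refine ⟨K₁ / γ ^ 3, min (b i₁ - a i₁) (a i₁ + 1 - b i₁), ⟨c, _, a, b, hab,
    fun i => (hi₁ i).trans (min_le_left _ _), fun i => (hi₁ i).trans (min_le_right _ _),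
    fun i j s hs t ht hst => ?_, hγ, by linarith [(hf 0).1.trans (hf 0).2], by positivity,
    lt_min (by linarith [(hab i₁).lt]) (by linarith [(hab i₁).lt_add])⟩, hc, fun i => rfl⟩
  rw [← coe_eq_coe_iff] at hst ⊢
  exact h.injOn i j hs ht (by rw [hc, hc, hst])

/-! ### The walk -/

/-- After a step backward the walk makes at least two steps forward. -/
structure NoDoubleBack (e : ℤ → MapGate) : Prop where
  one : ∀ n, ∀ x ∈ (e n).gate, (e n).map x ∉ (e (n - 1)).gate
  two : ∀ n, ∀ x ∈ (e n).gate, (e (n - 1)).map ((e n).map x) ∉ (e n).gate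

section Walk

variable {e : ℤ → MapGate}

theorem hitTime_eq {n : ℤ} {x : UnitAddCircle} {k : ℤ} {N : ℕ}
    (h : ((step e)^[N] (x, k)).2 = n) (h' : ∀ t < N, ((step e)^[t] (x, k)).2 ≠ n) :
    hitTime e n x k = N :=
  le_antisymm (Nat.sInf_le h) (le_csInf ⟨N, h⟩ fun t ht => by
    by_contra! hc
    exact h' t hc ht)

theorem step_of_notMem {n : ℤ} {x : UnitAddCircle} (h : x ∉ (e n).gate) :
    step e (x, n) = ((e n).map x, n + 1) := by simp [step, h]

theorem step_of_mem {n : ℤ} {x : UnitAddCircle} (h : x ∈ (e n).gate) :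
    step e (x, n) = ((e n).map x, n - 1) := by simp [step, h]

theorem passTime_of_notMem {n : ℤ} {x : UnitAddCircle} (h : x ∉ (e n).gate) :
    passTime e n x = 1 := by
  refine hitTime_eq (by simp [step_of_notMem h]) fun t ht => ?_
  interval_cases t
  simp

theorem iterate_step_of_mem (he : NoDoubleBack e) {n : ℤ} {x : UnitAddCircle}
    (h : x ∈ (e n).gate) : (step e)^[1] (x, n) = ((e n).map x, n - 1) ∧
      (step e)^[2] (x, n) = ((e (n - 1)).map ((e n).map x), n) ∧
      (step e)^[3] (x, n) = ((e n).map ((e (n - 1)).map ((e n).map x)), n + 1) := by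
  simp [Function.iterate_succ_apply', step_of_mem h, step_of_notMem (he.one n x h),
    step_of_notMem (he.two n x h)]

theorem passTime_of_mem (he : NoDoubleBack e) {n : ℤ} {x : UnitAddCircle} (h : x ∈ (e n).gate) :
    passTime e n x = 3 := by
  obtain ⟨h1, h2, h3⟩ := iterate_step_of_mem he h
  refine hitTime_eq (by rw [h3]) fun t ht => ?_
  interval_cases t
  · simp
  · rw [h1]; dsimp; lia
  · rw [h2]; dsimp; lia

theorem inducedMap_of_notMem {n : ℤ} {x : UnitAddCircle} (h : x ∉ (e n).gate) :
    inducedMap e n x = (e n).map x := by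
  simp [inducedMap, passTime_of_notMem h, step_of_notMem h]

theorem inducedMap_of_mem (he : NoDoubleBack e) {n : ℤ} {x : UnitAddCircle}
    (h : x ∈ (e n).gate) :
    inducedMap e n x = (e n).map ((e (n - 1)).map ((e n).map x)) := by
  rw [inducedMap, passTime_of_mem he h, (iterate_step_of_mem he h).2.2]

theorem passTime_spec (he : NoDoubleBack e) (n : ℤ) (x : UnitAddCircle) :
    (step e)^[passTime e n x] (x, n) = (inducedMap e n x, n + 1) ∧
      ∀ t < passTime e n x, ((step e)^[t] (x, n)).2 ≤ n := by
  by_cases h : x ∈ (e n).gate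
  · obtain ⟨h1, h2, h3⟩ := iterate_step_of_mem he h
    rw [passTime_of_mem he h, inducedMap_of_mem he h]
    refine ⟨h3, fun t ht => ?_⟩
    interval_cases t
    · simp
    · rw [h1]; dsimp; lia
    · rw [h2]
  · rw [passTime_of_notMem h, inducedMap_of_notMem h]
    refine ⟨by simp [step_of_notMem h], fun t ht => ?_⟩
    interval_cases t
    simp

/-- The internal state at the first visit to site `n` for the walk started at site `0`. -/
noncomputable def hitState (e : ℤ → MapGate) : ℕ → UnitAddCircle → UnitAddCircle
  | 0 => id
  | n + 1 => fun x => inducedMap e n (hitState e n x)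

/-- By `passTime_spec` the walk stays at or below site `n` until it first reaches `n + 1`, so the
passage times simply add up. -/
theorem hitTime_eq_sum (he : NoDoubleBack e) (n : ℕ) (x : UnitAddCircle) :
    hitTime e n x 0 = ∑ i ∈ Finset.range n, passTime e i (hitState e i x) := by
  have key : (step e)^[∑ i ∈ Finset.range n, passTime e i (hitState e i x)] (x, 0) =
      (hitState e n x, (n : ℤ)) ∧ ∀ t < ∑ i ∈ Finset.range n, passTime e i (hitState e i x),
        ((step e)^[t] (x, 0)).2 < n := by
    induction n with
    | zero => simp [hitState]
    | succ n ih =>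
      obtain ⟨h1, h2⟩ := ih
      obtain ⟨h3, h4⟩ := passTime_spec he n (hitState e n x)
      rw [Finset.sum_range_succ]
      set τ := ∑ i ∈ Finset.range n, passTime e i (hitState e i x)
      constructor
      · rw [add_comm, Function.iterate_add_apply, h1, h3]
        simp [hitState]
      · intro t ht
        push_cast
        rcases lt_or_ge t τ with h5 | h5
        · have := h2 t h5
          lia
        · obtain ⟨s, rfl⟩ := Nat.exists_eq_add_of_le' h5
          rw [Function.iterate_add_apply, h1]
          have := h4 s (by lia)
          lia
  refine hitTime_eq (by rw [key.1]) fun t ht => (key.2 t ht).ne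

end Walk

/-! ### Orbits of the lifted chain -/

namespace Chain

variable {ι : Type*} {γ K Λ ℓ b : ℝ} {S : System ι γ K Λ ℓ} (X : Chain S b)

/-- The state at time `j + l` as a function of the state at time `j`. -/
noncomputable def orbit (j : ℕ) : ℕ → ℝ → ℝ
  | 0 => id
  | l + 1 => fun t => X.ind (j + l) (orbit j l t)

theorem orbit_succ (j l : ℕ) (t : ℝ) : X.orbit j (l + 1) t = X.orbit (j + 1) l (X.ind j t) := by
  induction l with
  | zero => rfl
  | succ l ih =>
    simp only [orbit] at ih ⊢
    rw [ih, Nat.add_right_comm, add_assoc]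

theorem count_eq (j l : ℕ) (t : ℝ) :
    X.count j l t = ∑ i ∈ Finset.range l, X.visit (j + i) (X.orbit j i t) := by
  induction l generalizing j t with
  | zero => simp [count]
  | succ l ih =>
    rw [Finset.sum_range_succ']
    simp only [count, ih]
    rw [add_comm (X.visit j t)]
    congr 1
    exact Finset.sum_congr rfl fun i _ => by rw [orbit_succ, Nat.add_right_comm, add_assoc]

theorem count_obs (j l : ℕ) : Obs (X.count j l) := by
  induction l generalizing j with
  | zero => exact Obs.const 0
  | succ l ih => exact (X.visit_obs j).add (X.obs_ind j (ih (j + 1)))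

end Chain

/-- A function on the circle is measurable if its lift is. -/
theorem measurable_of_lift {F : UnitAddCircle → ℝ} (h : Measurable fun t : ℝ => F t) :
    Measurable F := by
  have h1 : F = (fun t : ℝ => F t) ∘ Subtype.val ∘ AddCircle.measurableEquivIoc (1 : ℝ) 0 := by
    funext x
    change F x = F (((AddCircle.equivIoc (1 : ℝ) 0 x : Set.Ioc (0 : ℝ) (0 + 1)) : ℝ) :
      UnitAddCircle)
    rw [AddCircle.coe_equivIoc]
  rw [h1]
  exact h.comp (measurable_subtype_coe.comp (AddCircle.measurableEquivIoc (1 : ℝ) 0).measurable)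

theorem integral_circle (F : UnitAddCircle → ℝ) :
    ∫ x : UnitAddCircle, F x = ∫ t in (0 : ℝ)..1, F t := by
  rw [← UnitAddCircle.intervalIntegral_preimage 0 F, zero_add]

/-- The factor 2 is the extra time that one visit to a gate costs. -/
theorem integral_sq_affine {f : ℝ → ℝ} {F : ℝ → ℝ} {a κ : ℝ} (h : ∀ t, F t = 2 * f t + a - κ) :
    ∫ t in (0 : ℝ)..1, F t ^ 2 = 4 * ∫ t in (0 : ℝ)..1, (f t - (κ - a) / 2) ^ 2 := by
  rw [← intervalIntegral.integral_const_mul]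
  refine intervalIntegral.integral_congr fun t _ => ?_
  simp only [h]; ring

/-! ### From the lifted chain to the two variances -/

namespace GoodFamily

variable {m : ℕ} {E : Fin m → MapGate} {γ K K₁ : ℝ}

theorem noDoubleBack (h : GoodFamily E γ K K₁) (ω : ℤ → Fin m) : NoDoubleBack (envOf E ω) :=
  ⟨fun _ x hx => h.disjoint_one _ _ x hx, fun _ x hx => h.disjoint_two _ _ x hx⟩

variable {Λ ℓ : ℝ} {S : System (Fin m) γ K Λ ℓ}

theorem coe_ind (h : GoodFamily E γ K K₁)
    (hmap : ∀ i, ∀ t : ℝ, (E i).map (t : UnitAddCircle) = ((S.cov i).lift t : UnitAddCircle))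
    (hgate : ∀ i, S.gate i = (fun t : ℝ => (t : UnitAddCircle)) ⁻¹' (E i).gate) (ω : ℤ → Fin m)
    (n : ℤ) (t : ℝ) :
    ((S.ind (ω n, ω (n - 1)) t : ℝ) : UnitAddCircle) =
      inducedMap (envOf E ω) n (t : UnitAddCircle) := by
  by_cases ht : t ∈ S.gate (ω n)
  · have ht' : (t : UnitAddCircle) ∈ (envOf E ω n).gate := by rw [hgate] at ht; exact ht
    rw [inducedMap_of_mem (h.noDoubleBack ω) ht', System.ind, if_pos ht]
    simp only [envOf, hmap]
  · have ht' : (t : UnitAddCircle) ∉ (envOf E ω n).gate := by rw [hgate] at ht; exact ht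
    rw [inducedMap_of_notMem ht', System.ind, if_neg ht]
    simp only [envOf, hmap]

theorem passTime_coe (h : GoodFamily E γ K K₁)
    (hgate : ∀ i, S.gate i = (fun t : ℝ => (t : UnitAddCircle)) ⁻¹' (E i).gate) (ω : ℤ → Fin m)
    (n : ℤ) (t : ℝ) :
    (passTime (envOf E ω) n (t : UnitAddCircle) : ℝ) =
      1 + 2 * (S.gate (ω n)).indicator 1 t := by
  by_cases ht : t ∈ S.gate (ω n)
  · have ht' : (t : UnitAddCircle) ∈ (envOf E ω n).gate := by rw [hgate] at ht; exact ht
    rw [passTime_of_mem (h.noDoubleBack ω) ht', Set.indicator_of_mem ht]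
    norm_num
  · have ht' : (t : UnitAddCircle) ∉ (envOf E ω n).gate := by rw [hgate] at ht; exact ht
    rw [passTime_of_notMem ht', Set.indicator_of_notMem ht]
    norm_num

/-- Both variances grow linearly, for every realization. -/
theorem variance_growth [Nonempty (Fin m)] (h : GoodFamily E γ K K₁) :
    ∃ C : ℝ, 0 < C ∧ ∀ ω : ℤ → Fin m, ∀ᶠ n : ℕ in atTop,
      C * n ≤ sigmaSq (envOf E ω) n ∧ C * n ≤ hitVar (envOf E ω) n := by
  obtain ⟨Λ, ℓ, S, hmap, hgate⟩ := h.exists_system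
  have hK := S.K_pos
  have ha := S.aperture_pos
  have hK3 : 1 / K ^ 3 ≤ 1 := by
    rw [div_le_one (by positivity)]; exact one_le_pow₀ S.one_le
  obtain ⟨C, hC, n₀, hgrow⟩ := S.count_growth (b := 1 / K ^ 3) (by positivity)
  refine ⟨C, hC, fun ω => ?_⟩
  filter_upwards [eventually_ge_atTop n₀] with n hn
  have hCn : 0 ≤ C * n := by positivity
  constructor
  -- In `sigmaSq` the gate of site `i` is evaluated at the state on arrival at site `i + 1`. The
  -- chain therefore starts from the density of `G_1 x` and at time `j` counts the gate of site `j +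
  -- 1` while applying the induced map of site `j + 2`.
  · set i₀ : Fin m × Fin m := (ω 1, ω 0) with hi₀
    have hone := Cone.one ha.le
    let X : Chain S (1 / K ^ 3) :=
      { idx := fun j => (ω (j + 2), ω (j + 1))
        obsIdx := fun j => ω (j + 1)
        init := S.op i₀ fun _ => 1
        cone := S.cone_op _ hone
        mass := by rw [S.integral_op _ hone.obs]; simp
        le_init := S.op_ge _ hone.nonneg hone.obs.per (s := 0) (t := 1) (by norm_num) zero_le_one
          fun _ _ _ => le_rfl }
    have horb : ∀ j : ℕ, ∀ t : ℝ, ((X.orbit 0 j (S.ind i₀ t) : ℝ) : UnitAddCircle) =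
        inducedComp (envOf E ω) (j + 1) (t : UnitAddCircle) := by
      intro j t
      induction j with
      | zero =>
        have := h.coe_ind hmap hgate ω 1 t
        simpa [Chain.orbit, inducedComp] using this
      | succ j ih =>
        have := h.coe_ind hmap hgate ω ((j + 1 : ℕ) + 1) (X.orbit 0 j (S.ind i₀ t))
        rw [ih] at this
        rw [inducedComp, Function.comp_apply, ← this, Chain.orbit, Chain.ind]
        have e1 : X.idx (0 + j) = (ω ((j + 1 : ℕ) + 1), ω ((j + 1 : ℕ) + 1 - 1)) := by
          simp only [X, zero_add, add_sub_cancel_right]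
          push_cast
          rw [add_assoc]; rfl
        rw [e1]
    have hpass : ∀ i : ℕ, ∀ t : ℝ,
        (passTime (envOf E ω) ((i + 1 : ℕ) : ℤ) (inducedComp (envOf E ω) (i + 1)
          (t : UnitAddCircle)) : ℝ) = 1 + 2 * X.visit (0 + i) (X.orbit 0 i (S.ind i₀ t)) := by
      intro i t
      rw [← horb, h.passTime_coe hgate, Chain.visit]
      simp only [X, zero_add]
      push_cast
      rfl
    set c : ℕ → ℝ := fun i => ∫ y : UnitAddCircle,
      (passTime (envOf E ω) i (inducedComp (envOf E ω) i y) : ℝ) with hc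
    have hsum : ∀ t : ℝ, ∑ i ∈ Finset.Icc 1 n, ((passTime (envOf E ω) i
        (inducedComp (envOf E ω) i (t : UnitAddCircle)) : ℝ) - c i) =
        2 * X.count 0 n (S.ind i₀ t) + n - ∑ i ∈ Finset.range n, c (i + 1) := by
      intro t
      rw [← Finset.Ico_add_one_right_eq_Icc, Finset.sum_Ico_eq_sum_range, Nat.add_sub_cancel,
        X.count_eq, Finset.mul_sum]
      have : (n : ℝ) = ∑ i ∈ Finset.range n, (1 : ℝ) := by simp
      rw [this, ← Finset.sum_add_distrib, ← Finset.sum_sub_distrib]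
      refine Finset.sum_congr rfl fun i _ => ?_
      rw [add_comm 1 i, hpass]
      ring
    rw [sigmaSq, integral_circle, integral_sq_affine hsum]
    set κ := (∑ i ∈ Finset.range n, c (i + 1) - n) / 2
    have h1 := hgrow X κ n hn
    have ho := (X.count_obs 0 n).sub (Obs.const κ)
    -- Duality undoes the first map: the average over the initial density is the average over
    -- uniform `x` composed with `G_1`.
    have h2 : ∫ t in (0 : ℝ)..1, X.init t * (X.count 0 n t - κ) ^ 2 =
        ∫ t in (0 : ℝ)..1, 1 * (X.count 0 n (S.ind i₀ t) - κ) ^ 2 :=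
      S.op_duality i₀ hone.obs (ψ := fun t => (X.count 0 n t - κ) ^ 2)
        (by simpa only [← pow_two] using ho.mul ho)
    simp only [one_mul] at h2
    rw [h2] at h1
    linarith
  -- For the hitting time the counted gate is that of the current site and the start is uniform; the
  -- lower bound 1 is relaxed to that of the other chain so that one constant serves both.
  · let X : Chain S (1 / K ^ 3) :=
      { idx := fun j => (ω j, ω (j - 1))
        obsIdx := fun j => ω j
        init := fun _ => 1
        cone := Cone.one ha.le
        mass := by simp
        le_init := fun _ => hK3 }
    have horb : ∀ j : ℕ, ∀ t : ℝ, ((X.orbit 0 j t : ℝ) : UnitAddCircle) =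
        hitState (envOf E ω) j (t : UnitAddCircle) := by
      intro j t
      induction j with
      | zero => rfl
      | succ j ih =>
        have := h.coe_ind hmap hgate ω j (X.orbit 0 j t)
        rw [ih] at this
        simp only [hitState, Chain.orbit, Chain.ind, zero_add]
        rw [← this]
    have hτ : ∀ t : ℝ, (hitTime (envOf E ω) n (t : UnitAddCircle) 0 : ℝ) =
        2 * X.count 0 n t + n := by
      intro t
      rw [hitTime_eq_sum (h.noDoubleBack ω), X.count_eq, Finset.mul_sum]
      have : (n : ℝ) = ∑ i ∈ Finset.range n, (1 : ℝ) := by simp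
      rw [this, ← Finset.sum_add_distrib]
      push_cast
      refine Finset.sum_congr rfl fun i _ => ?_
      rw [← horb, h.passTime_coe hgate, Chain.visit, zero_add]
      ring
    have hmeas : Measurable fun x : UnitAddCircle => (hitTime (envOf E ω) n x 0 : ℝ) := by
      apply measurable_of_lift
      simp only [hτ]
      exact ((X.count_obs 0 n).meas.const_mul 2).add_const _
    rw [hitVar, variance_eq_integral hmeas.aemeasurable, integral_circle,
      integral_sq_affine (f := X.count 0 n) (a := n)
        (κ := ∫ x : UnitAddCircle, (hitTime (envOf E ω) n x 0 : ℝ)) fun t => by rw [hτ]]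
    have h1 := hgrow X (((∫ x : UnitAddCircle, (hitTime (envOf E ω) n x 0 : ℝ)) - n) / 2) n hn
    simp only [X, one_mul] at h1
    linarith

theorem linearVarianceGrowth (h : GoodFamily E γ K K₁) (ν : Measure (Fin m))
    [IsProbabilityMeasure ν] : LinearVarianceGrowth E ν := by
  have : Nonempty (Fin m) := by
    obtain ⟨x, -⟩ := nonempty_of_measure_ne_zero (μ := ν) (s := Set.univ) (by simp)
    exact ⟨x⟩
  obtain ⟨C, hC, h1⟩ := h.variance_growth
  exact ⟨C, hC, Eventually.of_forall h1⟩

end GoodFamily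

/-! ### The two models -/

theorem norm_coe_le (t : ℝ) : ‖(t : UnitAddCircle)‖ ≤ |t| := by
  rw [UnitAddCircle.norm_eq]
  simpa using round_le t 0

theorem dist_coe_le (s t : ℝ) : dist (s : UnitAddCircle) (t : UnitAddCircle) ≤ |s - t| := by
  rw [dist_eq_norm, ← AddCircle.coe_sub]
  exact norm_coe_le _

theorem exists_lifts (x y : UnitAddCircle) :
    ∃ s t : ℝ, (s : UnitAddCircle) = x ∧ (t : UnitAddCircle) = y ∧ |s - t| = dist x y := by
  obtain ⟨s, rfl⟩ := QuotientAddGroup.mk_surjective x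
  obtain ⟨t, rfl⟩ := QuotientAddGroup.mk_surjective y
  refine ⟨s, t + round (s - t), rfl, coe_add_int t _, ?_⟩
  have : dist (s : UnitAddCircle) (t : UnitAddCircle) = |s - t - round (s - t)| := by
    rw [dist_eq_norm, ← AddCircle.coe_sub, UnitAddCircle.norm_eq]
  rw [← sub_sub]
  exact this.symm

/-! ### Distances and injectivity under derivative bounds -/

section Lipschitz

variable {γ K K₁ : ℝ} {T : UnitAddCircle → UnitAddCircle}

theorem ExpandingBounds.dist_le (h : ExpandingBounds γ K K₁ T) (x y : UnitAddCircle) :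
    dist (T x) (T y) ≤ K * dist x y := by
  obtain ⟨f, hf, hT, hb, -⟩ := h
  obtain ⟨s, t, rfl, rfl, hst⟩ := exists_lifts x y
  rw [hT, hT, ← hst]
  refine (dist_coe_le _ _).trans ?_
  have := Convex.norm_image_sub_le_of_norm_deriv_le (s := Set.univ) (C := K) (x := t) (y := s)
    (fun x _ => hf.differentiable one_ne_zero x) (fun x _ => (hb x).2) convex_univ trivial trivial
  exact this

theorem lift_injective {f : ℝ → ℝ} (hγ : 0 < γ) (hf : ContDiff ℝ 1 f)
    (hb : ∀ t, γ ≤ |deriv f t|) : Function.Injective f := by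
  have key : ∀ s t, s < t → f s ≠ f t := fun s t hst heq => by
    obtain ⟨c, -, hc⟩ := exists_deriv_eq_zero hst hf.continuous.continuousOn heq
    have := hb c
    rw [hc, abs_zero] at this
    linarith
  intro s t hst
  rcases lt_trichotomy s t with h | h | h
  · exact absurd hst (key s t h)
  · exact h
  · exact absurd hst.symm (key t s h)

/-- Lifts of two nearby points have images less than 1 apart, and an integer of absolute value less
than 1 is zero. -/
theorem ExpandingBounds.eq_of_dist_lt (h : ExpandingBounds γ K K₁ T) (hγ : 0 < γ)
    {x y : UnitAddCircle} (hxy : K * dist x y < 1) (hT : T x = T y) : x = y := by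
  obtain ⟨f, hf, hfT, hb, -⟩ := h
  obtain ⟨s, t, rfl, rfl, hst⟩ := exists_lifts x y
  rw [hfT, hfT, coe_eq_coe_iff] at hT
  obtain ⟨k, hk⟩ := hT
  have h1 := Convex.norm_image_sub_le_of_norm_deriv_le (s := Set.univ) (C := K) (x := t) (y := s)
    (fun x _ => hf.differentiable one_ne_zero x) (fun x _ => (hb x).2) convex_univ trivial trivial
  rw [Real.norm_eq_abs, Real.norm_eq_abs, hk, hst] at h1
  have h2 : |k| < 1 := by exact_mod_cast h1.trans_lt hxy
  rw [Int.abs_lt_one_iff.1 h2, Int.cast_zero, sub_eq_zero] at hk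
  rw [lift_injective hγ hf (fun t => (hb t).1) hk]

/-- An expanding map is injective on an arc disjoint from its image. -/
theorem ExpandingBounds.injOn_of_disjoint (h : ExpandingBounds γ K K₁ T) (hγ : 0 < γ)
    {W : Set UnitAddCircle} (hW : IsSegment W) (hd : T '' W ∩ W = ∅) : Set.InjOn T W := by
  obtain ⟨f, hf, hfT, hb, -⟩ := h
  obtain ⟨a, b, hab, rfl⟩ := hW
  have hinj := lift_injective hγ hf fun t => (hb t).1
  -- By the intermediate value theorem, a lifted image crossing a translate of `a` would send a
  -- point of the arc to the end point `a` of the arc. The image is thus confined between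
  -- consecutive translates and cannot contain two points differing by a nonzero integer.
  have hcover : ∀ s ∈ Set.Icc a b, ∀ t ∈ Set.Icc a b, ∀ l : ℤ, a + l ∉ Set.uIcc (f s) (f t) := by
    intro s hs t ht l hl
    obtain ⟨r, hr, hrl⟩ := intermediate_value_uIcc hf.continuous.continuousOn hl
    have hr' : r ∈ Set.Icc a b := Set.ordConnected_Icc.uIcc_subset hs ht hr
    have h1 : T (r : UnitAddCircle) = (a : UnitAddCircle) := by
      rw [hfT, hrl, coe_add_int]
    have : (a : UnitAddCircle) ∈ T '' ((fun t : ℝ => (t : UnitAddCircle)) '' Set.Icc a b) ∩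
        ((fun t : ℝ => (t : UnitAddCircle)) '' Set.Icc a b) :=
      ⟨⟨_, ⟨r, hr', rfl⟩, h1⟩, ⟨a, ⟨le_rfl, hab.le⟩, rfl⟩⟩
    rw [hd] at this
    exact this
  have key : ∀ s ∈ Set.Icc a b, ∀ t ∈ Set.Icc a b, ∀ k : ℤ, f s - f t = k → ¬ 0 < k := by
    intro s hs t ht k hk hk0
    have h1 : (1 : ℝ) ≤ k := by exact_mod_cast hk0
    obtain ⟨l, hl1, hl2⟩ := exists_mem_period (f t) a
    refine hcover s hs t ht l ?_
    rw [Set.mem_uIcc]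
    right
    constructor <;> linarith
  rintro _ ⟨s, hs, rfl⟩ _ ⟨t, ht, rfl⟩ hst
  simp only [hfT] at hst
  obtain ⟨k, hk⟩ := (coe_eq_coe_iff _ _).1 hst
  rcases lt_trichotomy k 0 with h | h | h
  · exact absurd (by lia) (key t ht s hs (-k) (by push_cast; linarith))
  · rw [h, Int.cast_zero, sub_eq_zero] at hk
    rw [hinj hk]
  · exact absurd h (key s hs t ht k hk)

end Lipschitz

/-- Turns the upper bound on the measure of a gate into a bound on the length of the interval above
it; the minimum with 1 accounts for intervals that wrap around. -/
theorem volume_arc_ge {I : Set ℝ} (hI : I.OrdConnected) {s t : ℝ} (hs : s ∈ I) (ht : t ∈ I) :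
    min (t - s) 1 ≤ volume.real ((fun t : ℝ => (t : UnitAddCircle)) '' I) := by
  rcases lt_or_ge t s with hst | hst
  · exact (min_le_left _ _).trans ((by linarith : t - s ≤ 0).trans measureReal_nonneg)
  set r := min (t - s) 1 with hr
  have hr0 : 0 ≤ r := le_min (by linarith) zero_le_one
  have hr1 : r ≤ t - s := min_le_left _ _
  set U := (fun t : ℝ => (t : UnitAddCircle)) '' Set.Icc s (s + r) with hU
  have hUI : U ⊆ (fun t : ℝ => (t : UnitAddCircle)) '' I :=
    Set.image_mono fun x hx => hI.out hs ht ⟨hx.1, by linarith [hx.2]⟩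
  have hUm : MeasurableSet U :=
    (isCompact_Icc.image (AddCircle.continuous_mk' 1)).isClosed.measurableSet
  have h1 : ENNReal.ofReal r ≤ volume U := by
    rw [AddCircle.add_projection_respects_measure 1 s hUm]
    have : volume (Set.Ioc s (s + r)) = ENNReal.ofReal r := by
      rw [Real.volume_Ioc]; congr 1; ring
    rw [← this]
    refine measure_mono fun x hx => ⟨⟨x, ⟨hx.1.le, hx.2⟩, rfl⟩, hx.1, hx.2.trans ?_⟩
    linarith [min_le_right (t - s) 1]
  have h2 : r ≤ volume.real U := by
    rw [measureReal_def, ← ENNReal.toReal_ofReal hr0]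
    exact ENNReal.toReal_mono (measure_ne_top _ _) h1
  exact h2.trans (measureReal_mono hUI)

/-- The upper bound on the gates gives `K * δ₀ < 1`, hence injectivity of every map on every gate;
the lower bound excludes gates with at most one point. -/
theorem goodFamily_of_modelA {γ K K₁ c δ₀ : ℝ} (hγ : 3 < γ) (hγK : γ ≤ K) (hc : 0 < c)
    (hδ : 0 < δ₀) (hδK : δ₀ ≤ 1 / (2 * K)) {m : ℕ} {E : Fin m → MapGate}
    (h : ∀ ω : ℤ → Fin m, ModelA γ K K₁ c δ₀ (envOf E ω)) : GoodFamily E γ K K₁ := by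
  have hK : 0 < K := by linarith
  have hδK' : K * δ₀ ≤ 1 / 2 := by
    rw [le_div_iff₀ (by positivity)] at hδK; linarith
  have hδ1 : δ₀ < 1 := by nlinarith
  have harc : ∀ i, IsArc (E i).gate := fun i => (h fun _ => i).arc 0
  refine ⟨hγ, fun i => (h fun _ => i).bounds 0, harc, fun i => ?_, fun i j => ?_,
    fun i j x hx hx' => ?_, fun i j x hx hx' => ?_⟩
  · by_contra hnt
    rw [Set.not_nontrivial_iff] at hnt
    have h1 := (h fun _ => i).gate_lower 0
    have h2 : volume.real (E i).gate = 0 := by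
      rcases hnt.eq_empty_or_singleton with h3 | ⟨x, h3⟩
      · rw [h3, measureReal_empty]
      · rw [h3, measureReal_def, ← Metric.closedBall_zero, AddCircle.volume_closedBall]
        simp
    have h3 := mul_pos hc hδ
    rw [envOf, h2] at h1
    linarith
  · have h1 := (h fun _ => j).gate_upper 0
    obtain ⟨I, hI, hW⟩ := harc j
    rw [envOf, hW] at h1
    rw [hW]
    have hdiam : ∀ s ∈ I, ∀ t ∈ I, t - s ≤ δ₀ := fun s hs t ht => by
      have h2 := (volume_arc_ge hI hs ht).trans h1
      rcases min_le_iff.1 h2 with h3 | h3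
      · exact h3
      · linarith
    rintro _ ⟨s, hs, rfl⟩ _ ⟨t, ht, rfl⟩ hst
    refine ((h fun _ => i).bounds 0).eq_of_dist_lt (by linarith) ?_ hst
    have h2 : dist (s : UnitAddCircle) (t : UnitAddCircle) ≤ δ₀ :=
      (dist_coe_le s t).trans (abs_le.2 ⟨by linarith [hdiam s hs t ht], hdiam t ht s hs⟩)
    have := mul_le_mul_of_nonneg_left h2 hK.le
    linarith
  -- All sequences are admissible, so any pair of indices can be placed at two neighbouring sites.
  · have h1 := (h fun n => if n = 0 then i else j).disjoint_one 0
    simp only [envOf, if_pos, zero_sub, show (-1 : ℤ) ≠ 0 by decide, if_false] at h1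
    exact Set.eq_empty_iff_forall_notMem.1 h1 _ ⟨⟨x, hx, rfl⟩, hx'⟩
  · have h1 := (h fun n => if n = 0 then i else j).disjoint_two 0
    simp only [envOf, if_pos, zero_sub, show (-1 : ℤ) ≠ 0 by decide, if_false] at h1
    exact Set.eq_empty_iff_forall_notMem.1 h1 _ ⟨⟨_, ⟨x, hx, rfl⟩, rfl⟩, hx'⟩

theorem ExpandingBounds.of_close {γ K K₁ δ : ℝ} {T T' : UnitAddCircle → UnitAddCircle}
    (h : ExpandingBounds γ K K₁ T) (h' : C1LipClose δ T' T) :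
    ExpandingBounds (γ - δ) (K + δ) (K₁ + δ) T' := by
  obtain ⟨f, hf, hT, hb, hlip⟩ := h
  obtain ⟨g, hg, -, hT', -, hb', hlip'⟩ := h'
  have hd : ∀ t, deriv (fun t => f t + g t) t = deriv f t + deriv g t := fun t =>
    deriv_fun_add (hf.differentiable one_ne_zero t) (hg.differentiable one_ne_zero t)
  refine ⟨fun t => f t + g t, hf.add hg, fun t => by rw [hT', hT, AddCircle.coe_add],
    fun t => ?_, fun s t => ?_⟩
  · rw [hd]
    have h1 := hb' t
    have h2 := abs_sub_abs_le_abs_sub (deriv f t) (-deriv g t)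
    rw [sub_neg_eq_add, abs_neg] at h2
    exact ⟨by linarith [(hb t).1], (abs_add_le _ _).trans (add_le_add (hb t).2 h1)⟩
  · rw [hd, hd, add_sub_add_comm, add_mul]
    exact (abs_add_le _ _).trans (add_le_add (hlip s t) (hlip' s t))

theorem ExpandingBounds.weaken {γ K K₁ γ' K' K₁' : ℝ} {T : UnitAddCircle → UnitAddCircle}
    (h : ExpandingBounds γ K K₁ T) (h1 : γ' ≤ γ) (h2 : K ≤ K') (h3 : K₁ ≤ K₁') :
    ExpandingBounds γ' K' K₁' T := by
  obtain ⟨f, hf, hT, hb, hlip⟩ := h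
  exact ⟨f, hf, hT, fun t => ⟨h1.trans (hb t).1, (hb t).2.trans h2⟩,
    fun s t => (hlip s t).trans (mul_le_mul_of_nonneg_right h3 (abs_nonneg _))⟩

theorem C1LipClose.dist_le {δ : ℝ} {T T' : UnitAddCircle → UnitAddCircle}
    (h : C1LipClose δ T' T) (x : UnitAddCircle) : dist (T' x) (T x) ≤ δ := by
  obtain ⟨g, -, -, hT', hg, -, -⟩ := h
  obtain ⟨t, rfl⟩ := QuotientAddGroup.mk_surjective x
  have := hT' t
  rw [dist_eq_norm]
  change ‖T' (t : UnitAddCircle) - T (t : UnitAddCircle)‖ ≤ δ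
  rw [this, add_sub_cancel_left]
  exact (norm_coe_le _).trans (hg t)

/-- Disjointness and injectivity for the reference pair are made quantitative by compactness, and
survive perturbations small compared with the resulting gaps. -/
theorem exists_goodFamily_of_modelB {T : UnitAddCircle → UnitAddCircle} {W : Set UnitAddCircle}
    (h : ModelBReference T W) : ∃ δbar : ℝ, 0 < δbar ∧ ∃ γ K K₁ : ℝ, ∀ δ₀ : ℝ, 0 < δ₀ →
      δ₀ ≤ δbar → ∀ (m : ℕ) (E : Fin m → MapGate),
        (∀ ω : ℤ → Fin m, ModelB T W δ₀ (envOf E ω)) → GoodFamily E γ K K₁ := by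
  obtain ⟨γ, K, K₁, hγ, hT⟩ := h.bounds
  have hK : 0 < K := by
    obtain ⟨f, -, -, hb, -⟩ := hT
    linarith [(hb 0).1.trans (hb 0).2]
  have hTc : Continuous T := (LipschitzWith.of_dist_le_mul (K := ⟨K, hK.le⟩)
    fun x y => hT.dist_le x y).continuous
  have hinj := hT.injOn_of_disjoint (by linarith) h.segment h.disjoint_one
  have hWc : IsCompact W := by
    obtain ⟨a, b, -, rfl⟩ := h.segment
    exact isCompact_Icc.image (AddCircle.continuous_mk' 1)
  obtain ⟨p, hp, q, hq, hpq⟩ : W.Nontrivial := by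
    obtain ⟨a, b, hab, rfl⟩ := h.segment
    refine ⟨a, ⟨a, ⟨le_rfl, hab.le⟩, rfl⟩, _, ⟨a + min (b - a) (1 / 2),
      ⟨by have := lt_min (sub_pos.2 hab) (one_half_pos (α := ℝ)); linarith,
        by linarith [min_le_left (b - a) (1 / 2)]⟩, rfl⟩, fun heq => ?_⟩
    obtain ⟨k, hk⟩ := (coe_eq_coe_iff _ _).1 heq
    have h1 := lt_min (sub_pos.2 hab) (one_half_pos (α := ℝ))
    have h2 := min_le_right (b - a) (1 / 2)
    have h3 : (k : ℝ) < 0 := by linarith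
    have h4 : (-1 : ℝ) < k := by linarith
    have h5 : k < 0 := by exact_mod_cast h3
    have h6 : -1 < k := by exact_mod_cast h4
    lia
  have hpq0 : 0 < dist p q := dist_pos.2 hpq
  obtain ⟨ρ₁, hρ₁, h1⟩ := (hWc.prod hWc).exists_forall_le' (f := fun p => dist (T p.1) p.2)
    (by fun_prop) (a := 0) fun p hp => dist_pos.2 fun heq =>
      Set.eq_empty_iff_forall_notMem.1 h.disjoint_one _ ⟨⟨p.1, hp.1, rfl⟩, heq ▸ hp.2⟩
  obtain ⟨ρ₂, hρ₂, h2⟩ := (hWc.prod hWc).exists_forall_le' (f := fun p => dist (T (T p.1)) p.2)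
    (by fun_prop) (a := 0) fun p hp => dist_pos.2 fun heq =>
      Set.eq_empty_iff_forall_notMem.1 h.disjoint_two _
        ⟨⟨_, ⟨p.1, hp.1, rfl⟩, rfl⟩, heq ▸ hp.2⟩
  -- Separation of images is required only for points at distance at least `1 / (2 * (K + 1))`;
  -- closer points are separated by local injectivity.
  have hSc : IsCompact ((W ×ˢ W) ∩ {p | 1 / (2 * (K + 1)) ≤ dist p.1 p.2}) :=
    (hWc.prod hWc).inter_right (isClosed_le continuous_const (by fun_prop))
  obtain ⟨ρ₃, hρ₃, h3⟩ := hSc.exists_forall_le' (f := fun p => dist (T p.1) (T p.2))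
    (by fun_prop) (a := 0) fun p hp => dist_pos.2 fun heq => by
      have h4 := hinj hp.1.1 hp.1.2 heq
      have h5 : 1 / (2 * (K + 1)) ≤ dist p.1 p.2 := hp.2
      rw [h4, dist_self] at h5
      have : 0 < 1 / (2 * (K + 1)) := by positivity
      linarith
  set ρ := min ρ₁ (min ρ₂ ρ₃) with hρ
  have hρ0 : 0 < ρ := lt_min hρ₁ (lt_min hρ₂ hρ₃)
  have e1 : ρ ≤ ρ₁ := min_le_left _ _
  have e2 : ρ ≤ ρ₂ := (min_le_right _ _).trans (min_le_left _ _)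
  have e3 : ρ ≤ ρ₃ := (min_le_right _ _).trans (min_le_right _ _)
  -- In order: uniform bounds with expansion still above 3, two points left in each gate,
  -- perturbation errors below the gap `ρ`, and `(K + 1) * dist x y < 1` for points whose references
  -- are close.
  refine ⟨min (min 1 ((γ - 3) / 2)) (min (dist p q / 2) (min (ρ / (2 * (K + 2) ^ 2))
    (1 / (8 * (K + 1))))), ?_, (γ + 3) / 2, K + 1, K₁ + 1, fun δ hδ hδb m E hE => ?_⟩
  · have : 0 < γ - 3 := by linarith
    positivity
  simp only [le_min_iff] at hδb
  obtain ⟨⟨d1, d2⟩, d3, d4, d5⟩ := hδb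
  rw [le_div_iff₀ (by positivity)] at d4 d5
  have hclose : ∀ i, C1LipClose δ (E i).map T := fun i => (hE fun _ => i).close 0
  have hdist : ∀ i x, dist ((E i).map x) (T x) ≤ δ := fun i => (hclose i).dist_le
  have hbounds : ∀ i, ExpandingBounds ((γ + 3) / 2) (K + 1) (K₁ + 1) (E i).map := fun i =>
    (hT.of_close (hclose i)).weaken (by linarith) (by linarith) (by linarith)
  have hH : ∀ i, Metric.hausdorffEDist (E i).gate W < ENNReal.ofReal δ :=
    fun i => (hE fun _ => i).gate_close 0
  have hnear : ∀ i, ∀ x ∈ (E i).gate, ∃ y ∈ W, dist x y < δ := fun i x hx => by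
    obtain ⟨y, hy, hxy⟩ := Metric.exists_edist_lt_of_hausdorffEDist_lt hx (hH i)
    exact ⟨y, hy, edist_lt_ofReal.1 hxy⟩
  have hnear' : ∀ i, ∀ x ∈ W, ∃ y ∈ (E i).gate, dist x y < δ := fun i x hx => by
    obtain ⟨y, hy, hxy⟩ := Metric.exists_edist_lt_of_hausdorffEDist_lt hx
      (Metric.hausdorffEDist_comm.trans_lt (hH i))
    exact ⟨y, hy, edist_lt_ofReal.1 hxy⟩
  have hTx : ∀ i x y, dist x y < δ → dist (T y) ((E i).map x) ≤ (K + 1) * δ := by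
    intro i x y hxy
    have k1 := hT.dist_le y x
    rw [dist_comm y x] at k1
    have k2 := mul_le_mul_of_nonneg_left hxy.le hK.le
    have k3 := hdist i x
    rw [dist_comm] at k3
    have k4 := dist_triangle (T y) (T x) ((E i).map x)
    linarith
  have hKδ : 0 < K * δ := mul_pos hK hδ
  have hKKδ : 0 < K * (K * δ) := mul_pos hK hKδ
  refine ⟨by linarith, hbounds, fun i => (hE fun _ => i).arc 0, fun i => ?_,
    fun i j x hx y hy hxy => ?_, fun i j x hx hx' => ?_, fun i j x hx hx' => ?_⟩
  · obtain ⟨x, hx, hpx⟩ := hnear' i p hp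
    obtain ⟨y, hy, hqy⟩ := hnear' i q hq
    refine ⟨x, hx, y, hy, fun heq => ?_⟩
    rw [← heq, dist_comm] at hqy
    have := dist_triangle p x q
    linarith
  · obtain ⟨x', hx', hxx⟩ := hnear j x hx
    obtain ⟨y', hy', hyy⟩ := hnear j y hy
    have k1 := hTx i x x' hxx
    have k2 := hTx i y y' hyy
    rw [← hxy] at k2
    have k3 := dist_triangle_right (T x') (T y') ((E i).map x)
    have k4 : dist (T x') (T y') < ρ := by nlinarith
    have k5 : dist x' y' < 1 / (2 * (K + 1)) := by
      by_contra! hc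
      have := h3 (x', y') ⟨⟨hx', hy'⟩, hc⟩
      simp only at this
      linarith
    have k6 := dist_triangle4 x x' y' y
    rw [dist_comm y' y] at k6
    refine (hbounds i).eq_of_dist_lt (by linarith) ?_ hxy
    rw [lt_div_iff₀ (by positivity)] at k5
    nlinarith
  · obtain ⟨x', hx1, hxx⟩ := hnear i x hx
    obtain ⟨z, hz, hzz⟩ := hnear j _ hx'
    have k1 := hTx i x x' hxx
    have k2 := dist_triangle (T x') ((E i).map x) z
    have k3 := h1 (x', z) ⟨hx1, hz⟩
    simp only at k3
    nlinarith
  · obtain ⟨x', hx1, hxx⟩ := hnear i x hx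
    obtain ⟨z, hz, hzz⟩ := hnear i _ hx'
    have k1 := hTx i x x' hxx
    have k2 := hT.dist_le (T x') ((E i).map x)
    have k3 := hdist j ((E i).map x)
    rw [dist_comm] at k3
    have k4 := dist_triangle4 (T (T x')) (T ((E i).map x)) ((E j).map ((E i).map x)) z
    have k5 := h2 (x', z) ⟨hx1, hz⟩
    have k6 := mul_le_mul_of_nonneg_left k1 hK.le
    simp only at k5
    nlinarith

end DynWalk

theorem lemma6p1 :
    (∀ γ K K₁ c : ℝ, 3 < γ → γ ≤ K → 0 < K₁ → 0 < c →
      ∃ δbar : ℝ, 0 < δbar ∧ ∀ δ₀ : ℝ, 0 < δ₀ → δ₀ ≤ δbar →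
        ∀ (m : ℕ) (E : Fin m → MapGate) (ν : Measure (Fin m)) [IsProbabilityMeasure ν],
          (∀ ω : ℤ → Fin m, DynWalk.ModelA γ K K₁ c δ₀ (DynWalk.envOf E ω)) →
            DynWalk.LinearVarianceGrowth E ν) ∧
    (∀ (T : UnitAddCircle → UnitAddCircle) (W : Set UnitAddCircle),
      DynWalk.ModelBReference T W →
      ∃ δbar : ℝ, 0 < δbar ∧ ∀ δ₀ : ℝ, 0 < δ₀ → δ₀ ≤ δbar →
        ∀ (m : ℕ) (E : Fin m → MapGate) (ν : Measure (Fin m)) [IsProbabilityMeasure ν],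
          (∀ ω : ℤ → Fin m, DynWalk.ModelB T W δ₀ (DynWalk.envOf E ω)) →
            DynWalk.LinearVarianceGrowth E ν) := by
  -- For model A it is enough that `K * δ₀ ≤ 1 / 2`, so that maps are injective on gates.
  refine ⟨fun γ K K₁ c hγ hγK hK₁ hc => ⟨1 / (2 * K), by
    have : 0 < K := by linarith
    positivity, ?_⟩, fun T W h => ?_⟩
  · intro δ₀ hδ hδK m E ν _ hE
    exact (DynWalk.goodFamily_of_modelA hγ hγK hc hδ hδK hE).linearVarianceGrowth ν
  · obtain ⟨δbar, hδbar, γ, K, K₁, hB⟩ := DynWalk.exists_goodFamily_of_modelB h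
    exact ⟨δbar, hδbar, fun δ₀ hδ hδb m E ν _ hE => (hB δ₀ hδ hδb m E hE).linearVarianceGrowth ν⟩
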